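/- Let $\mathbb{D}$ be the open unit disc, $\mathbb{T}$ the unit circle and $H^2$ the Hardy space of $\mathbb{D}$. For a finite positive Borel measure $\mu$ on $\mathbb{D}$ let $$G_\mu(z)=\int_{\mathbb{D}}\log\left|\frac{1-\overline{w}z}{z-w}\right|\,d\mu(w),\qquad \mathcal{D}_\mu(f)=\frac1\pi\int_{\mathbb{D}}|f'(z)|^2\,G_\mu(z)\,dx\,dy ,$$ and let $\mathcal{D}_\mu=\{f\in H^2:\mathcal{D}_\mu(f)<\infty\}$, with the Hilbert space norm given by $\|f\|_{\mathcal{D}_\mu}^2=\|f\|_{H^2}^2+\mathcal{D}_\mu(f)$. An invariant subspace of $\mathcal{D}_\mu$ is a closed linear subspace $\mathcal{M}$ such that $zf\in\mathcal{M}$ for every $f\in\mathcal{M}$. An inner function $I$ divides $f\in H^2$ if $f\in I H^2$, and $\mathcal{I}_{\mathcal{M}}$ denotes the greatest common inner divisor of $\mathcal{M}$: an inner function that divides every $f\in\mathcal{M}$ and is divisible by every inner function that divides every $f\in\mathcal{M}$ (it is unique up to a unimodular constant factor). Theorem. Let $\mu$ be a finite positive Borel measure on $\mathbb{D}$, and let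 $\mathcal{M}\neq\{0\}$ be an invariant subspace of $\mathcal{D}_\mu$. Then $\mathcal{M}$ has a greatest common inner divisor $\mathcal{I}_{\mathcal{M}}$, and $$\mathcal{M}=\mathcal{I}_{\mathcal{M}}H^2\cap\mathcal{D}_\mu .$$ -/

import Mathlib

namespace DirichletDisc

open MeasureTheory Filter Topology

/-- The open unit disc of the complex plane, as a type. -/
abbrev Disc : Type := ↥(Metric.ball (0 : ℂ) 1)

open Classical in
/-- The extension by zero to the plane of a function on the disc. -/
noncomputable def zeroExt (f : Disc → ℂ) : ℂ → ℂ := fun z =>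
  if h : z ∈ Metric.ball (0 : ℂ) 1 then f ⟨z, h⟩ else 0

/-- `f` is holomorphic on the unit disc. -/
def IsHolo (f : Disc → ℂ) : Prop :=
  DifferentiableOn ℂ (zeroExt f) (Metric.ball (0 : ℂ) 1)

/-- `‖f‖²` in the Hardy space `H²`: the supremum over `0 ≤ r < 1` of the mean of `|f|²` over the
circle of radius `r`. -/
noncomputable def hardyNormSq (f : Disc → ℂ) : ENNReal :=
  ⨆ r ∈ Set.Ico (0 : ℝ) 1,
    ENNReal.ofReal (2 * Real.pi)⁻¹ *
      ∫⁻ θ in Set.Ioc (0 : ℝ) (2 * Real.pi),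
        ‖zeroExt f ((r : ℂ) * Complex.exp ((θ : ℂ) * Complex.I))‖ₑ ^ 2

/-- The Hardy space `H²` of the unit disc. -/
def hardySpace : Set (Disc → ℂ) :=
  {f | IsHolo f ∧ hardyNormSq f < ⊤}

open Classical in
/-- The Green function `log |(1 - conj w * z) / (z - w)|` of the disc, equal to `∞` at `z = w`. -/
noncomputable def greenKernel (w : Disc) (z : ℂ) : ENNReal :=
  if z = (w : ℂ) then ⊤
  else ENNReal.ofReal (Real.log ‖(1 - (starRingEnd ℂ) (w : ℂ) * z) / (z - (w : ℂ))‖)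

/-- The Green potential `G_μ` of a positive Borel measure `μ` on the disc. -/
noncomputable def greenPotential (μ : Measure Disc) (z : ℂ) : ENNReal :=
  ∫⁻ w, greenKernel w z ∂μ

/-- The Dirichlet integral of `f` with weight `G_μ`, with respect to the normalized area measure
`dx dy / π` on the disc. -/
noncomputable def dirichletIntegral (μ : Measure Disc) (f : Disc → ℂ) : ENNReal :=
  ENNReal.ofReal Real.pi⁻¹ *
    ∫⁻ z in Metric.ball (0 : ℂ) 1, ‖deriv (zeroExt f) z‖ₑ ^ 2 * greenPotential μ z

/-- The weighted Dirichlet space `D_μ`. -/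
def dirichletSpace (μ : Measure Disc) : Set (Disc → ℂ) :=
  {f | f ∈ hardySpace ∧ dirichletIntegral μ f < ⊤}

/-- The square of the Hilbert space norm of `D_μ`. -/
noncomputable def dirichletNormSq (μ : Measure Disc) (f : Disc → ℂ) : ENNReal :=
  hardyNormSq f + dirichletIntegral μ f

/-- `M` is a closed linear subspace of `D_μ` that is invariant under multiplication by `z`. -/
structure IsInvariantSubspace (μ : Measure Disc) (M : Submodule ℂ (Disc → ℂ)) : Prop where
  subset : ∀ f ∈ M, f ∈ dirichletSpace μ
  closed : ∀ (g : ℕ → Disc → ℂ) (f : Disc → ℂ), (∀ n, g n ∈ M) → f ∈ dirichletSpace μ →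
    Tendsto (fun n => dirichletNormSq μ (g n - f)) atTop (𝓝 0) → f ∈ M
  shift : ∀ f ∈ M, (fun z : Disc => (z : ℂ) * f z) ∈ M

/-- `I` is an inner function: a holomorphic function on the disc, bounded by `1`, with unimodular
radial limits at almost every point of the unit circle. -/
structure IsInner (I : Disc → ℂ) : Prop where
  holo : IsHolo I
  bound : ∀ z, ‖I z‖ ≤ 1
  radial : ∀ᵐ θ : ℝ, ∃ ζ : ℂ, ‖ζ‖ = 1 ∧
    Tendsto (fun r : ℝ => zeroExt I ((r : ℂ) * Complex.exp ((θ : ℂ) * Complex.I)))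
      (𝓝[<] 1) (𝓝 ζ)

/-- The set `I H²` of the multiples of `I` in `H²`. For an inner function `I`, the functions of
`H²` that `I` divides are exactly the elements of `I H²`. -/
def innerMultiples (I : Disc → ℂ) : Set (Disc → ℂ) :=
  {f | ∃ h ∈ hardySpace, f = I * h}

/-- `I` is a greatest common inner divisor of `M`: an inner function that divides every element of
`M` and that is divisible by every inner function which divides every element of `M`. -/
structure IsGreatestCommonInnerDivisor (M : Submodule ℂ (Disc → ℂ)) (I : Disc → ℂ) : Prop where
  inner : IsInner I
  dvd : ∀ f ∈ M, f ∈ innerMultiples I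
  greatest : ∀ J : Disc → ℂ, IsInner J → (∀ f ∈ M, f ∈ innerMultiples J) → I ∈ innerMultiples J

end DirichletDisc

namespace DirichletDisc

open MeasureTheory Filter Topology

/-! The energy `dirichletIntegral μ f` is half the `μ`-integral of the local quantities `osc w f`,
the squared `H²` norms of `f ∘ mob w - f w`: this is the Littlewood-Paley formula, moved to the pole
`w` by a disc automorphism (`greenEnergy_eq_osc`). All estimates can then be made for one `w` at a
time, inside `H²`.

The theorem combines Beurling's theorem with the claim that `M` contains every function of `D_μ`
lying in its `H²`-closure (`IsInvariantSubspace.mem_of_tendsto_hardy`). For the claim, let `f_n ∈ M`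
tend to `f ∈ D_μ` in `H²`. The Herglotz transform `h` of the boundary values of `|f|²` is
holomorphic and `Re h ≥ |f|²`. With `t = 1 / (1 + ε h)`, the function `t f` is bounded by
`ε^(-1/2)`, and `osc w (t f) ≤ osc w f` (`osc_trunc_le`). Bounded functions lie in `D_μ`, with a
norm controlled by their bound, because `μ` is finite. So the truncations `t_n f_n` have bounded
`D_μ` norms and tend pointwise to `t f`; then `t f` tends to `f` as `ε → 0`, with norms at most that
of `f`. Neither limit leaves `M`, since `M` is closed under pointwise limits of norm-bounded
sequences (`IsInvariantSubspace.mem_of_tendsto`).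

That `t_n f_n` lies in `M` is an instance of `IsInvariantSubspace.mul_mem`: if `φ` is bounded and `φ
f ∈ D_μ`, then `φ f ∈ M`. Here `φ` is approximated by its dilates, and these by Taylor polynomials;
dilation increases `osc w` by at most a factor 4 (`osc_scale_le`), so the norms stay bounded.

Beurling's theorem (`exists_wandering`) writes the `H²`-closure of `M` as `p H²`, where `p` is
bounded by 1 and has norm 1; Fatou's theorem on radial limits shows that such a `p` is inner
(`isInner_ev`). It is a greatest common inner divisor because `J H²` is closed for inner `J`. Any
other greatest common inner divisor `I` is a multiple of `p`, so `I H²` lies in the closure as well,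
and the claim applies. -/

/-! ### Holomorphic functions on the disc and their power series -/

/-- The coefficients of the power series of `f` on the disc are `c`. -/
def HasCoeff (f : Disc → ℂ) (c : ℕ → ℂ) : Prop :=
  ∀ z : Disc, HasSum (fun n => c n * (z : ℂ) ^ n) (f z)

lemma Disc.norm_lt (z : Disc) : ‖(z : ℂ)‖ < 1 := by
  simpa only [mem_ball_zero_iff] using z.2

lemma zeroExt_of_mem (f : Disc → ℂ) {z : ℂ} (h : z ∈ Metric.ball (0 : ℂ) 1) :
    zeroExt f z = f ⟨z, h⟩ := by simp [zeroExt, h]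

@[simp] lemma zeroExt_coe (f : Disc → ℂ) (z : Disc) : zeroExt f z = f z :=
  zeroExt_of_mem f z.2

lemma isHolo_of_differentiableOn {F : ℂ → ℂ} {f : Disc → ℂ}
    (hF : DifferentiableOn ℂ F (Metric.ball 0 1)) (h : ∀ z : Disc, f z = F z) : IsHolo f :=
  hF.congr fun z hz => by rw [zeroExt_of_mem f hz, h]

lemma IsHolo.continuous {f : Disc → ℂ} (hf : IsHolo f) : Continuous f := by
  have := continuousOn_iff_continuous_domRestrict.1 (DifferentiableOn.continuousOn hf)
  exact this.congr fun z => zeroExt_coe f z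

lemma IsHolo.add {f g : Disc → ℂ} (hf : IsHolo f) (hg : IsHolo g) : IsHolo (f + g) :=
  isHolo_of_differentiableOn (DifferentiableOn.add hf hg) fun z => by simp

lemma IsHolo.sub {f g : Disc → ℂ} (hf : IsHolo f) (hg : IsHolo g) : IsHolo (f - g) :=
  isHolo_of_differentiableOn (DifferentiableOn.sub hf hg) fun z => by simp

lemma IsHolo.mul {f g : Disc → ℂ} (hf : IsHolo f) (hg : IsHolo g) : IsHolo (f * g) :=
  isHolo_of_differentiableOn (DifferentiableOn.mul hf hg) fun z => by simp

lemma IsHolo.smul {f : Disc → ℂ} (c : ℂ) (hf : IsHolo f) : IsHolo (c • f) :=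
  isHolo_of_differentiableOn (DifferentiableOn.const_smul hf c) fun z => by simp

lemma isHolo_const (c : ℂ) : IsHolo fun _ => c :=
  isHolo_of_differentiableOn (differentiableOn_const c) fun _ => rfl

lemma IsHolo.inv {f : Disc → ℂ} (hf : IsHolo f) (h0 : ∀ z, f z ≠ 0) :
    IsHolo fun z => (f z)⁻¹ :=
  isHolo_of_differentiableOn (DifferentiableOn.inv hf fun z hz => by
    rw [zeroExt_of_mem f hz]; exact h0 _) fun z => by simp

lemma IsHolo.exists_hasCoeff {f : Disc → ℂ} (hf : IsHolo f) : ∃ c, HasCoeff f c := by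
  refine ⟨fun n => (n.factorial : ℂ)⁻¹ * iteratedDeriv n (zeroExt f) 0, fun z => ?_⟩
  have := Complex.hasSum_taylorSeries_on_ball (f := zeroExt f) hf z.2
  simpa [mul_comm, mul_left_comm, mul_assoc] using this

/-- Convergence at a real point `r` with `‖z‖ < r < 1` is absolute, so the series converges
uniformly on the ball of radius `r`. -/
lemma HasCoeff.isHolo {f : Disc → ℂ} {c : ℕ → ℂ} (h : HasCoeff f c) : IsHolo f := by
  refine isHolo_of_differentiableOn (F := fun z => ∑' n, c n * z ^ n) ?_ fun z => (h z).tsum_eq.symm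
  intro z hz
  have hz1 : ‖z‖ < 1 := by simpa using hz
  obtain ⟨r, hr, hr1⟩ := exists_between hz1
  have hr0 : 0 ≤ r := (norm_nonneg z).trans hr.le
  have hs : Summable fun n => ‖c n‖ * r ^ n := by
    have := (h ⟨(r : ℂ), by simpa [abs_of_nonneg hr0] using hr1⟩).summable.norm
    simpa [abs_of_nonneg hr0] using this
  have hd : DifferentiableOn ℂ (fun z => ∑' n, c n * z ^ n) (Metric.ball 0 r) := by
    refine Complex.differentiableOn_tsum_of_summable_norm hs (fun n => by fun_prop)
      Metric.isOpen_ball fun n w hw => ?_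
    rw [norm_mul, norm_pow]
    gcongr
    simpa using (by simpa using hw : ‖w‖ < r).le
  exact (hd.differentiableAt (Metric.isOpen_ball.mem_nhds (by simpa using hr))).differentiableWithinAt

lemma HasCoeff.add {f g : Disc → ℂ} {c d : ℕ → ℂ} (hf : HasCoeff f c) (hg : HasCoeff g d) :
    HasCoeff (f + g) (c + d) := fun z => by
  simpa [add_mul] using (hf z).add (hg z)

lemma HasCoeff.sub {f g : Disc → ℂ} {c d : ℕ → ℂ} (hf : HasCoeff f c) (hg : HasCoeff g d) :
    HasCoeff (f - g) (c - d) := fun z => by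
  simpa [sub_mul] using (hf z).sub (hg z)

/-! ### Circle means and the Hardy norm -/

/-- The mean of `|f|²` over the circle of radius `r`. -/
noncomputable def circleSq (f : Disc → ℂ) (r : ℝ) : ENNReal :=
  ENNReal.ofReal (2 * Real.pi)⁻¹ *
      ∫⁻ θ in Set.Ioc (0 : ℝ) (2 * Real.pi),
        ‖zeroExt f ((r : ℂ) * Complex.exp ((θ : ℂ) * Complex.I))‖ₑ ^ 2

lemma hardyNormSq_eq_iSup (f : Disc → ℂ) : hardyNormSq f = ⨆ r ∈ Set.Ico (0 : ℝ) 1, circleSq f r :=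
  rfl

lemma circle_mem {r : ℝ} (h0 : 0 ≤ r) (h1 : r < 1) (θ : ℝ) :
    (r : ℂ) * Complex.exp ((θ : ℂ) * Complex.I) ∈ Metric.ball (0 : ℂ) 1 := by
  simpa [Complex.norm_exp_ofReal_mul_I, abs_of_nonneg h0] using h1

/-- The point of the disc with polar coordinates `r` and `θ`. -/
noncomputable def polarPt {r : ℝ} (h0 : 0 ≤ r) (h1 : r < 1) (θ : ℝ) : Disc :=
  ⟨(r : ℂ) * Complex.exp ((θ : ℂ) * Complex.I), circle_mem h0 h1 θ⟩

lemma continuous_polarPt {r : ℝ} (h0 : 0 ≤ r) (h1 : r < 1) : Continuous (polarPt h0 h1) := by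
  unfold polarPt; fun_prop

lemma circleSq_eq (f : Disc → ℂ) {r : ℝ} (h0 : 0 ≤ r) (h1 : r < 1) :
    circleSq f r = ENNReal.ofReal (2 * Real.pi)⁻¹ *
      ∫⁻ θ in Set.Ioc (0 : ℝ) (2 * Real.pi), ‖f (polarPt h0 h1 θ)‖ₑ ^ 2 := by
  simp only [circleSq, zeroExt_of_mem f (circle_mem h0 h1 _), polarPt]

lemma integral_exp_int_mul (k : ℤ) :
    ∫ θ in Set.Ioc (0 : ℝ) (2 * Real.pi), Complex.exp ((k : ℂ) * θ * Complex.I) =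
      if k = 0 then 2 * (Real.pi : ℂ) else 0 := by
  rw [← intervalIntegral.integral_of_le (by positivity)]
  split_ifs with h
  · simp [h]
  · have h2 : (k : ℂ) * Complex.I ≠ 0 := by simp [h]
    have : ∀ θ : ℝ, Complex.exp ((k : ℂ) * θ * Complex.I) = Complex.exp ((k * Complex.I) * θ) := by
      intro θ; congr 1; ring
    simp_rw [this]
    rw [integral_exp_mul_complex h2]
    have : (k : ℂ) * Complex.I * ((2 * Real.pi : ℝ) : ℂ) = k * (2 * Real.pi * Complex.I) := by
      push_cast; ring
    rw [this, Complex.exp_int_mul_two_pi_mul_I]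
    simp

lemma hasSum_mul_conj {u : ℕ → ℂ} {x : ℂ} (h : HasSum u x) :
    HasSum (fun p : ℕ × ℕ => u p.1 * (starRingEnd ℂ) (u p.2)) ((‖x‖ ^ 2 : ℝ) : ℂ) := by
  have hn : Summable fun n => ‖(starRingEnd ℂ) (u n)‖ := by simpa using h.summable.norm
  have hx : ((‖x‖ ^ 2 : ℝ) : ℂ) = x * (starRingEnd ℂ) x := by
    rw [Complex.mul_conj, Complex.normSq_eq_norm_sq]
  rw [hx]
  exact HasSum.mul (f := u) (g := fun n => (starRingEnd ℂ) (u n)) h (Complex.hasSum_conj'.2 h)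
    (summable_mul_of_summable_norm (f := u) (g := fun n => (starRingEnd ℂ) (u n)) h.summable.norm hn)

/-- Parseval: `|f|²` is an absolutely convergent double series, and orthogonality of the
exponentials leaves only its diagonal. -/
lemma HasCoeff.integral_normSq {f : Disc → ℂ} {c : ℕ → ℂ} (h : HasCoeff f c) {r : ℝ} (h0 : 0 ≤ r)
    (h1 : r < 1) :
    HasSum (fun n => ‖c n‖ ^ 2 * r ^ (2 * n))
      ((2 * Real.pi)⁻¹ * ∫ θ in Set.Ioc (0 : ℝ) (2 * Real.pi), ‖f (polarPt h0 h1 θ)‖ ^ 2) := by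
  have hs : Summable fun n => ‖c n‖ * r ^ n := by
    have := (h ⟨(r : ℂ), by simpa [abs_of_nonneg h0] using h1⟩).summable.norm
    simpa [abs_of_nonneg h0] using this
  let F : ℕ × ℕ → ℝ → ℂ := fun p θ =>
    (c p.1 * (r * Complex.exp (θ * Complex.I)) ^ p.1) *
      (starRingEnd ℂ) (c p.2 * (r * Complex.exp (θ * Complex.I)) ^ p.2)
  have hFn : ∀ p θ, ‖F p θ‖ = (‖c p.1‖ * r ^ p.1) * (‖c p.2‖ * r ^ p.2) := by
    intro p θ
    simp [F, Complex.norm_exp_ofReal_mul_I, abs_of_nonneg h0]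
  have hF : ∀ p θ, F p θ = (c p.1 * r ^ p.1) * (starRingEnd ℂ) (c p.2 * r ^ p.2) *
      Complex.exp (((p.1 - p.2 : ℤ) : ℂ) * θ * Complex.I) := by
    intro p θ
    have : Complex.exp (((p.1 - p.2 : ℤ) : ℂ) * θ * Complex.I) =
        Complex.exp (θ * Complex.I) ^ p.1 * (starRingEnd ℂ) (Complex.exp (θ * Complex.I)) ^ p.2 := by
      rw [← Complex.exp_conj, ← Complex.exp_nat_mul, ← Complex.exp_nat_mul, ← Complex.exp_add]
      congr 1
      simp
      ring
    rw [this]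
    simp only [F, map_mul, map_pow, mul_pow, Complex.conj_ofReal]
    ring
  have hsum : ∀ θ, HasSum (fun p => F p θ) ((‖f (polarPt h0 h1 θ)‖ ^ 2 : ℝ) : ℂ) := by
    intro θ
    exact hasSum_mul_conj (u := fun n => c n * (r * Complex.exp (θ * Complex.I)) ^ n) (h (polarPt h0 h1 θ))
  have hint : ∀ p, Integrable (F p) (volume.restrict (Set.Ioc (0 : ℝ) (2 * Real.pi))) := by
    intro p
    refine (Continuous.integrableOn_Icc ?_).mono_set Set.Ioc_subset_Icc_self
    fun_prop
  have hval : ∀ p : ℕ × ℕ, ∫ θ in Set.Ioc (0 : ℝ) (2 * Real.pi), F p θ =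
      if p.1 = p.2 then (((2 * Real.pi) * (‖c p.1‖ ^ 2 * r ^ (2 * p.1)) : ℝ) : ℂ) else 0 := by
    intro p
    simp_rw [hF]
    rw [integral_const_mul, integral_exp_int_mul]
    by_cases hp : p.1 = p.2
    · rw [if_pos (by omega), if_pos hp, hp, Complex.mul_conj, Complex.normSq_eq_norm_sq, norm_mul,
        norm_pow, Complex.norm_of_nonneg h0]
      push_cast; ring
    · have : ¬ ((p.1 : ℤ) - p.2 = 0) := by omega
      simp [hp, this]
  have hnorm : Summable fun p => ∫ θ in Set.Ioc (0 : ℝ) (2 * Real.pi), ‖F p θ‖ := by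
    simp_rw [hFn]
    have := (hs.mul_of_nonneg hs (fun n => by positivity) (fun n => by positivity))
    simpa [Real.pi_nonneg] using this.mul_left (2 * Real.pi)
  have key := hasSum_integral_of_summable_integral_norm hint hnorm
  simp_rw [fun θ => (hsum θ).tsum_eq, hval] at key
  have hinj : Function.Injective (fun n : ℕ => (n, n)) := fun a b hab => (Prod.ext_iff.1 hab).1
  rw [← hinj.hasSum_iff] at key
  · rw [integral_complex_ofReal] at key
    have k2 : HasSum (fun n => (2 * Real.pi) * (‖c n‖ ^ 2 * r ^ (2 * n)))
        (∫ θ in Set.Ioc (0 : ℝ) (2 * Real.pi), ‖f (polarPt h0 h1 θ)‖ ^ 2) := by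
      simpa [Function.comp_def, ← Complex.hasSum_ofReal] using key
    have := k2.mul_left (2 * Real.pi)⁻¹
    have h2 : (2 * Real.pi)⁻¹ * (2 * Real.pi) = 1 := inv_mul_cancel₀ (by positivity)
    simpa [← mul_assoc, h2] using this
  · rintro ⟨m, n⟩ hmn
    have : m ≠ n := fun e => hmn ⟨m, by simp [e]⟩
    simp [this]

lemma HasCoeff.circleSq_eq {f : Disc → ℂ} {c : ℕ → ℂ} (h : HasCoeff f c) {r : ℝ} (h0 : 0 ≤ r)
    (h1 : r < 1) : circleSq f r = ∑' n, ENNReal.ofReal (‖c n‖ ^ 2 * r ^ (2 * n)) := by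
  have key := h.integral_normSq h0 h1
  rw [DirichletDisc.circleSq_eq f h0 h1, ← ENNReal.ofReal_tsum_of_nonneg (fun n => by positivity) key.summable,
    key.tsum_eq, ENNReal.ofReal_mul (by positivity), ofReal_integral_eq_lintegral_ofReal]
  · simp_rw [ENNReal.ofReal_pow (norm_nonneg _), ofReal_norm]
  · refine (Continuous.integrableOn_Icc ?_).mono_set Set.Ioc_subset_Icc_self
    exact ((h.isHolo.continuous.comp (continuous_polarPt h0 h1)).norm.pow 2)
  · exact Eventually.of_forall fun _ => by positivity

lemma circleSq_le_hardyNormSq (f : Disc → ℂ) {r : ℝ} (h0 : 0 ≤ r) (h1 : r < 1) :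
    circleSq f r ≤ hardyNormSq f := by
  rw [hardyNormSq_eq_iSup]
  exact le_iSup₂ (f := fun r (_ : r ∈ Set.Ico (0 : ℝ) 1) => circleSq f r) r ⟨h0, h1⟩

lemma hardyNormSq_le {f : Disc → ℂ} {C : ENNReal}
    (h : ∀ r, 0 ≤ r → r < 1 → circleSq f r ≤ C) : hardyNormSq f ≤ C := by
  rw [hardyNormSq_eq_iSup]
  exact iSup₂_le fun r hr => h r hr.1 hr.2

/-- Each circle mean is bounded by the sum term by term; conversely every finite partial sum is a
limit of partial sums of circle means as `r → 1`. -/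
lemma HasCoeff.hardyNormSq_eq {f : Disc → ℂ} {c : ℕ → ℂ} (h : HasCoeff f c) :
    hardyNormSq f = ∑' n, ENNReal.ofReal (‖c n‖ ^ 2) := by
  apply le_antisymm
  · refine hardyNormSq_le fun r h0 h1 => ?_
    rw [h.circleSq_eq h0 h1]
    refine ENNReal.tsum_le_tsum fun n => ENNReal.ofReal_le_ofReal ?_
    exact mul_le_of_le_one_right (by positivity) (pow_le_one₀ h0 h1.le)
  · rw [ENNReal.tsum_eq_iSup_sum]
    refine iSup_le fun s => ?_
    have ht : Tendsto (fun r : ℝ => ∑ n ∈ s, ENNReal.ofReal (‖c n‖ ^ 2 * r ^ (2 * n))) (𝓝[<] 1)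
        (𝓝 (∑ n ∈ s, ENNReal.ofReal (‖c n‖ ^ 2))) := by
      refine tendsto_finsetSum _ fun n _ => ?_
      have : Continuous fun r : ℝ => ENNReal.ofReal (‖c n‖ ^ 2 * r ^ (2 * n)) :=
        ENNReal.continuous_ofReal.comp (by fun_prop)
      simpa using (this.tendsto 1).mono_left nhdsWithin_le_nhds
    refine le_of_tendsto ht ?_
    filter_upwards [Ioo_mem_nhdsLT (show (0 : ℝ) < 1 by norm_num)] with r hr
    refine le_trans ?_ (circleSq_le_hardyNormSq f hr.1.le hr.2)
    rw [h.circleSq_eq hr.1.le hr.2]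
    exact ENNReal.sum_le_tsum s

lemma HasCoeff.congr_coeff {f : Disc → ℂ} {c d : ℕ → ℂ} (hc : HasCoeff f c) (hd : HasCoeff f d) :
    c = d := by
  have h := (hc.sub hd).hardyNormSq_eq
  have h0 : HasCoeff (f - f) 0 := fun z => by simp
  rw [h0.hardyNormSq_eq] at h
  have h' : ∑' n, ENNReal.ofReal (‖(c - d) n‖ ^ 2) = 0 := by rw [← h]; simp
  funext n
  have := ENNReal.tsum_eq_zero.1 h' n
  have h3 : ‖c n - d n‖ ^ 2 ≤ 0 := by simpa using this
  have h4 : ‖c n - d n‖ = 0 := by nlinarith [norm_nonneg (c n - d n)]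
  exact sub_eq_zero.1 (norm_eq_zero.1 h4)

lemma circleSq_mono {f g : Disc → ℂ} (h : ∀ z, ‖f z‖ ≤ ‖g z‖) {r : ℝ} (h0 : 0 ≤ r) (h1 : r < 1) :
    circleSq f r ≤ circleSq g r := by
  rw [circleSq_eq f h0 h1, circleSq_eq g h0 h1]
  gcongr
  exact enorm_le_iff_norm_le.2 (h _)

lemma hardyNormSq_mono {f g : Disc → ℂ} (h : ∀ z, ‖f z‖ ≤ ‖g z‖) :
    hardyNormSq f ≤ hardyNormSq g :=
  hardyNormSq_le fun _ h0 h1 => (circleSq_mono h h0 h1).trans (circleSq_le_hardyNormSq g h0 h1)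

lemma circleSq_smul (c : ℂ) (f : Disc → ℂ) {r : ℝ} (h0 : 0 ≤ r) (h1 : r < 1) :
    circleSq (c • f) r = ‖c‖ₑ ^ 2 * circleSq f r := by
  rw [circleSq_eq _ h0 h1, circleSq_eq _ h0 h1]
  simp only [Pi.smul_apply, smul_eq_mul, enorm_mul, mul_pow]
  rw [lintegral_const_mul' _ _ (by simp)]
  ring

lemma hardyNormSq_smul_le (c : ℂ) (f : Disc → ℂ) :
    hardyNormSq (c • f) ≤ ‖c‖ₑ ^ 2 * hardyNormSq f :=
  hardyNormSq_le fun r h0 h1 => by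
    rw [circleSq_smul c f h0 h1]
    gcongr
    exact circleSq_le_hardyNormSq f h0 h1

lemma circleSq_one {r : ℝ} (h0 : 0 ≤ r) (h1 : r < 1) : circleSq (fun _ => 1) r = 1 := by
  rw [circleSq_eq _ h0 h1]
  simp only [enorm_one, one_pow, lintegral_const, MeasurableSet.univ, Measure.restrict_apply,
    Set.univ_inter, Real.volume_Ioc, sub_zero, one_mul]
  rw [← ENNReal.ofReal_mul (by positivity), inv_mul_cancel₀ (by positivity), ENNReal.ofReal_one]

lemma hardyNormSq_le_of_bound {f : Disc → ℂ} {C : ℝ} (h : ∀ z, ‖f z‖ ≤ C) :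
    hardyNormSq f ≤ ENNReal.ofReal (C ^ 2) := by
  have hC : 0 ≤ C := (norm_nonneg _).trans (h ⟨0, by simp⟩)
  refine hardyNormSq_le fun r h0 h1 => ?_
  calc circleSq f r ≤ circleSq ((C : ℂ) • fun _ => 1) r :=
        circleSq_mono (fun z => by simpa [abs_of_nonneg hC] using h z) h0 h1
    _ = _ := by
      rw [circleSq_smul _ _ h0 h1, circleSq_one h0 h1, mul_one, ENNReal.ofReal_pow hC,
        ← ofReal_norm, Complex.norm_of_nonneg hC]

lemma hardyNormSq_add_le {f g : Disc → ℂ} (hf : IsHolo f) :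
    hardyNormSq (f + g) ≤ 2 * hardyNormSq f + 2 * hardyNormSq g := by
  refine hardyNormSq_le fun r h0 h1 => ?_
  have h2 : ∀ x y : ℂ, ‖x + y‖ₑ ^ 2 ≤ 2 * ‖x‖ₑ ^ 2 + 2 * ‖y‖ₑ ^ 2 := by
    intro x y
    simp only [← ofReal_norm]
    rw [show (2 : ENNReal) = ENNReal.ofReal 2 by simp, ← ENNReal.ofReal_pow (norm_nonneg _),
      ← ENNReal.ofReal_pow (norm_nonneg _), ← ENNReal.ofReal_pow (norm_nonneg _),
      ← ENNReal.ofReal_mul (by norm_num), ← ENNReal.ofReal_mul (by norm_num),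
      ← ENNReal.ofReal_add (by positivity) (by positivity)]
    apply ENNReal.ofReal_le_ofReal
    nlinarith [norm_add_le x y, norm_nonneg (x + y), sq_nonneg (‖x‖ - ‖y‖)]
  calc circleSq (f + g) r ≤ 2 * circleSq f r + 2 * circleSq g r := by
        rw [circleSq_eq _ h0 h1, circleSq_eq _ h0 h1, circleSq_eq _ h0 h1,
          mul_left_comm 2, mul_left_comm 2, ← mul_add,
          ← lintegral_const_mul' (2 : ENNReal) (fun θ => ‖f (polarPt h0 h1 θ)‖ₑ ^ 2) (by simp),
          ← lintegral_const_mul' (2 : ENNReal) (fun θ => ‖g (polarPt h0 h1 θ)‖ₑ ^ 2) (by simp),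
          ← lintegral_add_left']
        · gcongr with θ
          exact h2 _ _
        · have := (hf.continuous.comp (continuous_polarPt h0 h1)).measurable
          exact ((this.enorm.pow_const 2).const_mul 2).aemeasurable
    _ ≤ _ := by
        gcongr
        exacts [circleSq_le_hardyNormSq f h0 h1, circleSq_le_hardyNormSq g h0 h1]

/-- On coefficients this is the parallelogram law of `ℂ`, summed over `n`. -/
lemma hardyNormSq_parallelogram {f g : Disc → ℂ} (hf : IsHolo f) (hg : IsHolo g) :
    hardyNormSq (f + g) + hardyNormSq (f - g) = 2 * hardyNormSq f + 2 * hardyNormSq g := by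
  obtain ⟨c, hc⟩ := hf.exists_hasCoeff
  obtain ⟨d, hd⟩ := hg.exists_hasCoeff
  rw [(hc.add hd).hardyNormSq_eq, (hc.sub hd).hardyNormSq_eq, hc.hardyNormSq_eq, hd.hardyNormSq_eq,
    ← ENNReal.tsum_mul_left, ← ENNReal.tsum_mul_left, ← ENNReal.tsum_add, ← ENNReal.tsum_add]
  congr 1 with n
  rw [show (2 : ENNReal) = ENNReal.ofReal 2 by simp, ← ENNReal.ofReal_mul (by norm_num),
    ← ENNReal.ofReal_mul (by norm_num), ← ENNReal.ofReal_add (by positivity) (by positivity),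
    ← ENNReal.ofReal_add (by positivity) (by positivity)]
  congr 1
  have := parallelogram_law_with_norm ℝ (c n) (d n)
  simp only [Pi.add_apply, Pi.sub_apply]
  nlinarith

/-- Lower semicontinuity of the Hardy norm under pointwise convergence. -/
lemma hardyNormSq_le_liminf {F : ℕ → Disc → ℂ} {f : Disc → ℂ} (hF : ∀ n, IsHolo (F n))
    (hlim : ∀ z, Tendsto (fun n => F n z) atTop (𝓝 (f z))) :
    hardyNormSq f ≤ liminf (fun n => hardyNormSq (F n)) atTop := by
  refine hardyNormSq_le fun r h0 h1 => ?_
  calc circleSq f r ≤ liminf (fun n => circleSq (F n) r) atTop := by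
        simp only [circleSq_eq _ h0 h1]
        have hm : ∀ n, Measurable fun θ => ‖F n (polarPt h0 h1 θ)‖ₑ ^ 2 := fun n =>
          ((hF n).continuous.comp (continuous_polarPt h0 h1)).measurable.enorm.pow_const 2
        have h2 : ∀ θ, ‖f (polarPt h0 h1 θ)‖ₑ ^ 2 =
            liminf (fun n => ‖F n (polarPt h0 h1 θ)‖ₑ ^ 2) atTop := fun θ =>
          (((ENNReal.continuous_pow 2).comp continuous_enorm).tendsto _ |>.comp
            (hlim (polarPt h0 h1 θ))).liminf_eq.symm
        simp_rw [h2]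
        refine (mul_le_mul_right (lintegral_liminf_le hm) _).trans ?_
        rw [ENNReal.liminf_const_mul_of_ne_top (by simp)]
    _ ≤ _ := liminf_le_liminf (Eventually.of_forall fun n => circleSq_le_hardyNormSq _ h0 h1)

/-! ### The Hardy space as a space of sequences; the shift -/

/-- The space of square summable coefficient sequences. -/
abbrev HSeq : Type := lp (fun _ : ℕ => ℂ) 2

lemma HSeq.hasSum_norm_sq (a : HSeq) : HasSum (fun n => ‖a n‖ ^ 2) (‖a‖ ^ 2) := by
  have := lp.hasSum_norm (by norm_num) a
  simpa using this

lemma memℓp_two_iff {c : ℕ → ℂ} : Memℓp c 2 ↔ Summable fun n => ‖c n‖ ^ 2 := by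
  rw [memℓp_gen_iff (by norm_num)]
  simp

lemma hasSum_geometric_sq (z : Disc) : HasSum (fun n => ‖(z : ℂ) ^ n‖ ^ 2) (1 - ‖(z : ℂ)‖ ^ 2)⁻¹ := by
  have h := z.norm_lt
  have := hasSum_geometric_of_lt_one (r := ‖(z : ℂ)‖ ^ 2) (by positivity)
    (by nlinarith [norm_nonneg (z : ℂ)])
  refine this.congr_fun ?_ |> id
  intro n
  rw [norm_pow, ← pow_mul, ← pow_mul, mul_comm]

lemma Disc.one_sub_sq_pos (z : Disc) : 0 < 1 - ‖(z : ℂ)‖ ^ 2 := by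
  nlinarith [norm_nonneg (z : ℂ), z.norm_lt]

/-- The coefficients of the reproducing kernel of the Hardy space. -/
noncomputable def kern (z : Disc) : HSeq :=
  ⟨fun n => (starRingEnd ℂ) (z : ℂ) ^ n, memℓp_two_iff.2 <| by
    simpa using (hasSum_geometric_sq z).summable⟩

lemma norm_kern_sq (z : Disc) : ‖kern z‖ ^ 2 = (1 - ‖(z : ℂ)‖ ^ 2)⁻¹ := by
  refine (HSeq.hasSum_norm_sq (kern z)).unique ?_
  simpa [kern] using hasSum_geometric_sq z

/-- The function on the disc with a given coefficient sequence. -/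
noncomputable def ev : HSeq →ₗ[ℂ] (Disc → ℂ) where
  toFun a z := inner ℂ (kern z) a
  map_add' a b := by ext z; simp
  map_smul' c a := by ext z; simp

lemma ev_apply (a : HSeq) (z : Disc) : ev a z = inner ℂ (kern z) a := rfl

lemma hasCoeff_ev (a : HSeq) : HasCoeff (ev a) a := fun z => by
  have := lp.hasSum_inner (𝕜 := ℂ) (kern z) a
  simpa [kern, ev_apply] using this

lemma isHolo_ev (a : HSeq) : IsHolo (ev a) := (hasCoeff_ev a).isHolo

lemma ev_injective : Function.Injective ev := fun a b h => by
  have h1 := hasCoeff_ev a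
  rw [h] at h1
  exact lp.ext (h1.congr_coeff (hasCoeff_ev b))

lemma hardyNormSq_ev (a : HSeq) : hardyNormSq (ev a) = ENNReal.ofReal (‖a‖ ^ 2) := by
  rw [(hasCoeff_ev a).hardyNormSq_eq, ← ENNReal.ofReal_tsum_of_nonneg (fun n => by positivity)
    (HSeq.hasSum_norm_sq a).summable, (HSeq.hasSum_norm_sq a).tsum_eq]

lemma ev_mem_hardySpace (a : HSeq) : ev a ∈ hardySpace :=
  ⟨isHolo_ev a, by rw [hardyNormSq_ev]; exact ENNReal.ofReal_lt_top⟩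

lemma HasCoeff.exists_ev {f : Disc → ℂ} {c : ℕ → ℂ} (h : HasCoeff f c) (hf : hardyNormSq f < ⊤) :
    ∃ a : HSeq, ev a = f ∧ ∀ n, a n = c n := by
  rw [h.hardyNormSq_eq] at hf
  have hs : Summable fun n => ‖c n‖ ^ 2 := by
    have := ENNReal.summable_toReal hf.ne
    simpa [ENNReal.toReal_ofReal, sq_nonneg] using this
  refine ⟨⟨c, memℓp_two_iff.2 hs⟩, ?_, fun n => rfl⟩
  funext z
  exact (hasCoeff_ev _ z).unique (h z)

lemma exists_ev {f : Disc → ℂ} (hf : f ∈ hardySpace) : ∃ a : HSeq, ev a = f := by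
  obtain ⟨c, hc⟩ := IsHolo.exists_hasCoeff hf.1
  obtain ⟨a, ha, -⟩ := hc.exists_ev hf.2
  exact ⟨a, ha⟩

/-- Cauchy-Schwarz against the reproducing kernel. -/
lemma norm_ev_sq_le (a : HSeq) (z : Disc) : (1 - ‖(z : ℂ)‖ ^ 2) * ‖ev a z‖ ^ 2 ≤ ‖a‖ ^ 2 := by
  have h1 : ‖ev a z‖ ≤ ‖kern z‖ * ‖a‖ := by
    rw [ev_apply]; exact norm_inner_le_norm _ _
  have h2 : ‖ev a z‖ ^ 2 ≤ (1 - ‖(z : ℂ)‖ ^ 2)⁻¹ * ‖a‖ ^ 2 := by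
    rw [← norm_kern_sq, ← mul_pow]
    gcongr
  have h3 := z.one_sub_sq_pos
  calc _ ≤ (1 - ‖(z : ℂ)‖ ^ 2) * ((1 - ‖(z : ℂ)‖ ^ 2)⁻¹ * ‖a‖ ^ 2) := by gcongr
    _ = _ := by rw [← mul_assoc, mul_inv_cancel₀ h3.ne', one_mul]

lemma tendsto_ev {ι : Type*} {l : Filter ι} {A : ι → HSeq} {a : HSeq} (h : Tendsto A l (𝓝 a)) (z : Disc) :
    Tendsto (fun i => ev (A i) z) l (𝓝 (ev a z)) :=
  (tendsto_const_nhds (x := kern z)).inner h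

lemma exists_ev_mul {φ : Disc → ℂ} (hφ : IsHolo φ) {C : ℝ} (hC : ∀ z, ‖φ z‖ ≤ C) (a : HSeq) :
    ∃ b : HSeq, ev b = φ * ev a ∧ ‖b‖ ≤ C * ‖a‖ := by
  have hC0 : 0 ≤ C := (norm_nonneg _).trans (hC ⟨0, by simp⟩)
  have hle : hardyNormSq (φ * ev a) ≤ ENNReal.ofReal ((C * ‖a‖) ^ 2) := by
    calc hardyNormSq (φ * ev a) ≤ hardyNormSq (ev ((C : ℂ) • a)) := hardyNormSq_mono fun z => by
          simp only [Pi.mul_apply, norm_mul, map_smul, Pi.smul_apply, norm_smul,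
            Complex.norm_of_nonneg hC0]
          gcongr
          exact hC z
      _ = _ := by rw [hardyNormSq_ev, norm_smul, Complex.norm_of_nonneg hC0]
  obtain ⟨b, hb⟩ := exists_ev (f := φ * ev a) ⟨hφ.mul (isHolo_ev a), hle.trans_lt ENNReal.ofReal_lt_top⟩
  refine ⟨b, hb, ?_⟩
  rw [← hb, hardyNormSq_ev, ENNReal.ofReal_le_ofReal_iff (by positivity)] at hle
  exact le_of_sq_le_sq hle (by positivity) |> id

/-- The coefficient sequence of `z * f`, where `f` has coefficients `c`. -/
def shiftSeq (c : ℕ → ℂ) : ℕ → ℂ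
  | 0 => 0
  | n + 1 => c n

lemma hasSum_shiftSeq_norm_sq (a : HSeq) : HasSum (fun n => ‖shiftSeq a n‖ ^ 2) (‖a‖ ^ 2) := by
  rw [← hasSum_nat_add_iff' 1]
  simpa [shiftSeq] using a.hasSum_norm_sq

/-- Multiplication by `z` on coefficient sequences. -/
noncomputable def shift : HSeq →ₗᵢ[ℂ] HSeq where
  toFun a := ⟨shiftSeq a, memℓp_two_iff.2 (hasSum_shiftSeq_norm_sq a).summable⟩
  map_add' a b := by
    ext n
    cases n
    · exact (add_zero (0 : ℂ)).symm
    · rfl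
  map_smul' c a := by ext n; cases n <;> simp [shiftSeq]
  norm_map' a := by
    have h1 := (HSeq.hasSum_norm_sq ⟨shiftSeq a,
      memℓp_two_iff.2 (hasSum_shiftSeq_norm_sq a).summable⟩).unique (hasSum_shiftSeq_norm_sq a)
    exact (sq_eq_sq₀ (norm_nonneg _) (norm_nonneg _)).1 h1

lemma shift_apply_succ (a : HSeq) (n : ℕ) : shift a (n + 1) = a n := rfl
lemma shift_apply_zero (a : HSeq) : shift a 0 = 0 := rfl

lemma ev_shift (a : HSeq) (z : Disc) : ev (shift a) z = z * ev a z := by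
  refine (hasCoeff_ev (shift a) z).unique ?_
  rw [← hasSum_nat_add_iff' 1]
  simp only [shift_apply_succ, Finset.range_one, Finset.sum_singleton, shift_apply_zero, zero_mul,
    sub_zero]
  refine ((hasCoeff_ev a z).mul_left (z : ℂ)).congr_fun ?_ |> id
  intro n
  ring

lemma ev_shift_pow (a : HSeq) (n : ℕ) (z : Disc) :
    ev ((shift.toContinuousLinearMap ^ n) a) z = z ^ n * ev a z := by
  induction n with
  | zero => simp
  | succ n ih =>
    rw [pow_succ', mul_apply_eq_comp, LinearIsometry.coe_toContinuousLinearMap, ev_shift,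
      ih]
    ring

lemma norm_smul_shift_lt (w : Disc) :
    ‖(starRingEnd ℂ) (w : ℂ) • shift.toContinuousLinearMap‖ < 1 := by
  refine lt_of_le_of_lt ?_ w.norm_lt
  rw [norm_smul, RCLike.norm_conj]
  exact mul_le_of_le_one_right (norm_nonneg _) (LinearIsometry.norm_toContinuousLinearMap_le _)

/-- Multiplication by `(1 - conj w * z)⁻¹` on coefficient sequences. -/
noncomputable def kmul (w : Disc) : HSeq →L[ℂ] HSeq :=
  ∑' n : ℕ, ((starRingEnd ℂ) (w : ℂ) • shift.toContinuousLinearMap) ^ n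

lemma kmul_sub (w : Disc) (a : HSeq) :
    kmul w a - (starRingEnd ℂ) (w : ℂ) • shift (kmul w a) = a := by
  have := mul_neg_geom_series _ (norm_smul_shift_lt w)
  have h2 := congrArg (fun T : HSeq →L[ℂ] HSeq => T a) this
  simpa [kmul, sub_mul] using h2

lemma one_sub_conj_mul_ne_zero (w z : Disc) : 1 - (starRingEnd ℂ) (w : ℂ) * z ≠ 0 := by
  intro h
  have h1 : ‖(starRingEnd ℂ) (w : ℂ) * z‖ = 1 := by rw [← sub_eq_zero.1 h]; simp
  rw [norm_mul, RCLike.norm_conj] at h1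
  nlinarith [w.norm_lt, z.norm_lt, norm_nonneg (w : ℂ), norm_nonneg (z : ℂ)]

lemma ev_kmul (w : Disc) (a : HSeq) (z : Disc) :
    ev (kmul w a) z = (1 - (starRingEnd ℂ) (w : ℂ) * z)⁻¹ * ev a z := by
  have h := congrArg (fun b => ev b z) (kmul_sub w a)
  simp only [map_sub, map_smul, Pi.sub_apply, Pi.smul_apply, ev_shift, smul_eq_mul] at h
  rw [← h]
  field_simp [one_sub_conj_mul_ne_zero w z]

/-! ### The Herglotz transform and harmonic majorants -/

/-- The Herglotz transform of `|f|²`, where `f` has coefficients `a`. -/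
noncomputable def herglotz (a : HSeq) (w : Disc) : ℂ :=
  2 * inner ℂ (kmul w a) a - (‖a‖ ^ 2 : ℝ)

/-- `kmul w a` is a power series in `conj w`, and the inner product conjugates its first argument:
the result is a power series in `w`. This makes `herglotz a` holomorphic. -/
lemma hasCoeff_inner_kmul (a b : HSeq) : HasCoeff (fun w => inner ℂ (kmul w a) b)
    fun n => inner ℂ ((shift.toContinuousLinearMap ^ n) a) b := by
  intro w
  have h1 := (summable_geometric_of_norm_lt_one (norm_smul_shift_lt w)).hasSum
  have h2 := h1.mapL (ContinuousLinearMap.apply ℂ HSeq a)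
  have h3 := (h2.mapL (innerSL ℂ b))
  have h4 := Complex.hasSum_conj'.2 h3
  simpa [smul_pow, inner_smul_right, kmul, mul_comm] using h4

lemma isHolo_herglotz (a : HSeq) : IsHolo (herglotz a) :=
  ((hasCoeff_inner_kmul a a).isHolo.smul 2).sub (isHolo_const _)

/-- Substitute `a = k - conj w • shift k` and use that `shift` is an isometry. The right-hand side
is the Poisson integral at `w` of the boundary values of `|f|²`, expressed without boundary values.
-/
lemma herglotz_re (a : HSeq) (w : Disc) :
    (herglotz a w).re = (1 - ‖(w : ℂ)‖ ^ 2) * ‖kmul w a‖ ^ 2 := by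
  set k := kmul w a with hk
  have ha : a = k - (starRingEnd ℂ) (w : ℂ) • shift k := (kmul_sub w a).symm
  have h1 : ‖a‖ ^ 2 = ‖k‖ ^ 2 - 2 * ((starRingEnd ℂ) (w : ℂ) * inner ℂ k (shift k)).re +
      ‖(w : ℂ)‖ ^ 2 * ‖k‖ ^ 2 := by
    conv_lhs => rw [ha]
    rw [@norm_sub_sq ℂ, inner_smul_right, norm_smul, RCLike.norm_conj, LinearIsometry.norm_map, mul_pow]
    rfl
  have h2 : (inner ℂ k a).re = ‖k‖ ^ 2 - ((starRingEnd ℂ) (w : ℂ) * inner ℂ k (shift k)).re := by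
    conv_lhs => rw [ha]
    rw [inner_sub_right, inner_smul_right, Complex.sub_re, inner_self_eq_norm_sq_to_K]
    norm_cast
  have h3 : (herglotz a w).re = 2 * (inner ℂ k a).re - ‖a‖ ^ 2 := by
    simp only [herglotz, ← hk, Complex.sub_re, Complex.ofReal_re, Complex.mul_re]
    simp
  rw [h3, h2, h1]; ring

/-- The point evaluation bound at `w`, applied to `kmul w a`, whose value there is `ev a w / (1 -
‖w‖²)`. -/
lemma norm_sq_le_herglotz_re (a : HSeq) (w : Disc) : ‖ev a w‖ ^ 2 ≤ (herglotz a w).re := by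
  have h := norm_ev_sq_le (kmul w a) w
  have h0 := w.one_sub_sq_pos
  have h1 : (1 - (starRingEnd ℂ) (w : ℂ) * w) = ((1 - ‖(w : ℂ)‖ ^ 2 : ℝ) : ℂ) := by
    rw [mul_comm, Complex.mul_conj, Complex.normSq_eq_norm_sq]; push_cast; rfl
  rw [ev_kmul, h1, norm_mul, norm_inv, Complex.norm_of_nonneg h0.le] at h
  rw [herglotz_re]
  calc ‖ev a w‖ ^ 2 = (1 - ‖(w : ℂ)‖ ^ 2) * ((1 - ‖(w : ℂ)‖ ^ 2) *
        ((1 - ‖(w : ℂ)‖ ^ 2)⁻¹ * ‖ev a w‖) ^ 2) := by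
        field_simp
    _ ≤ _ := by gcongr

lemma tendsto_herglotz {A : ℕ → HSeq} {a : HSeq} (h : Tendsto A atTop (𝓝 a)) (w : Disc) :
    Tendsto (fun n => herglotz (A n) w) atTop (𝓝 (herglotz a w)) := by
  have h1 := (((kmul w).continuous.tendsto a).comp h).inner (𝕜 := ℂ) h
  exact (h1.const_mul 2).sub ((Complex.continuous_ofReal.tendsto _).comp (h.norm.pow 2))

/-! ### Disc automorphisms acting on the Hardy space -/

/-- The centre of the disc. -/
def zeroPt : Disc := ⟨0, by simp⟩

@[simp] lemma coe_zeroPt : ((zeroPt : Disc) : ℂ) = 0 := rfl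

lemma norm_sq_one_sub_conj_mul_sub (w z : ℂ) :
    ‖1 - (starRingEnd ℂ) w * z‖ ^ 2 - ‖w - z‖ ^ 2 = (1 - ‖w‖ ^ 2) * (1 - ‖z‖ ^ 2) := by
  simp only [← Complex.normSq_eq_norm_sq, Complex.normSq_apply, Complex.sub_re, Complex.sub_im,
    Complex.mul_re, Complex.mul_im, Complex.conj_re, Complex.conj_im, Complex.one_re, Complex.one_im]
  ring

/-- The involution of the disc that exchanges `0` and `w`. -/
noncomputable def mob (w z : Disc) : Disc :=
  ⟨(w - z) / (1 - (starRingEnd ℂ) (w : ℂ) * z), by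
    have h := norm_sq_one_sub_conj_mul_sub w z
    have h1 := mul_pos w.one_sub_sq_pos z.one_sub_sq_pos
    rw [mem_ball_zero_iff, norm_div, div_lt_one (norm_pos_iff.2 (one_sub_conj_mul_ne_zero w z))]
    exact lt_of_pow_lt_pow_left₀ 2 (norm_nonneg _) (by linarith)⟩

lemma coe_mob (w z : Disc) :
    (mob w z : ℂ) = (w - z) / (1 - (starRingEnd ℂ) (w : ℂ) * z) := rfl

lemma one_sub_conj_mul_self (w : Disc) :
    1 - (starRingEnd ℂ) (w : ℂ) * w = ((1 - ‖(w : ℂ)‖ ^ 2 : ℝ) : ℂ) := by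
  rw [mul_comm, Complex.mul_conj, Complex.normSq_eq_norm_sq]; push_cast; rfl

lemma one_sub_conj_mul_mob (w z : Disc) : 1 - (starRingEnd ℂ) (w : ℂ) * mob w z =
    ((1 - ‖(w : ℂ)‖ ^ 2 : ℝ) : ℂ) / (1 - (starRingEnd ℂ) (w : ℂ) * z) := by
  have h := one_sub_conj_mul_ne_zero w z
  rw [coe_mob, ← one_sub_conj_mul_self, eq_div_iff h, sub_mul, mul_assoc, div_mul_cancel₀ _ h]
  ring

lemma mob_mob (w z : Disc) : mob w (mob w z) = z := by
  apply Subtype.ext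
  rw [coe_mob, one_sub_conj_mul_mob, ← one_sub_conj_mul_self, coe_mob,
    div_eq_iff (div_ne_zero (one_sub_conj_mul_ne_zero w w) (one_sub_conj_mul_ne_zero w z)),
    mul_div_assoc', eq_div_iff (one_sub_conj_mul_ne_zero w z), sub_mul,
    div_mul_cancel₀ _ (one_sub_conj_mul_ne_zero w z)]
  ring

@[simp] lemma mob_zeroPt (w : Disc) : mob w zeroPt = w := by
  apply Subtype.ext; simp [coe_mob]

lemma differentiableOn_mobius (w : Disc) :
    DifferentiableOn ℂ (fun z => ((w : ℂ) - z) / (1 - (starRingEnd ℂ) (w : ℂ) * z))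
      (Metric.ball 0 1) := by
  refine DifferentiableOn.div (by fun_prop) (by fun_prop) fun z hz => ?_
  exact one_sub_conj_mul_ne_zero w ⟨z, hz⟩

lemma IsHolo.comp_mob {f : Disc → ℂ} (hf : IsHolo f) (w : Disc) : IsHolo fun z => f (mob w z) :=
  isHolo_of_differentiableOn
    (DifferentiableOn.comp hf (differentiableOn_mobius w) fun z hz => (mob w ⟨z, hz⟩).2)
    fun z => ((zeroExt_coe f (mob w z)).symm)

lemma integral_polarPt {g : Disc → ℂ} (hg : IsHolo g) {r : ℝ} (h0 : 0 ≤ r) (h1 : r < 1) :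
    ∫ θ in Set.Ioc (0 : ℝ) (2 * Real.pi), g (polarPt h0 h1 θ) = 2 * Real.pi * g zeroPt := by
  have hd : DiffContOnCl ℂ (zeroExt g) (Metric.ball 0 |r|) := by
    refine (DifferentiableOn.mono hg ?_).diffContOnCl
    rw [abs_of_nonneg h0]
    exact Metric.closure_ball_subset_closedBall.trans (Metric.closedBall_subset_ball h1)
  have := hd.circleAverage
  rw [Real.circleAverage_def, intervalIntegral.integral_of_le (by positivity)] at this
  rw [← zeroExt_coe g zeroPt, coe_zeroPt, ← this, Complex.real_smul, ← mul_assoc]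
  have h2 : (2 * (Real.pi : ℂ)) * ((2 * Real.pi)⁻¹ : ℝ) = 1 := by
    push_cast; field_simp
  rw [h2, one_mul]
  refine integral_congr_ae (Eventually.of_forall fun θ => ?_)
  simp only [circleMap_zero]
  rw [zeroExt_of_mem g (circle_mem h0 h1 θ)]
  rfl

lemma HasCoeff.apply_zero {f : Disc → ℂ} {c : ℕ → ℂ} (h : HasCoeff f c) : f zeroPt = c 0 := by
  refine (h zeroPt).unique ?_
  have := hasSum_single (f := fun n => c n * ((zeroPt : Disc) : ℂ) ^ n) 0 fun n hn => by simp [hn]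
  simpa using this

lemma integrableOn_polarPt {E : Type*} [NormedAddCommGroup E] {f : Disc → E} (hf : Continuous f)
    {r : ℝ} (h0 : 0 ≤ r) (h1 : r < 1) :
    IntegrableOn (fun θ => f (polarPt h0 h1 θ)) (Set.Ioc (0 : ℝ) (2 * Real.pi)) :=
  (Continuous.integrableOn_Icc (hf.comp (continuous_polarPt h0 h1))).mono_set
    Set.Ioc_subset_Icc_self

lemma IsHolo.circleSq_eq_ofReal {f : Disc → ℂ} (hf : IsHolo f) {r : ℝ} (h0 : 0 ≤ r) (h1 : r < 1) :
    circleSq f r = ENNReal.ofReal ((2 * Real.pi)⁻¹ *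
      ∫ θ in Set.Ioc (0 : ℝ) (2 * Real.pi), ‖f (polarPt h0 h1 θ)‖ ^ 2) := by
  obtain ⟨c, h⟩ := hf.exists_hasCoeff
  have key := h.integral_normSq h0 h1
  rw [h.circleSq_eq h0 h1, ← ENNReal.ofReal_tsum_of_nonneg (fun n => by positivity) key.summable,
    key.tsum_eq]

lemma IsHolo.norm_sq_le_mean {f : Disc → ℂ} (hf : IsHolo f) {r : ℝ} (h0 : 0 ≤ r) (h1 : r < 1) :
    ‖f zeroPt‖ ^ 2 ≤ (2 * Real.pi)⁻¹ *
      ∫ θ in Set.Ioc (0 : ℝ) (2 * Real.pi), ‖f (polarPt h0 h1 θ)‖ ^ 2 := by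
  obtain ⟨c, h⟩ := hf.exists_hasCoeff
  have := le_hasSum (h.integral_normSq h0 h1) 0 fun n _ => by positivity
  rw [h.apply_zero]
  simpa using this

/-- A harmonic majorant bounds the Hardy norm. -/
lemma hardyNormSq_le_of_add_le_re {f u g : Disc → ℂ} (hf : IsHolo f) (hu : IsHolo u)
    (hg : IsHolo g) (h : ∀ z, ‖f z‖ ^ 2 + ‖u z‖ ^ 2 ≤ (g z).re) :
    hardyNormSq f ≤ ENNReal.ofReal ((g zeroPt).re - ‖u zeroPt‖ ^ 2) := by
  refine hardyNormSq_le fun r h0 h1 => ?_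
  rw [hf.circleSq_eq_ofReal h0 h1]
  apply ENNReal.ofReal_le_ofReal
  have i1 := integrableOn_polarPt (hf.continuous.norm.pow 2) h0 h1
  have i2 := integrableOn_polarPt (hu.continuous.norm.pow 2) h0 h1
  have i3 := integrableOn_polarPt (Complex.continuous_re.comp hg.continuous) h0 h1
  have e3 : ∫ θ in Set.Ioc (0 : ℝ) (2 * Real.pi), (g (polarPt h0 h1 θ)).re =
      2 * Real.pi * (g zeroPt).re := by
    have := congrArg Complex.re (integral_polarPt hg h0 h1)
    rw [← Complex.reCLM_apply, ← ContinuousLinearMap.integral_comp_comm _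
      (integrableOn_polarPt hg.continuous h0 h1)] at this
    simpa using this
  have hle := integral_mono (i1.add i2) i3 fun θ => h (polarPt h0 h1 θ)
  simp only [Pi.add_apply, Function.comp_apply] at hle
  rw [integral_add i1 i2, e3] at hle
  -- The mean of `‖u‖²` is at least its value at the centre; this produces the subtracted term,
  -- without which `osc_trunc_le` could not be reached.
  have hm := hu.norm_sq_le_mean h0 h1
  have hp : (0 : ℝ) < (2 * Real.pi)⁻¹ := by positivity
  have h4 := mul_le_mul_of_nonneg_left hle hp.le
  rw [← mul_assoc, inv_mul_cancel₀ (by positivity), one_mul, mul_add] at h4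
  simp only [Pi.pow_apply] at h4
  linarith

/-- `Re (herglotz a ∘ mob w)` is a harmonic majorant, with value `Re (herglotz a w)` at the centre.
-/
lemma hardyNormSq_comp_mob_le (a : HSeq) (w : Disc) :
    hardyNormSq (fun z => ev a (mob w z)) ≤ ENNReal.ofReal (herglotz a w).re := by
  have := hardyNormSq_le_of_add_le_re ((isHolo_ev a).comp_mob w) (isHolo_const 0)
    ((isHolo_herglotz a).comp_mob w) fun z => by
      simpa using norm_sq_le_herglotz_re a (mob w z)
  simpa using this

lemma exists_ev_comp_mob (a : HSeq) (w : Disc) : ∃ b : HSeq, ∀ z, ev b z = ev a (mob w z) := by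
  obtain ⟨b, hb⟩ := exists_ev (f := fun z => ev a (mob w z)) ⟨(isHolo_ev a).comp_mob w,
    (hardyNormSq_comp_mob_le a w).trans_lt ENNReal.ofReal_lt_top⟩
  exact ⟨b, fun z => congrFun hb z⟩

lemma norm_sq_of_comp_mob {a b : HSeq} {w : Disc} (h : ∀ z, ev b z = ev a (mob w z)) :
    ‖b‖ ^ 2 = (1 - ‖(w : ℂ)‖ ^ 2) * ‖kmul w a‖ ^ 2 := by
  have h0 := w.one_sub_sq_pos
  have hle : ∀ {a b : HSeq}, (∀ z, ev b z = ev a (mob w z)) →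
      ‖b‖ ^ 2 ≤ (1 - ‖(w : ℂ)‖ ^ 2) * ‖kmul w a‖ ^ 2 := by
    intro a b h
    have := hardyNormSq_comp_mob_le a w
    rw [← funext h, hardyNormSq_ev, herglotz_re,
      ENNReal.ofReal_le_ofReal_iff (by positivity)] at this
    exact this
  refine le_antisymm (hle h) ?_
  -- The reverse bound is the same inequality for `d = kmul w a ∘ mob w`: `mob w` is an involution,
  -- so `d ∘ mob w` is `kmul w a`, while `kmul w d` is a multiple of `b`.
  obtain ⟨d, hd⟩ := exists_ev_comp_mob (kmul w a) w
  have h1 : kmul w d = ((1 - ‖(w : ℂ)‖ ^ 2 : ℝ) : ℂ)⁻¹ • b := by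
    apply ev_injective
    funext z
    have h2 : ((1 - ‖(w : ℂ)‖ ^ 2 : ℝ) : ℂ) ≠ 0 := by exact_mod_cast h0.ne'
    rw [ev_kmul, hd, ev_kmul, one_sub_conj_mul_mob, map_smul, Pi.smul_apply, h, smul_eq_mul]
    field_simp [one_sub_conj_mul_ne_zero w z]
  have h3 := hle (a := d) (b := kmul w a) fun z => by rw [hd, mob_mob]
  rw [h1, norm_smul, norm_inv, Complex.norm_of_nonneg h0.le, mul_pow] at h3
  calc _ ≤ (1 - ‖(w : ℂ)‖ ^ 2) * ((1 - ‖(w : ℂ)‖ ^ 2) * (((1 - ‖(w : ℂ)‖ ^ 2)⁻¹) ^ 2 * ‖b‖ ^ 2)) := by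
        gcongr
    _ = _ := by field_simp

lemma hardyNormSq_comp_mob (a : HSeq) (w : Disc) :
    hardyNormSq (fun z => ev a (mob w z)) = ENNReal.ofReal (herglotz a w).re := by
  obtain ⟨b, hb⟩ := exists_ev_comp_mob a w
  rw [← funext hb, hardyNormSq_ev, herglotz_re, norm_sq_of_comp_mob hb]

/-! ### The local Dirichlet integrals `osc`, difference quotients and dilations -/

/-- Twice the Dirichlet integral of `f` with respect to the Green function with pole `w`. -/
noncomputable def osc (w : Disc) (f : Disc → ℂ) : ENNReal :=
  hardyNormSq fun z => f (mob w z) - f w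

/-- Pythagoras: constants are orthogonal to functions vanishing at the centre. -/
lemma IsHolo.hardyNormSq_eq_add {g : Disc → ℂ} (hg : IsHolo g) :
    hardyNormSq g = hardyNormSq (fun z => g z - g zeroPt) + ENNReal.ofReal (‖g zeroPt‖ ^ 2) := by
  obtain ⟨c, hc⟩ := hg.exists_hasCoeff
  have hd : HasCoeff (fun z => g z - g zeroPt) fun n => if n = 0 then 0 else c n := by
    intro z
    have h1 := (hc z).sub (hasSum_ite_eq (0 : ℕ) (c 0))
    rw [hc.apply_zero]
    refine h1.congr_fun ?_ |> id
    intro n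
    by_cases hn : n = 0
    · simp [hn]
    · simp [hn]
  rw [hc.hardyNormSq_eq, hd.hardyNormSq_eq, hc.apply_zero, tsum_eq_zero_add' ENNReal.summable,
    tsum_eq_zero_add' (f := fun n => ENNReal.ofReal (‖if n = 0 then 0 else c n‖ ^ 2)) ENNReal.summable]
  simp [add_comm]

lemma hardyNormSq_comp_mob_eq_osc_add {f : Disc → ℂ} (hf : IsHolo f) (w : Disc) :
    hardyNormSq (fun z => f (mob w z)) = osc w f + ENNReal.ofReal (‖f w‖ ^ 2) := by
  have := (hf.comp_mob w).hardyNormSq_eq_add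
  simpa [osc] using this

lemma osc_le_comp_mob {f : Disc → ℂ} (hf : IsHolo f) (w : Disc) :
    osc w f ≤ hardyNormSq (fun z => f (mob w z)) := by
  rw [hardyNormSq_comp_mob_eq_osc_add hf]; exact le_self_add

/-- The difference quotient of a function of the Hardy space. -/
lemma exists_quot (a : HSeq) (w : Disc) : ∃ g : HSeq,
    (∀ z : Disc, ((z : ℂ) - w) * ev g z = ev a z - ev a w) ∧
      osc w (ev a) = ENNReal.ofReal ((1 - ‖(w : ℂ)‖ ^ 2) * ‖g‖ ^ 2) := by
  obtain ⟨b, hb⟩ := exists_ev_comp_mob a w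
  -- `f ∘ mob w - f w` vanishes at the centre, so dividing it by `z` drops the first coefficient; a
  -- second composition with `mob w` moves the zero to `w`.
  let c : HSeq := ⟨fun n => b (n + 1), memℓp_two_iff.2
    ((summable_nat_add_iff 1).2 b.hasSum_norm_sq.summable)⟩
  have hc : ∀ z : Disc, (z : ℂ) * ev c z = ev a (mob w z) - ev a w := by
    intro z
    have h1 := hasCoeff_ev b z
    rw [← hasSum_nat_add_iff' 1] at h1
    have h2 : (ev b) z - ∑ i ∈ Finset.range 1, b i * (z : ℂ) ^ i = ev a (mob w z) - ev a w := by
      have h3 := (hasCoeff_ev b).apply_zero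
      rw [hb, mob_zeroPt] at h3
      rw [hb, h3]; simp
    rw [h2] at h1
    refine HasSum.unique ?_ h1
    refine ((hasCoeff_ev c z).mul_left (z : ℂ)).congr_fun ?_ |> id
    intro n
    simp only [c]
    ring
  have hosc : osc w (ev a) = ENNReal.ofReal (‖c‖ ^ 2) := by
    have h1 : (fun z => ev a (mob w z) - ev a w) = ev (shift c) := by
      funext z; rw [ev_shift, hc]
    rw [osc, h1, hardyNormSq_ev, LinearIsometry.norm_map]
  obtain ⟨d, hd⟩ := exists_ev_comp_mob c w
  -- `mob w z = -(z - w) / (1 - conj w * z)` explains both the sign and `kmul`.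
  refine ⟨-kmul w d, fun z => ?_, ?_⟩
  · have h1 := hc (mob w z)
    rw [mob_mob, ← hd, coe_mob] at h1
    rw [← h1, map_neg, Pi.neg_apply, ev_kmul]
    field_simp [one_sub_conj_mul_ne_zero w z]
    ring
  · rw [hosc, norm_neg, ← norm_sq_of_comp_mob (a := d) (b := c) fun z => by rw [hd, mob_mob]]

/-- The difference would be an eigenvector of the isometry `shift` for the eigenvalue `w`, of
modulus less than 1. -/
lemma eq_of_sub_mul_ev {x y : HSeq} {w : Disc}
    (h : ∀ z : Disc, ((z : ℂ) - w) * ev x z = ((z : ℂ) - w) * ev y z) : x = y := by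
  have h1 : shift (x - y) = (w : ℂ) • (x - y) := by
    apply ev_injective
    funext z
    simp only [ev_shift, map_sub, map_smul, Pi.smul_apply, Pi.sub_apply, smul_eq_mul]
    linear_combination h z
  have h2 := congrArg norm h1
  rw [LinearIsometry.norm_map, norm_smul] at h2
  have h3 : ‖x - y‖ = 0 := by nlinarith [w.norm_lt, norm_nonneg (x - y)]
  exact sub_eq_zero.1 (norm_eq_zero.1 h3)

/-- Multiplication by a real number `0 ≤ r ≤ 1` on the disc. -/
def Disc.scale (r : Set.Icc (0 : ℝ) 1) (z : Disc) : Disc :=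
  ⟨(r : ℝ) * z, by
    rw [mem_ball_zero_iff, norm_mul, Complex.norm_of_nonneg r.2.1]
    nlinarith [z.norm_lt, norm_nonneg (z : ℂ), r.2.1, r.2.2]⟩

lemma Disc.coe_scale (r : Set.Icc (0 : ℝ) 1) (z : Disc) :
    (z.scale r : ℂ) = (r : ℝ) * z := rfl

lemma IsHolo.comp_scale {f : Disc → ℂ} (hf : IsHolo f) (r : Set.Icc (0 : ℝ) 1) :
    IsHolo fun z => f (z.scale r) :=
  isHolo_of_differentiableOn
    (DifferentiableOn.comp (g := zeroExt f) (f := fun z => ((r : ℝ) : ℂ) * z) hf (by fun_prop)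
      fun z hz => (Disc.scale r ⟨z, hz⟩).2)
    fun z => ((zeroExt_coe f (z.scale r)).symm)

lemma hardyNormSq_comp_scale_le (f : Disc → ℂ) (r : Set.Icc (0 : ℝ) 1) :
    hardyNormSq (fun z => f (z.scale r)) ≤ hardyNormSq f := by
  refine hardyNormSq_le fun s h0 h1 => ?_
  have h2 : 0 ≤ r * s := mul_nonneg r.2.1 h0
  have h3 : r * s < 1 := by nlinarith [r.2.1, r.2.2]
  refine le_trans (le_of_eq ?_) (circleSq_le_hardyNormSq f h2 h3)
  rw [circleSq_eq _ h0 h1, circleSq_eq _ h2 h3]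
  congr! 5 with θ
  refine congrArg f (Subtype.ext ?_)
  simp [Disc.coe_scale, polarPt, mul_assoc]

lemma exists_ev_scale (a : HSeq) (r : Set.Icc (0 : ℝ) 1) :
    ∃ b : HSeq, (∀ z, ev b z = ev a (z.scale r)) ∧ ‖b‖ ≤ ‖a‖ := by
  have h := hardyNormSq_comp_scale_le (ev a) r
  obtain ⟨b, hb⟩ := exists_ev (f := fun z => ev a (z.scale r)) ⟨(isHolo_ev a).comp_scale r,
    h.trans_lt (ev_mem_hardySpace a).2⟩
  refine ⟨b, fun z => congrFun hb z, ?_⟩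
  rw [← hb, hardyNormSq_ev, hardyNormSq_ev, ENNReal.ofReal_le_ofReal_iff (by positivity)] at h
  exact (sq_le_sq₀ (norm_nonneg _) (norm_nonneg _)).1 h

lemma norm_kmul_le (w : Disc) (a : HSeq) : (1 - ‖(w : ℂ)‖) * ‖kmul w a‖ ≤ ‖a‖ := by
  have h := norm_sub_norm_le (kmul w a) ((starRingEnd ℂ) (w : ℂ) • shift (kmul w a))
  rw [kmul_sub, norm_smul, RCLike.norm_conj, LinearIsometry.norm_map] at h
  linarith

/-- `osc v (ev g)` is at most the squared norm of `ev g ∘ mob v`, which is `(1 - ‖v‖²) ‖kmul v g‖²`,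
and `kmul v` has norm at most `1 / (1 - ‖v‖)`. -/
lemma norm_quot_le {g q : HSeq} {v : Disc}
    (h : osc v (ev g) = ENNReal.ofReal ((1 - ‖(v : ℂ)‖ ^ 2) * ‖q‖ ^ 2)) :
    (1 - ‖(v : ℂ)‖) * ‖q‖ ≤ ‖g‖ := by
  have h0 := v.one_sub_sq_pos
  have h1 := osc_le_comp_mob (isHolo_ev g) v
  rw [h, hardyNormSq_comp_mob, herglotz_re, ENNReal.ofReal_le_ofReal_iff (by positivity)] at h1
  have h2 : ‖q‖ ≤ ‖kmul v g‖ :=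
    (sq_le_sq₀ (norm_nonneg _) (norm_nonneg _)).1 (le_of_mul_le_mul_left h1 h0)
  refine le_trans ?_ (norm_kmul_le v g)
  have := v.norm_lt
  gcongr

/-- Dilations increase the local Dirichlet integrals by a bounded factor. -/
lemma osc_scale_le (a : HSeq) (w : Disc) (r : Set.Icc (0 : ℝ) 1) :
    osc w (fun z => ev a (z.scale r)) ≤ 4 * osc w (ev a) := by
  obtain ⟨g, hg, hog⟩ := exists_quot a w
  obtain ⟨ar, har, -⟩ := exists_ev_scale a r
  obtain ⟨gr, hgr, hgrn⟩ := exists_ev_scale g r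
  obtain ⟨q, hq, hoq⟩ := exists_quot g (w.scale r)
  obtain ⟨qr, hqr, hqrn⟩ := exists_ev_scale q r
  obtain ⟨x, hx, hox⟩ := exists_quot ar w
  -- The difference quotient of the dilate at `w`, in terms of the dilates of `g` and of the
  -- difference quotient `q` of `g` at `r w`.
  have hxe : x = ((r : ℝ) : ℂ) • gr - ((1 - (r : ℝ)) * w : ℂ) • ((r : ℝ) : ℂ) • qr := by
    refine eq_of_sub_mul_ev (w := w) fun z => ?_
    have e1 := hg (z.scale r)
    have e2 := hg (w.scale r)
    have e3 := hq (z.scale r)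
    rw [hx, har, har]
    simp only [map_sub, map_smul, Pi.sub_apply, Pi.smul_apply, smul_eq_mul, hgr, hqr]
    simp only [Disc.coe_scale] at e1 e2 e3 ⊢
    linear_combination -e1 + e2 + (1 - (r : ℝ)) * w * e3
  have hn := norm_quot_le hoq
  have hr0 := r.2.1
  have hr1 := r.2.2
  have hw := w.norm_lt
  have hw0 := norm_nonneg (w : ℂ)
  have hsc : ‖(w.scale r : ℂ)‖ = r * ‖(w : ℂ)‖ := by
    rw [Disc.coe_scale, norm_mul, Complex.norm_of_nonneg hr0]
  have hxn : ‖x‖ ≤ 2 * ‖g‖ := by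
    have h1 : ‖x‖ ≤ r * ‖gr‖ + (1 - r) * ‖(w : ℂ)‖ * (r * ‖qr‖) := by
      rw [hxe]
      refine (norm_sub_le _ _).trans (le_of_eq ?_)
      rw [norm_smul, norm_smul, norm_smul, norm_mul, Complex.norm_of_nonneg hr0]
      have : ‖(1 : ℂ) - (r : ℝ)‖ = 1 - r := by
        rw [← Complex.ofReal_one, ← Complex.ofReal_sub, Complex.norm_of_nonneg (by linarith)]
      rw [this]
    rw [hsc] at hn
    -- The factor `(1 - r) ‖w‖` absorbs the blow-up `1 / (1 - r ‖w‖)` of the second quotient,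
    -- uniformly in `r` and `w`.
    have h2 : (1 - (r : ℝ)) * ‖(w : ℂ)‖ * (r * ‖qr‖) ≤ (1 - r * ‖(w : ℂ)‖) * ‖q‖ := by
      have a1 : (r : ℝ) * ‖qr‖ ≤ ‖q‖ := by nlinarith [norm_nonneg qr]
      have a2 : (1 - (r : ℝ)) * ‖(w : ℂ)‖ ≤ 1 - r * ‖(w : ℂ)‖ := by nlinarith
      have a3 : 0 ≤ (1 - (r : ℝ)) * ‖(w : ℂ)‖ := mul_nonneg (by linarith) hw0
      exact mul_le_mul a2 a1 (by positivity) (a3.trans a2)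
    nlinarith [norm_nonneg gr]
  have : (fun z => ev a (z.scale r)) = ev ar := (funext har).symm
  rw [this, hox, hog, show (4 : ENNReal) = ENNReal.ofReal 4 by simp,
    ← ENNReal.ofReal_mul (by norm_num)]
  apply ENNReal.ofReal_le_ofReal
  have h0 := w.one_sub_sq_pos
  have : ‖x‖ ^ 2 ≤ 4 * ‖g‖ ^ 2 := by nlinarith [norm_nonneg x, norm_nonneg g]
  nlinarith

/-! ### Green energies and the Littlewood-Paley formula -/

/-- The Dirichlet integral of `f` weighted by the Green function with pole `w`. -/
noncomputable def greenEnergy (w : Disc) (f : Disc → ℂ) : ENNReal :=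
  ENNReal.ofReal Real.pi⁻¹ *
    ∫⁻ z in Metric.ball (0 : ℂ) 1, ‖deriv (zeroExt f) z‖ₑ ^ 2 * greenKernel w z

lemma measurable_greenKernel : Measurable fun p : Disc × ℂ => greenKernel p.1 p.2 := by
  unfold greenKernel
  refine Measurable.ite ?_ measurable_const ?_
  · exact measurableSet_eq_fun measurable_snd (measurable_subtype_coe.comp measurable_fst)
  · have h1 : Measurable fun p : Disc × ℂ => (p.1 : ℂ) := measurable_subtype_coe.comp measurable_fst
    exact (Real.measurable_log.comp (((measurable_const.sub
      (((Complex.continuous_conj.measurable).comp h1).mul measurable_snd)).div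
        (measurable_snd.sub h1)).norm)).ennreal_ofReal

lemma measurable_integrand (f : Disc → ℂ) : Measurable fun p : Disc × ℂ =>
    ‖deriv (zeroExt f) p.2‖ₑ ^ 2 * greenKernel p.1 p.2 :=
  (((measurable_deriv _).comp measurable_snd).enorm.pow_const 2).mul measurable_greenKernel

lemma measurable_greenEnergy (f : Disc → ℂ) : Measurable fun w => greenEnergy w f :=
  (Measurable.lintegral_prod_right' (measurable_integrand f)).const_mul _

lemma dirichletIntegral_eq_lintegral_greenEnergy (μ : Measure Disc) [IsFiniteMeasure μ]
    (f : Disc → ℂ) : dirichletIntegral μ f = ∫⁻ w, greenEnergy w f ∂μ := by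
  unfold dirichletIntegral greenEnergy greenPotential
  rw [lintegral_const_mul' _ _ (by simp), lintegral_lintegral_swap
    (measurable_integrand f).aemeasurable]
  congr 1
  refine lintegral_congr fun z => ?_
  rw [lintegral_const_mul' _ _ (by simp)]

/-- Conformal invariance: up to sign, the quotient inside the logarithm is the reciprocal of `mob w`
evaluated at the second point. -/
lemma greenKernel_mob (w z : Disc) : greenKernel w (mob w z) = greenKernel zeroPt z := by
  have h0 : (mob w z : ℂ) = w ↔ (z : ℂ) = 0 := by
    constructor
    · intro h
      have h1 := mob_mob w z
      rw [Subtype.ext h] at h1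
      rw [← h1]; simp [coe_mob]
    · intro h
      have : z = zeroPt := Subtype.ext h
      rw [this, mob_zeroPt]
  unfold greenKernel
  by_cases hz : (z : ℂ) = 0
  · rw [if_pos (h0.2 hz), if_pos (by simpa using hz)]
  · rw [if_neg (fun h => hz (h0.1 h)), if_neg (by simpa using hz)]
    have h1 := congrArg (Subtype.val) (mob_mob w z)
    rw [coe_mob] at h1
    have h2 : (1 - (starRingEnd ℂ) (w : ℂ) * mob w z) / ((mob w z : ℂ) - w) = -(z : ℂ)⁻¹ := by
      rw [← h1, inv_div, ← neg_sub (w : ℂ) (mob w z : ℂ), div_neg]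
    rw [h2]
    simp

lemma hasDerivAt_zeroExt {f : Disc → ℂ} (hf : IsHolo f) (z : Disc) :
    HasDerivAt (zeroExt f) (deriv (zeroExt f) z) z :=
  (DifferentiableOn.differentiableAt hf (Metric.isOpen_ball.mem_nhds z.2)).hasDerivAt

lemma zeroExt_comp_mob_eventuallyEq (f : Disc → ℂ) (w z : Disc) :
    zeroExt (fun u => f (mob w u)) =ᶠ[𝓝 (z : ℂ)]
      fun u => zeroExt f (zeroExt (fun u => (mob w u : ℂ)) u) := by
  filter_upwards [Metric.isOpen_ball.mem_nhds z.2] with u hu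
  rw [zeroExt_of_mem _ hu, zeroExt_of_mem _ hu, zeroExt_coe]

lemma isHolo_mob (w : Disc) : IsHolo fun u => (mob w u : ℂ) :=
  isHolo_of_differentiableOn (differentiableOn_mobius w) fun _ => rfl

lemma deriv_comp_mob {f : Disc → ℂ} (hf : IsHolo f) (w z : Disc) :
    deriv (zeroExt fun u => f (mob w u)) z =
      deriv (zeroExt f) (mob w z) * deriv (zeroExt fun u => (mob w u : ℂ)) z := by
  rw [(zeroExt_comp_mob_eventuallyEq f w z).deriv_eq]
  have h1 := hasDerivAt_zeroExt (isHolo_mob w) z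
  have h2 := hasDerivAt_zeroExt hf (mob w z)
  have h3 : (mob w z : ℂ) = zeroExt (fun u => (mob w u : ℂ)) z := by simp
  rw [h3] at h2 ⊢
  exact (h2.comp (z : ℂ) h1).deriv

lemma det_restrictScalars_toSpanSingleton (c : ℂ) :
    ((ContinuousLinearMap.toSpanSingleton ℂ c).restrictScalars ℝ).det = ‖c‖ ^ 2 := by
  simp [ContinuousLinearMap.det, LinearMap.det_restrictScalars,
      Algebra.norm_complex_eq, Complex.normSq_eq_norm_sq]

/-- In the change of variables `mob w`, the Jacobian is the squared modulus of the derivative, which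
the chain rule for `f ∘ mob w` absorbs. -/
lemma greenEnergy_comp_mob {f : Disc → ℂ} (hf : IsHolo f) (w : Disc) :
    greenEnergy w f = greenEnergy zeroPt (fun z => f (mob w z)) := by
  unfold greenEnergy
  congr 1
  have himg : zeroExt (fun u => (mob w u : ℂ)) '' Metric.ball (0 : ℂ) 1 = Metric.ball (0 : ℂ) 1 := by
    ext z
    constructor
    · rintro ⟨u, hu, rfl⟩
      rw [zeroExt_of_mem _ hu]
      exact (mob w _).2
    · intro hz
      refine ⟨mob w ⟨z, hz⟩, (mob w _).2, ?_⟩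
      rw [zeroExt_coe, mob_mob]
  have hinj : Set.InjOn (zeroExt (fun u => (mob w u : ℂ))) (Metric.ball (0 : ℂ) 1) := by
    intro x hx y hy hxy
    rw [zeroExt_of_mem _ hx, zeroExt_of_mem _ hy] at hxy
    have := congrArg (mob w) (Subtype.ext hxy)
    rw [mob_mob, mob_mob] at this
    exact congrArg Subtype.val this
  have main := lintegral_image_eq_lintegral_abs_det_fderiv_mul volume
    (Metric.isOpen_ball.measurableSet : MeasurableSet (Metric.ball (0 : ℂ) 1))
    (f' := fun z => (ContinuousLinearMap.toSpanSingleton ℂ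
      (deriv (zeroExt fun u => (mob w u : ℂ)) z)).restrictScalars ℝ)
    (fun z hz => ((hasDerivAt_zeroExt (isHolo_mob w) ⟨z, hz⟩).hasFDerivAt.restrictScalars
      ℝ).hasFDerivWithinAt) hinj (fun z => ‖deriv (zeroExt f) z‖ₑ ^ 2 * greenKernel w z)
  rw [himg] at main
  rw [main]
  refine setLIntegral_congr_fun Metric.isOpen_ball.measurableSet fun z hz => ?_
  have h1 := deriv_comp_mob hf w ⟨z, hz⟩
  have h2 := greenKernel_mob w ⟨z, hz⟩
  simp only at h1 h2 ⊢
  rw [h1, ← h2, zeroExt_of_mem _ hz, det_restrictScalars_toSpanSingleton, abs_of_nonneg (by positivity),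
    enorm_mul, mul_pow, ENNReal.ofReal_pow (norm_nonneg _), ofReal_norm]
  ring

lemma lintegral_pow_mul_neg_log (n : ℕ) :
    ∫⁻ r in Set.Ioo (0 : ℝ) 1, ENNReal.ofReal (r ^ n * -Real.log r) =
      ENNReal.ofReal (((n + 1 : ℝ) ^ 2)⁻¹) := by
  -- A primitive of `r ^ n * -log r`; keeping `r * log r` together makes it continuous at 0.
  let H : ℝ → ℝ := fun r => r ^ (n + 1) / (n + 1) ^ 2 - r ^ n * (r * Real.log r) / (n + 1)
  have hn : (n + 1 : ℝ) ≠ 0 := by positivity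
  have hc : Continuous H := by
    have := Real.continuous_mul_log
    fun_prop
  have hd : ∀ r ∈ Set.Ioo (0 : ℝ) 1, HasDerivAt H (r ^ n * -Real.log r) r := by
    intro r hr
    have hr0 : r ≠ 0 := hr.1.ne'
    have h1 := (hasDerivAt_pow (n + 1) r).div_const ((n + 1 : ℝ) ^ 2)
    have h2 := ((hasDerivAt_pow (n + 1) r).mul (Real.hasDerivAt_log hr0)).div_const (n + 1 : ℝ)
    have h3 := h1.sub h2
    have e : H = fun r => r ^ (n + 1) / (n + 1) ^ 2 - r ^ (n + 1) * Real.log r / (n + 1) := by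
      funext r; simp only [H]; ring
    rw [e]
    refine h3.congr_deriv ?_
    push_cast
    field_simp
    ring
  have hpos : ∀ r ∈ Set.Ioo (0 : ℝ) 1, 0 ≤ r ^ n * -Real.log r := fun r hr =>
    mul_nonneg (pow_nonneg hr.1.le n) (neg_nonneg.2 (Real.log_nonpos hr.1.le hr.2.le))
  have hi := intervalIntegral.integrableOn_deriv_of_nonneg hc.continuousOn hd hpos
  have hI := intervalIntegral.integral_eq_sub_of_hasDerivAt_of_le (zero_le_one' ℝ) hc.continuousOn hd
    ((intervalIntegrable_iff_integrableOn_Ioc_of_le zero_le_one).2 hi)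
  rw [intervalIntegral.integral_of_le zero_le_one, integral_Ioc_eq_integral_Ioo] at hI
  rw [← ofReal_integral_eq_lintegral_ofReal (hi.mono_set Set.Ioo_subset_Ioc_self), hI]
  · simp [H]
  · filter_upwards [self_mem_ae_restrict measurableSet_Ioo] with r hr using hpos r hr

/-- Polar coordinates use the angles `(-π, π)`, the circle means use `(0, 2π]`; periodicity
reconciles them. -/
lemma lintegral_Ioo_neg_pi_pi (f : Disc → ℂ) {r : ℝ} (h0 : 0 ≤ r) (h1 : r < 1) :
    ∫⁻ θ in Set.Ioo (-Real.pi) Real.pi, ‖f (polarPt h0 h1 θ)‖ₑ ^ 2 =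
      ENNReal.ofReal (2 * Real.pi) * circleSq f r := by
  have hp : Function.Periodic (fun θ => ‖f (polarPt h0 h1 θ)‖ₑ ^ 2) (2 * Real.pi) := by
    intro θ
    have : polarPt h0 h1 (θ + 2 * Real.pi) = polarPt h0 h1 θ := by
      apply Subtype.ext
      simp only [polarPt]
      congr 1
      rw [← Complex.exp_periodic ((θ : ℂ) * Complex.I)]
      congr 1; push_cast; ring
    simp only [this]
  have hT : (0 : ℝ) < 2 * Real.pi := by positivity
  rw [circleSq_eq f h0 h1, ← mul_assoc, ← ENNReal.ofReal_mul hT.le, mul_inv_cancel₀ hT.ne',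
    ENNReal.ofReal_one, one_mul, restrict_Ioo_eq_restrict_Ioc]
  have := (isAddFundamentalDomain_Ioc hT (-Real.pi)).setLIntegral_eq
    (isAddFundamentalDomain_Ioc hT 0) (fun θ => ‖f (polarPt h0 h1 θ)‖ₑ ^ 2) hp.map_vadd_zmultiples
  rwa [zero_add, show -Real.pi + 2 * Real.pi = Real.pi by ring] at this

lemma exists_hasCoeff_deriv {f : Disc → ℂ} (hf : IsHolo f) : ∃ c : ℕ → ℂ, HasCoeff f c ∧
    HasCoeff (fun z => deriv (zeroExt f) z) fun n => (n + 1) * c (n + 1) := by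
  refine ⟨fun n => (n.factorial : ℂ)⁻¹ * iteratedDeriv n (zeroExt f) 0, fun z => ?_, fun z => ?_⟩
  · have := Complex.hasSum_taylorSeries_on_ball (f := zeroExt f) hf z.2
    simpa [mul_comm, mul_left_comm, mul_assoc] using this
  · have := Complex.hasSum_taylorSeries_on_ball (f := deriv (zeroExt f))
      (DifferentiableOn.deriv hf Metric.isOpen_ball) z.2
    refine this.congr_fun ?_ |> id
    intro n
    have h1 : ((n.factorial : ℂ)) ≠ 0 := by exact_mod_cast n.factorial_ne_zero
    have h2 : ((n : ℂ) + 1) ≠ 0 := by exact_mod_cast n.succ_ne_zero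
    simp only [sub_zero, smul_eq_mul, ← iteratedDeriv_succ', Nat.factorial_succ]
    push_cast
    field_simp

lemma lintegral_ball_eq_polar {F : ℂ → ENNReal} (hF : Measurable F) :
    ∫⁻ z in Metric.ball (0 : ℂ) 1, F z = ∫⁻ r in Set.Ioo (0 : ℝ) 1, ENNReal.ofReal r *
      ∫⁻ θ in Set.Ioo (-Real.pi) Real.pi, F (r * Complex.exp (θ * Complex.I)) := by
  have hmeas : Measurable fun p : ℝ × ℝ => ENNReal.ofReal p.1 *
      (Metric.ball (0 : ℂ) 1).indicator F (p.1 * Complex.exp (p.2 * Complex.I)) := by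
    refine (measurable_fst.ennreal_ofReal).mul
      ((hF.indicator Metric.isOpen_ball.measurableSet).comp ?_)
    exact Continuous.measurable (by fun_prop)
  have hpol : ∀ p : ℝ × ℝ, Complex.polarCoord.symm p = p.1 * Complex.exp (p.2 * Complex.I) := by
    intro p
    rw [Complex.polarCoord_symm_apply, Complex.exp_mul_I, Complex.ofReal_cos, Complex.ofReal_sin]
  have hIoo : Set.Ioo (0 : ℝ) 1 = Set.Iio 1 ∩ Set.Ioi 0 := by
    rw [Set.inter_comm, Set.Ioi_inter_Iio]
  rw [← lintegral_indicator Metric.isOpen_ball.measurableSet,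
    ← Complex.lintegral_comp_polarCoord_symm]
  simp_rw [hpol, smul_eq_mul]
  rw [polarCoord_target, Measure.volume_eq_prod, ← Measure.prod_restrict,
    lintegral_prod _ hmeas.aemeasurable, hIoo,
    ← Measure.restrict_restrict measurableSet_Iio, ← lintegral_indicator measurableSet_Iio]
  refine setLIntegral_congr_fun measurableSet_Ioi fun r hr => ?_
  have hr0 : (0 : ℝ) < r := hr
  have hmem : ∀ θ : ℝ, (r : ℂ) * Complex.exp (θ * Complex.I) ∈ Metric.ball (0 : ℂ) 1 ↔ r < 1 := by
    intro θ
    rw [mem_ball_zero_iff, norm_mul, Complex.norm_exp_ofReal_mul_I, mul_one,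
      Complex.norm_of_nonneg hr0.le]
  by_cases h1 : r < 1
  · simp only [Set.indicator_of_mem (show r ∈ Set.Iio (1 : ℝ) from h1),
      Set.indicator_of_mem ((hmem _).2 h1)]
    rw [lintegral_const_mul' _ _ (by simp)]
  · simp only [Set.indicator_of_notMem (show r ∉ Set.Iio (1 : ℝ) from h1),
      Set.indicator_of_notMem (fun h => h1 ((hmem _).1 h)), mul_zero, lintegral_zero]

lemma greenKernel_zeroPt_polar {r : ℝ} (h0 : 0 < r) (θ : ℝ) :
    greenKernel zeroPt (r * Complex.exp (θ * Complex.I)) = ENNReal.ofReal (-Real.log r) := by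
  have hn : (r : ℂ) * Complex.exp (θ * Complex.I) ≠ 0 :=
    mul_ne_zero (by exact_mod_cast h0.ne') (Complex.exp_ne_zero _)
  simp only [greenKernel, coe_zeroPt, if_neg hn, map_zero, zero_mul, sub_zero, norm_inv,
    norm_mul, Complex.norm_exp_ofReal_mul_I, mul_one, Complex.norm_of_nonneg h0.le, one_div,
    Real.log_inv]

lemma hardyNormSq_sub_apply_zeroPt {f : Disc → ℂ} {c : ℕ → ℂ} (hc : HasCoeff f c) :
    hardyNormSq (fun z => f z - f zeroPt) = ∑' n, ENNReal.ofReal (‖c (n + 1)‖ ^ 2) := by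
  have hadd := hc.isHolo.hardyNormSq_eq_add
  rw [hc.hardyNormSq_eq, tsum_eq_zero_add' ENNReal.summable, ← hc.apply_zero, add_comm] at hadd
  exact ((ENNReal.add_left_inj ENNReal.ofReal_ne_top).1 hadd).symm

lemma polar_inner_integral {f : Disc → ℂ} {d : ℕ → ℂ}
    (hd : HasCoeff (fun z => deriv (zeroExt f) z) d) {r : ℝ} (hr : r ∈ Set.Ioo (0 : ℝ) 1) :
    (ENNReal.ofReal r *
      ∫⁻ θ in Set.Ioo (-Real.pi) Real.pi, ‖deriv (zeroExt f) (r * Complex.exp (θ * Complex.I))‖ₑ ^ 2 *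
        greenKernel zeroPt (r * Complex.exp (θ * Complex.I))) =
      ENNReal.ofReal (2 * Real.pi) * ∑' n : ℕ, ENNReal.ofReal (‖d n‖ ^ 2) *
        ENNReal.ofReal (r ^ (2 * n + 1) * -Real.log r) := by
  have hl : 0 ≤ -Real.log r := neg_nonneg.2 (Real.log_nonpos hr.1.le hr.2.le)
  simp_rw [greenKernel_zeroPt_polar hr.1]
  rw [lintegral_mul_const' _ _ ENNReal.ofReal_ne_top]
  have h1 := lintegral_Ioo_neg_pi_pi (fun z => deriv (zeroExt f) z) hr.1.le hr.2
  simp only [polarPt] at h1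
  have h2 : ∀ n : ℕ, ENNReal.ofReal (‖d n‖ ^ 2) * ENNReal.ofReal (r ^ (2 * n + 1) * -Real.log r) =
      ENNReal.ofReal r * (ENNReal.ofReal (‖d n‖ ^ 2 * r ^ (2 * n)) * ENNReal.ofReal (-Real.log r)) := by
    intro n
    have hr0 := hr.1.le
    rw [← ENNReal.ofReal_mul (by positivity), ← ENNReal.ofReal_mul (by positivity),
      ← ENNReal.ofReal_mul hr0]
    congr 1; ring
  simp_rw [h2]
  rw [h1, hd.circleSq_eq hr.1.le hr.2, ENNReal.tsum_mul_left, ENNReal.tsum_mul_right]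
  ring

/-- The origin of the factor 1/2: `2π / π` times `(n + 1)² / (2n + 2)²`. The exponent `2n + 1`
includes the factor `r` of the area element. -/
lemma littlewood_paley_coeff (c : ℂ) (n : ℕ) :
    ENNReal.ofReal Real.pi⁻¹ * (ENNReal.ofReal (2 * Real.pi) *
      (ENNReal.ofReal (‖((n : ℂ) + 1) * c‖ ^ 2) *
        ENNReal.ofReal ((((2 * n + 1 : ℕ) + 1 : ℝ) ^ 2)⁻¹))) = 2⁻¹ * ENNReal.ofReal (‖c‖ ^ 2) := by
  have h2 : (2⁻¹ : ENNReal) = ENNReal.ofReal 2⁻¹ := by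
    rw [ENNReal.ofReal_inv_of_pos (by norm_num)]; simp
  have h1 : ‖((n : ℂ) + 1)‖ = n + 1 := by
    rw [← Complex.ofReal_natCast, ← Complex.ofReal_one, ← Complex.ofReal_add,
      Complex.norm_of_nonneg (by positivity)]
  have hp := Real.pi_pos
  rw [h2, ← ENNReal.ofReal_mul (by positivity), ← ENNReal.ofReal_mul (by positivity),
    ← ENNReal.ofReal_mul (by positivity), ← ENNReal.ofReal_mul (by positivity), norm_mul, h1]
  congr 1
  push_cast
  field_simp
  ring

lemma greenEnergy_zeroPt_eq_tsum {f : Disc → ℂ} {d : ℕ → ℂ}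
    (hd : HasCoeff (fun z => deriv (zeroExt f) z) d) :
    greenEnergy zeroPt f = ∑' n : ℕ, ENNReal.ofReal Real.pi⁻¹ * (ENNReal.ofReal (2 * Real.pi) *
      (ENNReal.ofReal (‖d n‖ ^ 2) * ENNReal.ofReal ((((2 * n + 1 : ℕ) + 1 : ℝ) ^ 2)⁻¹))) := by
  have hm : Measurable fun z => ‖deriv (zeroExt f) z‖ₑ ^ 2 * greenKernel zeroPt z := by
    have g : Measurable fun z : ℂ => greenKernel zeroPt z :=
      measurable_greenKernel.comp (measurable_prodMk_left (x := zeroPt))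
    exact ((measurable_deriv _).enorm.pow_const 2).mul g
  have hm2 : ∀ n : ℕ, Measurable fun r : ℝ => ENNReal.ofReal (‖d n‖ ^ 2) *
      ENNReal.ofReal (r ^ (2 * n + 1) * -Real.log r) := by
    intro n
    have g1 : Measurable fun r : ℝ => r ^ (2 * n + 1) := measurable_id.pow_const _
    have g2 : Measurable fun r : ℝ => r ^ (2 * n + 1) * -Real.log r := g1.mul Real.measurable_log.neg
    have g3 : Measurable fun r : ℝ => ENNReal.ofReal (r ^ (2 * n + 1) * -Real.log r) :=
      ENNReal.measurable_ofReal.comp g2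
    exact g3.const_mul _
  have e1 := setLIntegral_congr_fun (μ := volume) (measurableSet_Ioo (a := (0 : ℝ)) (b := 1))
    fun r hr => polar_inner_integral hd hr
  have e2 := lintegral_tsum (μ := volume.restrict (Set.Ioo (0 : ℝ) 1)) fun n => (hm2 n).aemeasurable
  rw [greenEnergy, lintegral_ball_eq_polar hm, e1, lintegral_const_mul' _ _ ENNReal.ofReal_ne_top,
    e2, ENNReal.tsum_mul_left, ENNReal.tsum_mul_left]
  congr 3
  funext n
  rw [lintegral_const_mul' _ _ ENNReal.ofReal_ne_top, lintegral_pow_mul_neg_log]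

/-- The Littlewood-Paley formula. -/
lemma greenEnergy_zeroPt {f : Disc → ℂ} (hf : IsHolo f) :
    greenEnergy zeroPt f = 2⁻¹ * hardyNormSq (fun z => f z - f zeroPt) := by
  obtain ⟨c, hc, hd⟩ := exists_hasCoeff_deriv hf
  rw [greenEnergy_zeroPt_eq_tsum hd, hardyNormSq_sub_apply_zeroPt hc, ← ENNReal.tsum_mul_left]
  exact tsum_congr fun n => littlewood_paley_coeff (c (n + 1)) n

lemma greenEnergy_eq_osc {f : Disc → ℂ} (hf : IsHolo f) (w : Disc) :
    greenEnergy w f = 2⁻¹ * osc w f := by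
  rw [greenEnergy_comp_mob hf, greenEnergy_zeroPt (hf.comp_mob w), mob_zeroPt, osc]

lemma IsHolo.measurable_osc {f : Disc → ℂ} (hf : IsHolo f) : Measurable fun w => osc w f := by
  have : (fun w => osc w f) = fun w => 2 * greenEnergy w f := by
    funext w
    rw [greenEnergy_eq_osc hf, ← mul_assoc, ENNReal.mul_inv_cancel (by simp) (by simp), one_mul]
  rw [this]
  exact (measurable_greenEnergy f).const_mul 2

lemma IsHolo.dirichletIntegral_eq {f : Disc → ℂ} (hf : IsHolo f) (μ : Measure Disc)
    [IsFiniteMeasure μ] : dirichletIntegral μ f = 2⁻¹ * ∫⁻ w, osc w f ∂μ := by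
  rw [dirichletIntegral_eq_lintegral_greenEnergy]
  simp_rw [greenEnergy_eq_osc hf]
  rw [lintegral_const_mul' _ _ (by simp)]

/-! ### The norm of `D_μ`: parallelogram law and lower semicontinuity -/

lemma osc_parallelogram {f g : Disc → ℂ} (hf : IsHolo f) (hg : IsHolo g) (w : Disc) :
    osc w (f + g) + osc w (f - g) = 2 * osc w f + 2 * osc w g := by
  have := hardyNormSq_parallelogram ((hf.comp_mob w).sub (isHolo_const (f w)))
    ((hg.comp_mob w).sub (isHolo_const (g w)))
  simp only [osc]
  have e1 : (fun z => (f + g) (mob w z) - (f + g) w) =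
      ((fun z => f (mob w z)) - fun _ => f w) + ((fun z => g (mob w z)) - fun _ => g w) := by
    funext z; simp; ring
  have e2 : (fun z => (f - g) (mob w z) - (f - g) w) =
      ((fun z => f (mob w z)) - fun _ => f w) - ((fun z => g (mob w z)) - fun _ => g w) := by
    funext z; simp; ring
  rw [e1, e2]
  exact this

lemma osc_smul_le (c : ℂ) (f : Disc → ℂ) (w : Disc) : osc w (c • f) ≤ ‖c‖ₑ ^ 2 * osc w f := by
  refine le_trans (le_of_eq ?_) (hardyNormSq_smul_le c _)
  simp only [osc]
  congr 1
  funext z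
  simp [mul_sub]

lemma osc_le_liminf {F : ℕ → Disc → ℂ} {f : Disc → ℂ} (hF : ∀ n, IsHolo (F n))
    (hlim : ∀ z, Tendsto (fun n => F n z) atTop (𝓝 (f z))) (w : Disc) :
    osc w f ≤ liminf (fun n => osc w (F n)) atTop :=
  hardyNormSq_le_liminf (fun n => ((hF n).comp_mob w).sub (isHolo_const (F n w)))
    fun z => (hlim (mob w z)).sub (hlim w)

lemma mem_dirichletSpace_iff {μ : Measure Disc} {f : Disc → ℂ} :
    f ∈ dirichletSpace μ ↔ IsHolo f ∧ dirichletNormSq μ f < ⊤ := by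
  simp only [dirichletSpace, hardySpace, Set.mem_ofPred_eq, dirichletNormSq, ENNReal.add_lt_top]
  tauto

/-- Closed balls are convex, so convex combinations of a tail inherit its pointwise limit. -/
lemma norm_sub_le_of_mem_convexHull {F : ℕ → Disc → ℂ} {z : Disc} {c : ℂ} {ε : ℝ} {n : ℕ}
    (h : ∀ k, n ≤ k → ‖F k z - c‖ ≤ ε) {g : Disc → ℂ}
    (hg : g ∈ convexHull ℝ (Set.range fun k => F (n + k))) : ‖g z - c‖ ≤ ε := by
  have hc : Convex ℝ {u : Disc → ℂ | u z ∈ Metric.closedBall c ε} :=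
    (convex_closedBall c ε).linear_preimage (LinearMap.proj (R := ℝ) (φ := fun _ : Disc => ℂ) z)
  have := convexHull_min (s := Set.range fun k => F (n + k)) ?_ hc hg
  · simpa [dist_eq_norm] using this
  · rintro _ ⟨k, rfl⟩
    simpa [dist_eq_norm] using h (n + k) (Nat.le_add_right _ _)

lemma liminf_add_liminf_le (u v : ℕ → ENNReal) :
    liminf u atTop + liminf v atTop ≤ liminf (fun n => u n + v n) atTop := by
  have hm : ∀ u : ℕ → ENNReal, Monotone fun n => ⨅ i, ⨅ _ : i ≥ n, u i := fun u n m hnm =>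
    le_iInf₂ fun i hi => iInf₂_le i (hnm.trans hi)
  rw [liminf_eq_iSup_iInf_of_nat, liminf_eq_iSup_iInf_of_nat, liminf_eq_iSup_iInf_of_nat,
    ENNReal.iSup_add_iSup_of_monotone (hm u) (hm v)]
  exact iSup_mono fun n => le_iInf₂ fun i hi => add_le_add (iInf₂_le i hi) (iInf₂_le i hi)

section
variable (μ : Measure Disc) [IsFiniteMeasure μ]

lemma IsHolo.dirichletNormSq_eq {f : Disc → ℂ} (hf : IsHolo f) :
    dirichletNormSq μ f = hardyNormSq f + 2⁻¹ * ∫⁻ w, osc w f ∂μ := by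
  rw [dirichletNormSq, hf.dirichletIntegral_eq μ]

lemma dirichletNormSq_parallelogram {f g : Disc → ℂ} (hf : IsHolo f) (hg : IsHolo g) :
    dirichletNormSq μ (f + g) + dirichletNormSq μ (f - g) =
      2 * dirichletNormSq μ f + 2 * dirichletNormSq μ g := by
  rw [(hf.add hg).dirichletNormSq_eq μ, (hf.sub hg).dirichletNormSq_eq μ, hf.dirichletNormSq_eq μ,
    hg.dirichletNormSq_eq μ]
  have h1 := hardyNormSq_parallelogram hf hg
  have h2 : ∫⁻ w, osc w (f + g) ∂μ + ∫⁻ w, osc w (f - g) ∂μ =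
      2 * ∫⁻ w, osc w f ∂μ + 2 * ∫⁻ w, osc w g ∂μ := by
    rw [← lintegral_add_left (hf.add hg).measurable_osc,
      ← lintegral_const_mul' _ _ (by simp : (2 : ENNReal) ≠ ⊤),
      ← lintegral_const_mul' _ _ (by simp : (2 : ENNReal) ≠ ⊤),
      ← lintegral_add_left (hf.measurable_osc.const_mul 2)]
    exact lintegral_congr fun w => osc_parallelogram hf hg w
  calc _ = (hardyNormSq (f + g) + hardyNormSq (f - g)) +
        2⁻¹ * (∫⁻ w, osc w (f + g) ∂μ + ∫⁻ w, osc w (f - g) ∂μ) := by ring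
    _ = _ := by rw [h1, h2]; ring

lemma dirichletNormSq_smul_le (c : ℂ) {f : Disc → ℂ} (hf : IsHolo f) :
    dirichletNormSq μ (c • f) ≤ ‖c‖ₑ ^ 2 * dirichletNormSq μ f := by
  rw [(hf.smul c).dirichletNormSq_eq μ, hf.dirichletNormSq_eq μ, mul_add, mul_left_comm,
    ← lintegral_const_mul' _ _ (by simp : ‖c‖ₑ ^ 2 ≠ ⊤)]
  gcongr with w
  · exact hardyNormSq_smul_le c f
  · exact osc_smul_le c f w

/-- Fatou's lemma, on circles for each `osc w` and once more for the integral in `w`. -/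
lemma dirichletNormSq_le_of_tendsto {F : ℕ → Disc → ℂ} {f : Disc → ℂ} (hF : ∀ n, IsHolo (F n))
    (hf : IsHolo f) (hlim : ∀ z, Tendsto (fun n => F n z) atTop (𝓝 (f z))) {C : ENNReal}
    (hC : ∀ᶠ n in atTop, dirichletNormSq μ (F n) ≤ C) : dirichletNormSq μ f ≤ C := by
  have h1 := hardyNormSq_le_liminf hF hlim
  have h2 : 2⁻¹ * ∫⁻ w, osc w f ∂μ ≤ liminf (fun n => 2⁻¹ * ∫⁻ w, osc w (F n) ∂μ) atTop := by
    rw [ENNReal.liminf_const_mul_of_ne_top (by simp)]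
    gcongr
    exact (lintegral_mono fun w => osc_le_liminf hF hlim w).trans
      (lintegral_liminf_le fun n => (hF n).measurable_osc)
  rw [hf.dirichletNormSq_eq μ]
  refine ((add_le_add h1 h2).trans (liminf_add_liminf_le _ _)).trans ?_
  refine liminf_le_of_frequently_le' (Eventually.frequently ?_)
  filter_upwards [hC] with n hn
  rwa [(hF n).dirichletNormSq_eq μ] at hn

variable {μ}

/-- Invariant subspaces are closed under bounded pointwise limits. -/
lemma IsInvariantSubspace.mem_of_tendsto {M : Submodule ℂ (Disc → ℂ)}
    (hM : IsInvariantSubspace μ M) {F : ℕ → Disc → ℂ} {f : Disc → ℂ} (hF : ∀ n, F n ∈ M)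
    (hf : IsHolo f) (hlim : ∀ z, Tendsto (fun n => F n z) atTop (𝓝 (f z))) {C : ENNReal}
    (hC : C < ⊤) (hb : ∀ n, dirichletNormSq μ (F n) ≤ C) : f ∈ M := by
  have hholo : ∀ g ∈ M, IsHolo g := fun g hg => (hM.subset g hg).1.1
  -- Convex hulls of the tails. Nearly minimal elements of `K n` still tend to `f` pointwise, and
  -- the parallelogram law makes them Cauchy: an elementary form of Mazur's lemma.
  let K : ℕ → Set (Disc → ℂ) := fun n => convexHull ℝ (Set.range fun k => F (n + k))
  have hKM : ∀ n, K n ⊆ M := fun n => convexHull_min (by rintro _ ⟨k, rfl⟩; exact hF _)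
    (M.restrictScalars ℝ).convex
  have hKanti : ∀ {n m}, n ≤ m → K m ⊆ K n := by
    intro n m hnm
    refine convexHull_mono ?_
    rintro _ ⟨k, rfl⟩
    exact ⟨m - n + k, by simp only; congr 1; omega⟩
  let d : ℕ → ENNReal := fun n => ⨅ h ∈ K n, dirichletNormSq μ h
  have hdle : ∀ n, ∀ h ∈ K n, d n ≤ dirichletNormSq μ h := fun n h hh => iInf₂_le h hh
  have hdC : ∀ n, d n ≤ C := fun n =>
    (hdle n (F (n + 0)) (subset_convexHull ℝ _ ⟨0, rfl⟩)).trans (hb _)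
  have hdmono : Monotone d := fun n m hnm => le_iInf₂ fun h hh => hdle n h (hKanti hnm hh)
  let D : ENNReal := ⨆ n, d n
  have hDC : D ≤ C := iSup_le hdC
  have hDtop : D ≠ ⊤ := (hDC.trans_lt hC).ne
  have hex : ∀ n : ℕ, ∃ h ∈ K n, dirichletNormSq μ h ≤ d n + ((n : ENNReal) + 1)⁻¹ := by
    intro n
    have hlt : d n < d n + ((n : ENNReal) + 1)⁻¹ :=
      ENNReal.lt_add_right ((hdC n).trans_lt hC).ne (by simp)
    obtain ⟨h, hh⟩ := iInf_lt_iff.1 hlt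
    obtain ⟨hK, hlt⟩ := iInf_lt_iff.1 hh
    exact ⟨h, hK, hlt.le⟩
  choose h hhK hhle using hex
  have hhM : ∀ n, h n ∈ M := fun n => hKM n (hhK n)
  have hconv : ∀ z, Tendsto (fun n => h n z) atTop (𝓝 (f z)) := by
    intro z
    rw [Metric.tendsto_atTop]
    intro ε hε
    obtain ⟨N, hN⟩ := Metric.tendsto_atTop.1 (hlim z) (ε / 2) (half_pos hε)
    refine ⟨N, fun n hn => ?_⟩
    rw [dist_eq_norm]
    refine lt_of_le_of_lt (norm_sub_le_of_mem_convexHull (ε := ε / 2) (fun k hk => ?_) (hhK n))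
      (half_lt_self hε)
    have := hN k (hn.trans hk)
    rw [dist_eq_norm] at this
    exact this.le
  -- The midpoint of `h n` and `h m` lies in `K N`, so its squared norm is at least `d N`, while
  -- those of `h n` and `h m` exceed `D` by at most `1 / (N + 1)`.
  have hcauchy : ∀ N n m, N ≤ n → N ≤ m →
      dirichletNormSq μ (h n - h m) + 4 * d N ≤ 4 * (D + ((N : ENNReal) + 1)⁻¹) := by
    intro N n m hn hm
    have h2 : ((2 : ℂ)⁻¹ • (h n + h m)) ∈ K N := by
      have := (convex_convexHull ℝ (Set.range fun k => F (N + k))) (hKanti hn (hhK n))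
        (hKanti hm (hhK m)) (show (0 : ℝ) ≤ 2⁻¹ by norm_num) (show (0 : ℝ) ≤ 2⁻¹ by norm_num)
        (by norm_num)
      convert this using 1
      funext z
      simp
      ring
    have h3 := hdle N _ h2
    have h4 := h3.trans (dirichletNormSq_smul_le μ _ ((hholo _ (hhM n)).add (hholo _ (hhM m))))
    have h5 : 4 * d N ≤ dirichletNormSq μ (h n + h m) := by
      have : ‖(2 : ℂ)⁻¹‖ₑ ^ 2 = 4⁻¹ := by
        rw [enorm_inv (by norm_num), ← ENNReal.inv_pow]
        congr 1
        rw [← ofReal_norm]; norm_num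
      rw [this] at h4
      calc 4 * d N ≤ 4 * (4⁻¹ * dirichletNormSq μ (h n + h m)) := by gcongr
        _ = _ := by rw [← mul_assoc, ENNReal.mul_inv_cancel (by simp) (by simp), one_mul]
    have hk : ∀ k, N ≤ k → dirichletNormSq μ (h k) ≤ D + ((N : ENNReal) + 1)⁻¹ := fun k hk =>
      (hhle k).trans (add_le_add (le_iSup d k) (by gcongr))
    calc _ ≤ dirichletNormSq μ (h n - h m) + dirichletNormSq μ (h n + h m) := by gcongr
      _ = 2 * dirichletNormSq μ (h n) + 2 * dirichletNormSq μ (h m) := by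
        rw [add_comm, dirichletNormSq_parallelogram μ (hholo _ (hhM n)) (hholo _ (hhM m))]
      _ ≤ 2 * (D + ((N : ENNReal) + 1)⁻¹) + 2 * (D + ((N : ENNReal) + 1)⁻¹) := by
        gcongr
        exacts [hk n hn, hk m hm]
      _ = _ := by ring
  -- Letting `m → ∞` needs only lower semicontinuity, because the limit `f` is already known.
  have hlimit : ∀ N n, N ≤ n →
      dirichletNormSq μ (h n - f) ≤ 4 * (D + ((N : ENNReal) + 1)⁻¹) - 4 * d N := by
    intro N n hn
    refine dirichletNormSq_le_of_tendsto μ (F := fun m => h n - h m)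
      (fun m => (hholo _ (hhM n)).sub (hholo _ (hhM m))) ((hholo _ (hhM n)).sub hf)
      (fun z => tendsto_const_nhds.sub (hconv z)) ?_
    filter_upwards [eventually_ge_atTop N] with m hm
    exact ENNReal.le_sub_of_add_le_right
      (ENNReal.mul_ne_top (by simp) ((hdC N).trans_lt hC).ne) (hcauchy N n m hn hm)
  refine hM.closed h f hhM (mem_dirichletSpace_iff.2 ⟨hf, lt_of_le_of_lt
    (dirichletNormSq_le_of_tendsto μ (fun n => hholo _ (hF n)) hf hlim
      (Eventually.of_forall hb)) hC⟩) ?_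
  have hdD : Tendsto d atTop (𝓝 D) := tendsto_atTop_iSup hdmono
  have hinv : Tendsto (fun N : ℕ => ((N : ENNReal) + 1)⁻¹) atTop (𝓝 0) := by
    have := (tendsto_add_atTop_iff_nat 1).2 ENNReal.tendsto_inv_nat_nhds_zero
    simpa using this
  have hT : Tendsto (fun N : ℕ => 4 * (D + ((N : ENNReal) + 1)⁻¹) - 4 * d N) atTop (𝓝 0) := by
    have t1 : Tendsto (fun N : ℕ => 4 * (D + ((N : ENNReal) + 1)⁻¹)) atTop (𝓝 (4 * D)) := by
      have := ENNReal.Tendsto.const_mul (a := 4) (tendsto_const_nhds (x := D).add hinv)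
        (Or.inr (by simp))
      simpa using this
    have t2 := ENNReal.Tendsto.const_mul (a := 4) hdD (Or.inr (by simp))
    have := ENNReal.Tendsto.sub t1 t2 (Or.inl (ENNReal.mul_ne_top (by simp) hDtop))
    simpa using this
  exact tendsto_of_tendsto_of_tendsto_of_le_of_le tendsto_const_nhds hT (fun _ => zero_le)
    fun N => hlimit N N le_rfl
end

/-! ### Multiplication by bounded functions inside an invariant subspace -/

lemma hardyNormSq_smul (c : ℂ) (f : Disc → ℂ) :
    hardyNormSq (c • f) = ‖c‖ₑ ^ 2 * hardyNormSq f := by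
  refine le_antisymm (hardyNormSq_smul_le c f) ?_
  rcases eq_or_ne c 0 with rfl | hc
  · simp
  · have h := hardyNormSq_smul_le c⁻¹ (c • f)
    rw [inv_smul_smul₀ hc, enorm_inv hc, ← ENNReal.inv_pow] at h
    calc _ ≤ ‖c‖ₑ ^ 2 * ((‖c‖ₑ ^ 2)⁻¹ * hardyNormSq (c • f)) := by gcongr
      _ = _ := by
        rw [← mul_assoc, ENNReal.mul_inv_cancel (by simpa using hc) (by simp), one_mul]

lemma hardyNormSq_mul_le {φ : Disc → ℂ} {C : ℝ} (hC : ∀ z, ‖φ z‖ ≤ C) (f : Disc → ℂ) :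
    hardyNormSq (φ * f) ≤ ENNReal.ofReal (C ^ 2) * hardyNormSq f := by
  have hC0 : 0 ≤ C := (norm_nonneg _).trans (hC zeroPt)
  have h : ENNReal.ofReal (C ^ 2) = ‖(C : ℂ)‖ₑ ^ 2 := by
    rw [← ofReal_norm, Complex.norm_of_nonneg hC0, ENNReal.ofReal_pow hC0]
  rw [h, ← hardyNormSq_smul]
  refine hardyNormSq_mono fun z => ?_
  simp only [Pi.mul_apply, Pi.smul_apply, smul_eq_mul, norm_mul, Complex.norm_of_nonneg hC0]
  gcongr
  exact hC z

/-- Leibniz splitting `φ f - φ(w) f(w) = φ (f - f(w)) + f(w) (φ - φ(w))`, composed with `mob w`. -/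
lemma osc_mul_le {φ f : Disc → ℂ} (hφ : IsHolo φ) (hf : IsHolo f) {C : ℝ} (hC : ∀ z, ‖φ z‖ ≤ C)
    (w : Disc) :
    osc w (φ * f) ≤ 2 * (ENNReal.ofReal (C ^ 2) * osc w f) + 2 * (‖f w‖ₑ ^ 2 * osc w φ) := by
  have e : (fun z => (φ * f) (mob w z) - (φ * f) w) =
      (fun z => φ (mob w z)) * (fun z => f (mob w z) - f w) +
        f w • fun z => φ (mob w z) - φ w := by
    funext z; simp; ring
  rw [osc, e]
  refine (hardyNormSq_add_le ((hφ.comp_mob w).mul ((hf.comp_mob w).sub (isHolo_const _)))).trans ?_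
  rw [hardyNormSq_smul]
  have h := hardyNormSq_mul_le (φ := fun z => φ (mob w z)) (fun z => hC _)
    fun z => f (mob w z) - f w
  exact add_le_add (mul_le_mul_right h 2) le_rfl

/-- The same splitting solved for the other term: finite energy of `φ * f` takes the place of `φ`
being a multiplier. -/
lemma norm_sq_mul_osc_le {φ f : Disc → ℂ} (hφ : IsHolo φ) (hf : IsHolo f) {C : ℝ}
    (hC : ∀ z, ‖φ z‖ ≤ C) (w : Disc) :
    ‖f w‖ₑ ^ 2 * osc w φ ≤ 2 * osc w (φ * f) + 2 * (ENNReal.ofReal (C ^ 2) * osc w f) := by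
  have e : (f w • fun z => φ (mob w z) - φ w) = (fun z => (φ * f) (mob w z) - (φ * f) w) +
      (fun z => -φ (mob w z)) * (fun z => f (mob w z) - f w) := by
    funext z; simp; ring
  rw [osc, ← hardyNormSq_smul, e]
  refine (hardyNormSq_add_le (((hφ.mul hf).comp_mob w).sub (isHolo_const _))).trans ?_
  have h := hardyNormSq_mul_le (φ := fun z => -φ (mob w z)) (C := C)
    (fun z => by rw [norm_neg]; exact hC _) fun z => f (mob w z) - f w
  exact add_le_add le_rfl (mul_le_mul_right h 2)

/-- Only `osc w` of the dilated factor needs `osc_scale_le`, and the reverse splitting then returns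
to the undilated product: `18 = 2 + 8 * 2` and `16 = 8 * 2`, with `8 = 2 * 4`. The bound does not
depend on `r`. -/
lemma osc_mul_scale_le {a : HSeq} {f : Disc → ℂ} (hf : IsHolo f) {C : ℝ}
    (hC : ∀ z, ‖ev a z‖ ≤ C) (r : Set.Icc (0 : ℝ) 1) (w : Disc) :
    osc w ((fun z => ev a (z.scale r)) * f) ≤
      18 * ENNReal.ofReal (C ^ 2) * osc w f + 16 * osc w (ev a * f) := by
  refine (osc_mul_le ((isHolo_ev a).comp_scale r) hf (fun z => hC _) w).trans ?_
  have h1 := norm_sq_mul_osc_le (isHolo_ev a) hf hC w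
  calc _ ≤ 2 * (ENNReal.ofReal (C ^ 2) * osc w f) + 2 * (‖f w‖ₑ ^ 2 * (4 * osc w (ev a))) := by
        gcongr; exact osc_scale_le a w r
    _ = 2 * (ENNReal.ofReal (C ^ 2) * osc w f) + 8 * (‖f w‖ₑ ^ 2 * osc w (ev a)) := by ring
    _ ≤ 2 * (ENNReal.ofReal (C ^ 2) * osc w f) +
        8 * (2 * osc w (ev a * f) + 2 * (ENNReal.ofReal (C ^ 2) * osc w f)) := by gcongr
    _ = _ := by ring

/-- The coordinate function. -/
def coordFn (z : Disc) : ℂ := z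

lemma isHolo_coordFn : IsHolo coordFn :=
  isHolo_of_differentiableOn differentiableOn_id fun _ => rfl

/-- `osc w coordFn` is at most `1 - ‖w‖²`, which compensates the growth of `‖ev a w‖²`. Hence
Lipschitz factors cost at most a multiple of the finite mass of `μ`. -/
lemma norm_sq_mul_osc_coordFn_le (a : HSeq) (w : Disc) :
    ‖ev a w‖ₑ ^ 2 * osc w coordFn ≤ ENNReal.ofReal (‖a‖ ^ 2) := by
  have h1 := hardyNormSq_comp_mob_eq_osc_add isHolo_coordFn w
  have h2 : hardyNormSq (fun z => coordFn (mob w z)) ≤ ENNReal.ofReal (1 ^ 2) :=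
    hardyNormSq_le_of_bound fun z => (mob w z).norm_lt.le
  have h3 : osc w coordFn ≤ ENNReal.ofReal (1 - ‖(w : ℂ)‖ ^ 2) := by
    rw [ENNReal.ofReal_sub _ (by positivity)]
    refine ENNReal.le_sub_of_add_le_right ENNReal.ofReal_ne_top ?_
    rw [h1] at h2
    simpa [coordFn] using h2
  have h4 := norm_ev_sq_le a w
  calc _ ≤ ‖ev a w‖ₑ ^ 2 * ENNReal.ofReal (1 - ‖(w : ℂ)‖ ^ 2) := by gcongr
    _ = ENNReal.ofReal (‖ev a w‖ ^ 2 * (1 - ‖(w : ℂ)‖ ^ 2)) := by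
      rw [ENNReal.ofReal_mul (by positivity), ENNReal.ofReal_pow (norm_nonneg _), ofReal_norm]
    _ ≤ _ := ENNReal.ofReal_le_ofReal (by linarith)

lemma osc_le_of_lipschitz {p : Disc → ℂ} {L : ℝ} (w : Disc)
    (hL : ∀ z, ‖p z - p w‖ ≤ L * ‖(z : ℂ) - w‖) : osc w p ≤ ENNReal.ofReal (L ^ 2) * osc w coordFn := by
  have h := hardyNormSq_smul (L : ℂ) fun z => coordFn (mob w z) - coordFn w
  have e : ‖(L : ℂ)‖ₑ ^ 2 = ENNReal.ofReal (L ^ 2) := by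
    rw [← ofReal_norm, Complex.norm_real, Real.norm_eq_abs, ← ENNReal.ofReal_pow (abs_nonneg _), sq_abs]
  rw [osc, osc, ← e, ← h]
  refine hardyNormSq_mono fun z => ?_
  refine (hL _).trans ?_
  simp only [Pi.smul_apply, smul_eq_mul, norm_mul, coordFn, Complex.norm_real, Real.norm_eq_abs]
  gcongr
  exact le_abs_self L

lemma norm_pow_sub_pow_le (z w : Disc) (n : ℕ) : ‖(z : ℂ) ^ n - (w : ℂ) ^ n‖ ≤ n * ‖(z : ℂ) - w‖ := by
  induction n with
  | zero => simp
  | succ n ih =>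
    have e : (z : ℂ) ^ (n + 1) - (w : ℂ) ^ (n + 1) =
        z * ((z : ℂ) ^ n - (w : ℂ) ^ n) + (z - w) * (w : ℂ) ^ n := by ring
    have h1 : ‖(w : ℂ)‖ ^ n ≤ 1 := pow_le_one₀ (norm_nonneg _) w.norm_lt.le
    rw [e]
    refine (norm_add_le _ _).trans ?_
    rw [norm_mul, norm_mul, norm_pow]
    push_cast
    nlinarith [norm_nonneg ((z : ℂ) ^ n - (w : ℂ) ^ n), z.norm_lt, norm_nonneg ((z : ℂ) - w)]

lemma IsInvariantSubspace.pow_mul_mem {μ : Measure Disc}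
    {M : Submodule ℂ (Disc → ℂ)} (hM : IsInvariantSubspace μ M) {f : Disc → ℂ} (hf : f ∈ M)
    (n : ℕ) : (fun z : Disc => (z : ℂ) ^ n * f z) ∈ M := by
  induction n with
  | zero => simpa using hf
  | succ n ih =>
    convert hM.shift _ ih using 2 with z
    ring

section
variable {μ : Measure Disc} [IsFiniteMeasure μ]

/-- A common form for polynomial and dilated multipliers; 18 is the constant of the dilates, while
polynomials need only 2. -/
lemma dirichletNormSq_mul_le {φ f : Disc → ℂ} (hφ : IsHolo φ) (hf : IsHolo f) {C : ℝ}
    (hC : ∀ z, ‖φ z‖ ≤ C) {Y : Disc → ENNReal}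
    (hY : ∀ w, osc w (φ * f) ≤ ENNReal.ofReal (C ^ 2) * (18 * osc w f) + Y w) :
    dirichletNormSq μ (φ * f) ≤ ENNReal.ofReal (C ^ 2) * (hardyNormSq f + 18 * ∫⁻ w, osc w f ∂μ) +
      ∫⁻ w, Y w ∂μ := by
  rw [(hφ.mul hf).dirichletNormSq_eq μ, mul_add, add_assoc]
  have h2 : (2⁻¹ : ENNReal) ≤ 1 := by simp
  refine add_le_add (hardyNormSq_mul_le hC f) ?_
  calc 2⁻¹ * ∫⁻ w, osc w (φ * f) ∂μ ≤ 1 * ∫⁻ w, osc w (φ * f) ∂μ := by gcongr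
    _ ≤ ∫⁻ w, (ENNReal.ofReal (C ^ 2) * (18 * osc w f) + Y w) ∂μ := by
      rw [one_mul]; exact lintegral_mono hY
    _ = _ := by
      rw [lintegral_add_left ((hf.measurable_osc.const_mul _).const_mul _),
        lintegral_const_mul' _ _ ENNReal.ofReal_ne_top, lintegral_const_mul' _ _ (by simp)]

lemma lintegral_osc_lt_top {f : Disc → ℂ} (hf : f ∈ dirichletSpace μ) :
    ∫⁻ w, osc w f ∂μ < ⊤ := by
  have h := hf.2
  rw [IsHolo.dirichletIntegral_eq hf.1.1] at h
  by_contra hc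
  rw [not_lt, top_le_iff] at hc
  rw [hc] at h
  simp [ENNReal.mul_top] at h

variable {M : Submodule ℂ (Disc → ℂ)}

/-- The Taylor coefficients of a dilate decay geometrically, so its Taylor polynomials are bounded
and Lipschitz uniformly in the degree. Their products with `f` lie in `M`, have bounded norms and
converge pointwise. -/
lemma IsInvariantSubspace.scale_mul_mem (hM : IsInvariantSubspace μ M) {f : Disc → ℂ} (hf : f ∈ M)
    (a : HSeq) {r : Set.Icc (0 : ℝ) 1} (hr : (r : ℝ) < 1) :
    (fun z => ev a (z.scale r)) * f ∈ M := by
  have hfD := hM.subset f hf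
  obtain ⟨b, rfl⟩ := exists_ev hfD.1
  have hr0 := r.2.1
  have hs : Summable fun n : ℕ => (n : ℝ) * (r : ℝ) ^ n := by
    have := summable_pow_mul_geometric_of_norm_lt_one (R := ℝ) 1 (r := r)
      (by rwa [Real.norm_eq_abs, abs_of_nonneg hr0])
    simpa using this
  have hs0 : Summable fun n : ℕ => (r : ℝ) ^ n := summable_geometric_of_lt_one hr0 hr
  let p : ℕ → Disc → ℂ := fun N z => ∑ n ∈ Finset.range N, a n * (r : ℝ) ^ n * (z : ℂ) ^ n
  have hcn : ∀ n, ‖a n * ((r : ℝ) : ℂ) ^ n‖ ≤ ‖a‖ * (r : ℝ) ^ n := fun n => by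
    rw [norm_mul, norm_pow, Complex.norm_of_nonneg hr0]
    gcongr
    exact lp.norm_apply_le_norm (by norm_num) a n
  have hph : ∀ N, IsHolo (p N) := fun N => isHolo_of_differentiableOn
    (F := fun z => ∑ n ∈ Finset.range N, a n * (r : ℝ) ^ n * z ^ n) (by fun_prop) fun _ => rfl
  set A : ℝ := ‖a‖ * ∑' n : ℕ, (r : ℝ) ^ n
  set L : ℝ := ‖a‖ * ∑' n : ℕ, (n : ℝ) * (r : ℝ) ^ n
  have hpA : ∀ N z, ‖p N z‖ ≤ A := by
    intro N z
    calc ‖p N z‖ ≤ ∑ n ∈ Finset.range N, ‖a‖ * (r : ℝ) ^ n := by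
          refine norm_sum_le_of_le _ fun n _ => ?_
          rw [norm_mul, norm_pow]
          refine (mul_le_of_le_one_right (norm_nonneg _)
            (pow_le_one₀ (norm_nonneg _) z.norm_lt.le)).trans (hcn n)
      _ ≤ A := by
          rw [← Finset.mul_sum]
          exact mul_le_mul_of_nonneg_left (hs0.sum_le_tsum _ fun n _ => by positivity) (norm_nonneg _)
  have hpL : ∀ N z w, ‖p N z - p N w‖ ≤ L * ‖(z : ℂ) - w‖ := by
    intro N z w
    have e : p N z - p N w =
        ∑ n ∈ Finset.range N, a n * ((r : ℝ) : ℂ) ^ n * ((z : ℂ) ^ n - (w : ℂ) ^ n) := by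
      simp only [p, ← Finset.sum_sub_distrib, mul_sub]
    calc ‖p N z - p N w‖ ≤ ∑ n ∈ Finset.range N, ‖a‖ * ((n : ℝ) * (r : ℝ) ^ n) * ‖(z : ℂ) - w‖ := by
          rw [e]
          refine norm_sum_le_of_le _ fun n _ => ?_
          rw [norm_mul]
          calc _ ≤ (‖a‖ * (r : ℝ) ^ n) * (n * ‖(z : ℂ) - w‖) :=
                mul_le_mul (hcn n) (norm_pow_sub_pow_le z w n) (norm_nonneg _) (by positivity)
            _ = _ := by ring
      _ ≤ _ := by
          rw [← Finset.sum_mul, ← Finset.mul_sum]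
          refine mul_le_mul_of_nonneg_right ?_ (norm_nonneg _)
          exact mul_le_mul_of_nonneg_left (hs.sum_le_tsum _ fun n _ => by positivity) (norm_nonneg _)
  refine hM.mem_of_tendsto (F := fun N => p N * ev b)
    (C := ENNReal.ofReal (A ^ 2) * (hardyNormSq (ev b) + 18 * ∫⁻ w, osc w (ev b) ∂μ) +
      ∫⁻ _, 2 * (ENNReal.ofReal (L ^ 2) * ENNReal.ofReal (‖b‖ ^ 2)) ∂μ) (fun N => ?_)
    (((isHolo_ev a).comp_scale r).mul (isHolo_ev b)) (fun z => ?_) ?_ fun N => ?_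
  · have : p N * ev b = ∑ n ∈ Finset.range N, (a n * ((r : ℝ) : ℂ) ^ n) •
        fun z : Disc => (z : ℂ) ^ n * ev b z := by
      funext z
      simp only [p, Pi.mul_apply, Finset.sum_apply, Pi.smul_apply, smul_eq_mul, Finset.sum_mul,
        mul_assoc]
    rw [this]
    exact M.sum_mem fun n _ => M.smul_mem _ (hM.pow_mul_mem hf n)
  · have h1 := (hasCoeff_ev a (z.scale r)).tendsto_sum_nat
    simp only [Pi.mul_apply]
    refine Tendsto.mul_const _ (h1.congr fun N => ?_)
    refine Finset.sum_congr rfl fun n _ => ?_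
    rw [Disc.coe_scale, mul_pow]; ring
  · refine ENNReal.add_lt_top.2 ⟨ENNReal.mul_lt_top ENNReal.ofReal_lt_top (ENNReal.add_lt_top.2
      ⟨hfD.1.2, ENNReal.mul_lt_top (by simp) (lintegral_osc_lt_top hfD)⟩), ?_⟩
    rw [lintegral_const]
    exact ENNReal.mul_lt_top (ENNReal.mul_lt_top (by simp) (ENNReal.mul_lt_top
      ENNReal.ofReal_lt_top ENNReal.ofReal_lt_top)) (measure_lt_top μ _)
  · refine dirichletNormSq_mul_le (hph N) (isHolo_ev b) (hpA N) fun w => ?_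
    refine (osc_mul_le (hph N) (isHolo_ev b) (hpA N) w).trans ?_
    rw [mul_left_comm]
    gcongr ?_ + 2 * ?_
    · gcongr; norm_num
    · calc _ ≤ ‖ev b w‖ₑ ^ 2 * (ENNReal.ofReal (L ^ 2) * osc w coordFn) := by
            gcongr; exact osc_le_of_lipschitz w fun z => hpL N z w
        _ = ENNReal.ofReal (L ^ 2) * (‖ev b w‖ₑ ^ 2 * osc w coordFn) := by ring
        _ ≤ _ := by gcongr; exact norm_sq_mul_osc_coordFn_le b w

lemma exists_ev_of_bound {φ : Disc → ℂ} (hφ : IsHolo φ) {C : ℝ} (hC : ∀ z, ‖φ z‖ ≤ C) :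
    ∃ a : HSeq, ev a = φ :=
  exists_ev ⟨hφ, (hardyNormSq_le_of_bound hC).trans_lt ENNReal.ofReal_lt_top⟩

/-- The radii `1 - 1 / (n + 1)`. -/
noncomputable def radius (n : ℕ) : Set.Icc (0 : ℝ) 1 :=
  ⟨1 - 1 / ((n : ℝ) + 1), by
    rw [sub_nonneg, div_le_one (by positivity)]; linarith [n.cast_nonneg (α := ℝ)],
    by rw [sub_le_self_iff]; positivity⟩

lemma radius_lt_one (n : ℕ) : (radius n : ℝ) < 1 := by
  have : 0 < 1 / ((n : ℝ) + 1) := by positivity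
  simp only [radius]; linarith

lemma tendsto_scale_radius (z : Disc) : Tendsto (fun n => z.scale (radius n)) atTop (𝓝 z) := by
  rw [tendsto_subtype_rng]
  have h1 : Tendsto (fun n => (radius n : ℝ)) atTop (𝓝 1) := by
    have := (tendsto_const_nhds (x := (1 : ℝ))).sub (tendsto_one_div_add_atTop_nhds_zero_nat (𝕜 := ℝ))
    simpa [radius] using this
  have h2 := ((Complex.continuous_ofReal.tendsto 1).comp h1).mul_const (z : ℂ)
  simpa [Disc.coe_scale] using h2

/-- The products of `f` with the dilates of `φ` lie in `M`; finite energy of `φ * f` bounds their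
norms independently of the radius. -/
lemma IsInvariantSubspace.mul_mem (hM : IsInvariantSubspace μ M) {φ f : Disc → ℂ} (hf : f ∈ M)
    (hφ : IsHolo φ) {C : ℝ} (hC : ∀ z, ‖φ z‖ ≤ C) (hφf : φ * f ∈ dirichletSpace μ) :
    φ * f ∈ M := by
  have hfD := hM.subset f hf
  obtain ⟨a, rfl⟩ := exists_ev_of_bound hφ hC
  have hF : ∀ n, (fun z : Disc => ev a (z.scale (radius n))) * f ∈ M :=
    fun n => hM.scale_mul_mem hf a (radius_lt_one n)
  have hlim : ∀ z, Tendsto (fun n => ((fun z : Disc => ev a (z.scale (radius n))) * f) z) atTop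
      (𝓝 ((ev a * f) z)) := fun z => by
    have h1 : Tendsto (fun n => ev a (z.scale (radius n))) atTop (𝓝 (ev a z)) :=
      (hφ.continuous.tendsto z).comp (tendsto_scale_radius z)
    exact h1.mul_const (f z)
  have hlt : ENNReal.ofReal (C ^ 2) * (hardyNormSq f + 18 * ∫⁻ w, osc w f ∂μ) +
      ∫⁻ w, 16 * osc w (ev a * f) ∂μ < ⊤ := by
    refine ENNReal.add_lt_top.2 ⟨ENNReal.mul_lt_top ENNReal.ofReal_lt_top (ENNReal.add_lt_top.2
      ⟨hfD.1.2, ENNReal.mul_lt_top (by simp) (lintegral_osc_lt_top hfD)⟩), ?_⟩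
    rw [lintegral_const_mul' _ _ (by simp)]
    exact ENNReal.mul_lt_top (by simp) (lintegral_osc_lt_top hφf)
  have hb : ∀ n, dirichletNormSq μ ((fun z : Disc => ev a (z.scale (radius n))) * f) ≤
      ENNReal.ofReal (C ^ 2) * (hardyNormSq f + 18 * ∫⁻ w, osc w f ∂μ) +
        ∫⁻ w, 16 * osc w (ev a * f) ∂μ := by
    intro n
    refine dirichletNormSq_mul_le (φ := fun z => ev a (z.scale (radius n)))
      (Y := fun w => 16 * osc w (ev a * f))
      (hφ.comp_scale (radius n)) hfD.1.1 (fun z => hC _) fun w => ?_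
    refine (osc_mul_scale_le hfD.1.1 hC (radius n) w).trans (le_of_eq ?_)
    ring
  exact hM.mem_of_tendsto hF hφf.1.1 hlim hlt hb

/-- Composition with `mob w` preserves sup bounds, so `osc w f ≤ C²` for every `w`. -/
lemma dirichletNormSq_le_of_bound {f : Disc → ℂ} (hf : IsHolo f) {C : ℝ} (hC : ∀ z, ‖f z‖ ≤ C) :
    dirichletNormSq μ f ≤ ENNReal.ofReal (C ^ 2) * (1 + μ Set.univ) := by
  have h2 : (2⁻¹ : ENNReal) ≤ 1 := by simp
  rw [hf.dirichletNormSq_eq μ, mul_add, mul_one]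
  refine add_le_add (hardyNormSq_le_of_bound hC) ?_
  calc 2⁻¹ * ∫⁻ w, osc w f ∂μ ≤ 1 * ∫⁻ _, ENNReal.ofReal (C ^ 2) ∂μ := by
        gcongr with w
        exact (osc_le_comp_mob hf w).trans (hardyNormSq_le_of_bound fun z => hC _)
    _ = _ := by rw [one_mul, lintegral_const]

lemma mem_dirichletSpace_of_bound {f : Disc → ℂ} (hf : IsHolo f) {C : ℝ} (hC : ∀ z, ‖f z‖ ≤ C) :
    f ∈ dirichletSpace μ :=
  mem_dirichletSpace_iff.2 ⟨hf, (dirichletNormSq_le_of_bound hf hC).trans_lt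
    (ENNReal.mul_lt_top ENNReal.ofReal_lt_top
      (ENNReal.add_lt_top.2 ⟨by simp, measure_lt_top μ _⟩))⟩

end

/-! ### Truncation by the Herglotz transform -/

/-- A bounded function whose product with the function with coefficients `a` is bounded. -/
noncomputable def trunc (ε : ℝ) (a : HSeq) (z : Disc) : ℂ := (1 + ε * herglotz a z)⁻¹

lemma herglotz_re_nonneg (a : HSeq) (z : Disc) : 0 ≤ (herglotz a z).re :=
  (sq_nonneg _).trans (norm_sq_le_herglotz_re a z)

lemma one_le_re_one_add_herglotz {ε : ℝ} (hε : 0 ≤ ε) (a : HSeq) (z : Disc) :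
    1 ≤ (1 + ε * herglotz a z).re := by
  have := mul_nonneg hε (herglotz_re_nonneg a z)
  simpa using this

lemma one_add_herglotz_ne_zero {ε : ℝ} (hε : 0 ≤ ε) (a : HSeq) (z : Disc) :
    1 + ε * herglotz a z ≠ 0 := by
  intro h
  have := one_le_re_one_add_herglotz hε a z
  rw [h] at this
  norm_num at this

lemma isHolo_trunc {ε : ℝ} (hε : 0 ≤ ε) (a : HSeq) : IsHolo (trunc ε a) :=
  ((isHolo_const 1).add ((isHolo_herglotz a).smul (ε : ℂ))).inv
    fun z => one_add_herglotz_ne_zero hε a z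

lemma norm_trunc_le {ε : ℝ} (hε : 0 ≤ ε) (a : HSeq) (z : Disc) : ‖trunc ε a z‖ ≤ 1 := by
  rw [trunc, norm_inv]
  exact inv_le_one_of_one_le₀ ((one_le_re_one_add_herglotz hε a z).trans (Complex.re_le_norm _))

/-- `Re (1 / u) = |1 / u|² Re u` for `u = 1 + ε h`. Together with `Re h ≥ |f|²` this yields both the
sup bound and the energy bound for `t f`. -/
lemma trunc_re {ε : ℝ} (hε : 0 ≤ ε) (a : HSeq) (z : Disc) :
    (trunc ε a z).re = ‖trunc ε a z‖ ^ 2 + ε * (‖trunc ε a z‖ ^ 2 * (herglotz a z).re) := by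
  have h := one_add_herglotz_ne_zero hε a z
  have h1 : Complex.normSq (1 + ε * herglotz a z) ≠ 0 := by simpa using h
  rw [trunc, Complex.inv_re, norm_inv, inv_pow, ← Complex.normSq_eq_norm_sq]
  field_simp
  simp

lemma norm_trunc_mul_sq_le {ε : ℝ} (hε : 0 < ε) (a : HSeq) (z : Disc) :
    ‖trunc ε a z * ev a z‖ ^ 2 ≤ ε⁻¹ := by
  have h1 := trunc_re hε.le a z
  have h2 : (trunc ε a z).re ≤ 1 := (Complex.re_le_norm _).trans (norm_trunc_le hε.le a z)
  have h3 : ε * (‖trunc ε a z‖ ^ 2 * ‖ev a z‖ ^ 2) ≤ ε * (‖trunc ε a z‖ ^ 2 * (herglotz a z).re) := by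
    gcongr; exact norm_sq_le_herglotz_re a z
  rw [norm_mul, mul_pow, ← one_div, le_div_iff₀ hε]
  nlinarith [sq_nonneg ‖trunc ε a z‖]

/-- By `trunc_re`, `ε⁻¹ Re t` is a harmonic majorant of `|t f|² + ε⁻¹ |t|²`. After composition with
`mob w`, what remains at the centre is `ε⁻¹ (Re t - |t|²)` at `w`, which is `|t|² Re h`. -/
lemma hardyNormSq_trunc_comp_mob_le {ε : ℝ} (hε : 0 < ε) (a : HSeq) (w : Disc) :
    hardyNormSq (fun z => (trunc ε a * ev a) (mob w z)) ≤
      ENNReal.ofReal (‖trunc ε a w‖ ^ 2 * (herglotz a w).re) := by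
  have ht := isHolo_trunc hε.le a
  have hs : ‖((Real.sqrt ε⁻¹ : ℝ) : ℂ)‖ ^ 2 = ε⁻¹ := by
    rw [Complex.norm_of_nonneg (Real.sqrt_nonneg _), Real.sq_sqrt (by positivity)]
  have h := hardyNormSq_le_of_add_le_re ((ht.mul (isHolo_ev a)).comp_mob w)
    ((ht.comp_mob w).smul ((Real.sqrt ε⁻¹ : ℝ) : ℂ)) ((ht.comp_mob w).smul ((ε⁻¹ : ℝ) : ℂ))
    fun z => by
      simp only [Pi.smul_apply, Pi.mul_apply, smul_eq_mul, norm_mul, mul_pow, hs,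
        Complex.re_ofReal_mul, trunc_re hε.le a (mob w z)]
      have := norm_sq_le_herglotz_re a (mob w z)
      rw [mul_add, ← mul_assoc ε⁻¹ ε, inv_mul_cancel₀ hε.ne', one_mul, add_comm]
      gcongr
  refine h.trans (ENNReal.ofReal_le_ofReal (le_of_eq ?_))
  simp only [Pi.smul_apply, smul_eq_mul, norm_mul, mul_pow, hs, mob_zeroPt, Complex.re_ofReal_mul,
    trunc_re hε.le a w]
  rw [mul_add, ← mul_assoc ε⁻¹ ε, inv_mul_cancel₀ hε.ne']
  ring

/-- The previous bound says `osc w (t f) + |t f|² ≤ |t|² (osc w f + |f|²)` with values at `w`. The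
point values cancel, and `|t| ≤ 1`. -/
lemma osc_trunc_le {ε : ℝ} (hε : 0 < ε) (a : HSeq) (w : Disc) :
    osc w (trunc ε a * ev a) ≤ osc w (ev a) := by
  have h := hardyNormSq_trunc_comp_mob_le hε a w
  rw [hardyNormSq_comp_mob_eq_osc_add ((isHolo_trunc hε.le a).mul (isHolo_ev a)),
    ENNReal.ofReal_mul (by positivity), ← hardyNormSq_comp_mob,
    hardyNormSq_comp_mob_eq_osc_add (isHolo_ev a), mul_add, ← ENNReal.ofReal_mul (by positivity),
    Pi.mul_apply, norm_mul, mul_pow] at h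
  refine ((ENNReal.add_le_add_iff_right ENNReal.ofReal_ne_top).1 h).trans ?_
  refine mul_le_of_le_one_left' ?_
  rw [← ENNReal.ofReal_one]
  refine ENNReal.ofReal_le_ofReal (pow_le_one₀ (norm_nonneg _) (norm_trunc_le hε.le a w))

lemma dirichletNormSq_trunc_le (μ : Measure Disc) [IsFiniteMeasure μ] {ε : ℝ} (hε : 0 < ε)
    (a : HSeq) : dirichletNormSq μ (trunc ε a * ev a) ≤ dirichletNormSq μ (ev a) := by
  have ht := isHolo_trunc hε.le a
  rw [(ht.mul (isHolo_ev a)).dirichletNormSq_eq μ, (isHolo_ev a).dirichletNormSq_eq μ]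
  gcongr with w
  · refine hardyNormSq_mono fun z => ?_
    rw [Pi.mul_apply, norm_mul]
    exact mul_le_of_le_one_left (norm_nonneg _) (norm_trunc_le hε.le a z)
  · exact osc_trunc_le hε a w

/-- An invariant subspace contains every function of the Dirichlet space in its closure in the
Hardy space. -/
lemma IsInvariantSubspace.mem_of_tendsto_hardy {μ : Measure Disc} [IsFiniteMeasure μ]
    {M : Submodule ℂ (Disc → ℂ)} (hM : IsInvariantSubspace μ M) {A : ℕ → HSeq} {a : HSeq}
    (hA : ∀ n, ev (A n) ∈ M) (hlim : Tendsto A atTop (𝓝 a)) (ha : ev a ∈ dirichletSpace μ) :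
    ev a ∈ M := by
  -- For fixed `ε` the truncations are bounded by `ε^(-1/2)` uniformly in `n`, hence bounded in
  -- `D_μ`, however large the `D_μ` norms of the `ev (A n)` are.
  have key : ∀ ε : ℝ, 0 < ε → trunc ε a * ev a ∈ M := by
    intro ε hε
    have hb : ∀ n z, ‖(trunc ε (A n) * ev (A n)) z‖ ≤ Real.sqrt ε⁻¹ := fun n z =>
      Real.le_sqrt_of_sq_le (norm_trunc_mul_sq_le hε (A n) z)
    have hh : ∀ n, IsHolo (trunc ε (A n) * ev (A n)) := fun n =>
      (isHolo_trunc hε.le _).mul (isHolo_ev _)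
    refine hM.mem_of_tendsto (F := fun n => trunc ε (A n) * ev (A n))
      (C := ENNReal.ofReal (Real.sqrt ε⁻¹ ^ 2) * (1 + μ Set.univ)) (fun n => ?_)
      ((isHolo_trunc hε.le a).mul (isHolo_ev a)) (fun z => ?_) ?_ fun n => ?_
    · exact hM.mul_mem (hA n) (isHolo_trunc hε.le _) (norm_trunc_le hε.le _)
        (mem_dirichletSpace_of_bound (hh n) (hb n))
    · refine Tendsto.mul ?_ (tendsto_ev hlim z)
      exact (((tendsto_herglotz hlim z).const_mul (ε : ℂ)).const_add 1).inv₀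
        (one_add_herglotz_ne_zero hε.le a z)
    · exact ENNReal.mul_lt_top ENNReal.ofReal_lt_top
        (ENNReal.add_lt_top.2 ⟨by simp, measure_lt_top μ _⟩)
    · exact dirichletNormSq_le_of_bound (hh n) (hb n)
  -- Now `ε → 0`; truncation does not increase the norm, so the norm of `ev a` is a common bound.
  refine hM.mem_of_tendsto (F := fun n : ℕ => trunc (1 / ((n : ℝ) + 1)) a * ev a)
    (C := dirichletNormSq μ (ev a)) (fun n => key _ (by positivity)) (isHolo_ev a) (fun z => ?_)
    (mem_dirichletSpace_iff.1 ha).2 fun n => dirichletNormSq_trunc_le μ (by positivity) a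
  have h0 : Tendsto (fun n : ℕ => ((1 / ((n : ℝ) + 1) : ℝ) : ℂ)) atTop (𝓝 0) := by
    have := (Complex.continuous_ofReal.tendsto 0).comp
      (tendsto_one_div_add_atTop_nhds_zero_nat (𝕜 := ℝ))
    simpa [Function.comp_def] using this
  have h1 := (((h0.mul_const (herglotz a z)).const_add 1).inv₀ (by simp)).mul_const (ev a z)
  simpa [trunc] using h1

/-! ### Multiplication operators on the Hardy space -/

/-- `mulOp φ hφ h1` is multiplication by `φ` on the Hardy space. -/
noncomputable def mulOp (φ : Disc → ℂ) (hφ : IsHolo φ) (h1 : ∀ z, ‖φ z‖ ≤ 1) : HSeq →L[ℂ] HSeq :=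
  LinearMap.mkContinuous
    { toFun := fun a => (exists_ev_mul hφ h1 a).choose
      map_add' := fun a b => ev_injective <| by
        rw [map_add ev (exists_ev_mul hφ h1 a).choose]
        refine (exists_ev_mul hφ h1 (a + b)).choose_spec.1.trans ?_
        rw [(exists_ev_mul hφ h1 a).choose_spec.1, (exists_ev_mul hφ h1 b).choose_spec.1, map_add,
          mul_add]
      map_smul' := fun c a => ev_injective <| by
        rw [RingHom.id_apply, map_smul ev c (exists_ev_mul hφ h1 a).choose]
        refine (exists_ev_mul hφ h1 (c • a)).choose_spec.1.trans ?_
        rw [(exists_ev_mul hφ h1 a).choose_spec.1, map_smul, mul_smul_comm] }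
    1 fun a => (exists_ev_mul hφ h1 a).choose_spec.2

section mulOp
variable {φ : Disc → ℂ} (hφ : IsHolo φ) (h1 : ∀ z, ‖φ z‖ ≤ 1)

lemma ev_mulOp (a : HSeq) : ev (mulOp φ hφ h1 a) = φ * ev a :=
  (exists_ev_mul hφ h1 a).choose_spec.1

lemma norm_mulOp_le (a : HSeq) : ‖mulOp φ hφ h1 a‖ ≤ ‖a‖ :=
  (exists_ev_mul hφ h1 a).choose_spec.2.trans_eq (one_mul _)

/-- The sequence of coefficients of `z ^ n`. -/
noncomputable def monomial (n : ℕ) : HSeq := lp.single 2 n 1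

lemma norm_monomial (n : ℕ) : ‖monomial n‖ = 1 := by
  simp [monomial, lp.norm_single]

lemma ev_monomial (n : ℕ) (z : Disc) : ev (monomial n) z = (z : ℂ) ^ n := by
  refine (hasCoeff_ev (monomial n) z).unique ?_
  convert hasSum_single n fun m hm => ?_ using 1
  · simp [monomial]
  · simp [monomial, hm]

lemma hasSum_monomial (a : HSeq) : HasSum (fun n => a n • monomial n) a := by
  have h := lp.hasSum_single (by norm_num) a
  convert h using 2 with n
  rw [monomial, ← lp.single_smul]
  simp

lemma mulOp_monomial {p : HSeq} (hp : ev p = φ) (n : ℕ) :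
    mulOp φ hφ h1 (monomial n) = (shift.toContinuousLinearMap ^ n) p := by
  refine ev_injective (funext fun z => ?_)
  rw [ev_mulOp, ev_shift_pow, hp, Pi.mul_apply, ev_monomial, mul_comm]

lemma norm_shift_pow (n : ℕ) (p : HSeq) : ‖(shift.toContinuousLinearMap ^ n) p‖ = ‖p‖ := by
  induction n with
  | zero => simp
  | succ n ih => rw [pow_succ', mul_apply_eq_comp]; exact (shift.norm_map _).trans ih

lemma inner_shift_pow (n : ℕ) (p q : HSeq) :
    inner ℂ ((shift.toContinuousLinearMap ^ n) p) ((shift.toContinuousLinearMap ^ n) q) =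
      inner ℂ p q := by
  induction n with
  | zero => simp
  | succ n ih =>
    rw [pow_succ', mul_apply_eq_comp, mul_apply_eq_comp]
    exact (shift.inner_map_map _ _).trans ih

lemma hasSum_mulOp {p : HSeq} (hp : ev p = φ) (a : HSeq) :
    HasSum (fun n => a n • (shift.toContinuousLinearMap ^ n) p) (mulOp φ hφ h1 a) := by
  have h := (mulOp φ hφ h1).hasSum (hasSum_monomial a)
  simpa [Function.comp_def, mulOp_monomial hφ h1 hp] using h

/-- Multiplication by a function bounded by `1` and of norm `1` is isometric. -/
lemma norm_mulOp {p : HSeq} (hp : ev p = φ) (hn : ‖p‖ = 1) (a : HSeq) :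
    ‖mulOp φ hφ h1 a‖ = ‖a‖ := by
  set T := mulOp φ hφ h1 with hT
  have hTn : ∀ n, ‖T (monomial n)‖ = 1 := fun n => by
    rw [hT, mulOp_monomial hφ h1 hp, norm_shift_pow, hn]
  have hle : ∀ x, ‖T.adjoint x‖ ≤ ‖x‖ := fun x => by
    have h := T.adjoint.le_opNorm x
    rw [LinearIsometryEquiv.norm_map] at h
    refine h.trans (mul_le_of_le_one_left (norm_nonneg _) ?_)
    exact T.opNorm_le_bound zero_le_one fun y => by rw [one_mul]; exact norm_mulOp_le hφ h1 y
  -- The adjoint is a contraction and `⟨T* T e, e⟩ = ‖T e‖² = 1 = ‖e‖²`, which forces `T* T e = e`.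
  have key : ∀ n, T.adjoint (T (monomial n)) = monomial n := fun n => by
    rw [← sub_eq_zero, ← norm_eq_zero, ← sq_eq_zero_iff]
    refine le_antisymm ?_ (sq_nonneg _)
    have h2 : RCLike.re (inner ℂ (T.adjoint (T (monomial n))) (monomial n)) = 1 := by
      rw [ContinuousLinearMap.adjoint_inner_left, inner_self_eq_norm_sq, hTn, one_pow]
    rw [norm_sub_sq (𝕜 := ℂ), h2, norm_monomial]
    have h3 := hle (T (monomial n))
    rw [hTn] at h3
    nlinarith [norm_nonneg (T.adjoint (T (monomial n)))]
  have h4 : T.adjoint (T a) = a := by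
    have h5 := (T.adjoint.comp T).hasSum (hasSum_monomial a)
    refine h5.unique ?_
    convert hasSum_monomial a using 2 with n
    simp [key]
  have h6 : RCLike.re (inner ℂ (T.adjoint (T a)) a) = ‖T a‖ ^ 2 := by
    rw [ContinuousLinearMap.adjoint_inner_left, inner_self_eq_norm_sq]
  rw [h4, inner_self_eq_norm_sq] at h6
  exact ((sq_eq_sq₀ (norm_nonneg _) (norm_nonneg _)).1 h6).symm

lemma mulOp_mem {p : HSeq} (hp : ev p = φ) {N : Submodule ℂ HSeq} (hN : IsClosed (N : Set HSeq))
    (hpN : ∀ n, (shift.toContinuousLinearMap ^ n) p ∈ N) (a : HSeq) : mulOp φ hφ h1 a ∈ N :=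
  hN.mem_of_tendsto (hasSum_mulOp hφ h1 hp a)
    (Eventually.of_forall fun _ => N.sum_mem fun n _ => N.smul_mem _ (hpN n))

lemma isClosed_range_mulOp {p : HSeq} (hp : ev p = φ) (hn : ‖p‖ = 1) :
    IsClosed (Set.range (mulOp φ hφ h1)) :=
  (AddMonoidHomClass.isometry_of_norm (mulOp φ hφ h1)
    (norm_mulOp hφ h1 hp hn)).isClosedEmbedding.isClosed_range

end mulOp

/-! ### Beurling's theorem -/

section Beurling
variable {N : Submodule ℂ HSeq}

lemma shift_pow_mem (hN : ∀ a ∈ N, shift a ∈ N) {a : HSeq} (ha : a ∈ N) (n : ℕ) :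
    (shift.toContinuousLinearMap ^ n) a ∈ N := by
  induction n with
  | zero => simpa
  | succ n ih => rw [pow_succ', mul_apply_eq_comp]; exact hN _ ih

/-- Such an element is divisible by every power of `z`. -/
lemma eq_zero_of_forall_exists_shift {P : HSeq → Prop}
    (hP : ∀ a, P a → ∃ b, P b ∧ shift b = a) {a : HSeq} (ha : P a) : a = 0 := by
  have h : ∀ n, ∀ a, P a → a n = 0 := by
    intro n
    induction n with
    | zero =>
      intro a ha
      obtain ⟨b, -, rfl⟩ := hP a ha
      exact shift_apply_zero b
    | succ n ih =>
      intro a ha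
      obtain ⟨b, hb, rfl⟩ := hP a ha
      rw [shift_apply_succ]
      exact ih b hb
  ext n
  exact h n a ha

lemma inner_shift_pow_self {p : HSeq} (hN : ∀ a ∈ N, shift a ∈ N) {x : HSeq} (hx : x ∈ N)
    (hp : ∀ a ∈ N, inner ℂ (shift a) p = 0) {n : ℕ} (hn : n ≠ 0) :
    inner ℂ ((shift.toContinuousLinearMap ^ n) x) p = 0 := by
  obtain ⟨m, rfl⟩ := Nat.exists_eq_succ_of_ne_zero hn
  rw [pow_succ', mul_apply_eq_comp]
  exact hp _ (shift_pow_mem hN hx m)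

/-- `p` is orthogonal to `shift ^ n p` for `n ≥ 1`, so its Herglotz transform is the constant 1,
whose real part dominates `|p|²`. -/
lemma norm_ev_le_one_of_wandering (hN : ∀ a ∈ N, shift a ∈ N) {p : HSeq} (hpN : p ∈ N)
    (hn : ‖p‖ = 1) (hp : ∀ a ∈ N, inner ℂ (shift a) p = 0) (z : Disc) : ‖ev p z‖ ≤ 1 := by
  have h1 : inner ℂ (kmul z p) p = 1 := by
    refine (hasCoeff_inner_kmul p p z).unique ?_
    convert hasSum_single 0 fun m hm => ?_ using 1
    · simp [hn]
    · simp only [inner_shift_pow_self hN hpN hp hm, zero_mul]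
  have h2 := norm_sq_le_herglotz_re p z
  rw [herglotz, h1, hn] at h2
  norm_num at h2
  exact h2

/-- The wandering subspace has dimension at most one. If `p ⊥ q`, then all `shift ^ m p` are
orthogonal to all `shift ^ n q`; the product `p q` lies in the closed span of either family, so it
is orthogonal to itself, although its norm is 1. -/
lemma inner_wandering_ne_zero (hN : ∀ a ∈ N, shift a ∈ N) {p q : HSeq} (hpN : p ∈ N) (hqN : q ∈ N)
    (hn : ‖p‖ = 1) (hm : ‖q‖ = 1) (hp : ∀ a ∈ N, inner ℂ (shift a) p = 0)
    (hq : ∀ a ∈ N, inner ℂ (shift a) q = 0) : inner ℂ p q ≠ 0 := by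
  intro h0
  have hp1 := norm_ev_le_one_of_wandering hN hpN hn hp
  have hq1 := norm_ev_le_one_of_wandering hN hqN hm hq
  have hpq : ∀ m n, inner ℂ ((shift.toContinuousLinearMap ^ m) p)
      ((shift.toContinuousLinearMap ^ n) q) = 0 := by
    intro m n
    rcases lt_trichotomy m n with h | rfl | h
    · obtain ⟨k, rfl⟩ := Nat.exists_eq_add_of_lt h
      rw [show m + k + 1 = m + (k + 1) from rfl, pow_add, mul_apply_eq_comp,
        inner_shift_pow, ← inner_conj_symm, inner_shift_pow_self hN hqN hp k.succ_ne_zero, map_zero]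
    · rw [inner_shift_pow, h0]
    · obtain ⟨k, rfl⟩ := Nat.exists_eq_add_of_lt h
      rw [show n + k + 1 = n + (k + 1) from rfl, pow_add, mul_apply_eq_comp,
        inner_shift_pow, inner_shift_pow_self hN hpN hq k.succ_ne_zero]
  set x := mulOp (ev p) (isHolo_ev p) hp1 q
  have hx : x = mulOp (ev q) (isHolo_ev q) hq1 p := ev_injective <| by
    rw [ev_mulOp, ev_mulOp, mul_comm]
  have h1 : ∀ m, inner ℂ ((shift.toContinuousLinearMap ^ m) p) x = 0 := by
    intro m
    have h2 := (innerSL ℂ ((shift.toContinuousLinearMap ^ m) p)).hasSum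
      (hasSum_mulOp (isHolo_ev q) hq1 rfl p)
    rw [hx]
    refine h2.unique ?_
    convert hasSum_zero using 2 with n
    rw [innerSL_apply_apply, inner_smul_right, hpq, mul_zero]
  have h3 : inner ℂ x x = 0 := by
    have h4 := (innerSL ℂ x).hasSum (hasSum_mulOp (isHolo_ev p) hp1 rfl q)
    refine h4.unique ?_
    convert hasSum_zero using 2 with n
    have := h1 n
    rw [← inner_conj_symm, map_eq_zero] at this
    rw [innerSL_apply_apply, inner_smul_right, this, mul_zero]
  have h5 : ‖x‖ = 1 := (norm_mulOp _ _ rfl hn q).trans hm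
  rw [inner_self_eq_zero] at h3
  rw [h3, norm_zero] at h5
  exact zero_ne_one h5

/-- Orthogonal projection onto the closed subspace `shift N`; the remainder stays in `N` because
`shift N ⊆ N`. -/
lemma exists_shift_add_orthogonal (hN : ∀ a ∈ N, shift a ∈ N) (hc : IsClosed (N : Set HSeq))
    {a : HSeq} (ha : a ∈ N) : ∃ b ∈ N, ∃ y ∈ N, (∀ c ∈ N, inner ℂ (shift c) y = 0) ∧
      a = shift b + y := by
  let K : Submodule ℂ HSeq := N.map shift.toLinearMap
  have hK : IsClosed (K : Set HSeq) := by
    rw [Submodule.map_coe]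
    exact shift.isometry.isClosedEmbedding.isClosedMap _ hc
  have : CompleteSpace K := hK.completeSpace_coe
  obtain ⟨x, hx, y, hy, rfl⟩ := K.exists_add_mem_mem_orthogonal a
  obtain ⟨b, hb, rfl⟩ := hx
  refine ⟨b, hb, y, ?_, fun c hc => hy _ ⟨c, hc, rfl⟩, rfl⟩
  exact (N.add_mem_iff_right (hN b hb)).1 ha

/-- **Beurling's theorem** in terms of sequences of coefficients. -/
theorem exists_wandering (hN : ∀ a ∈ N, shift a ∈ N) (hc : IsClosed (N : Set HSeq)) (h0 : N ≠ ⊥) :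
    ∃ p ∈ N, ‖p‖ = 1 ∧ ∃ h1 : ∀ z, ‖ev p z‖ ≤ 1,
      ∀ a ∈ N, a ∈ Set.range (mulOp (ev p) (isHolo_ev p) h1) := by
  have hnorm : ∀ y ∈ N, y ≠ 0 → (∀ c ∈ N, inner ℂ (shift c) y = 0) →
      ((‖y‖⁻¹ : ℝ) : ℂ) • y ∈ N ∧ ‖((‖y‖⁻¹ : ℝ) : ℂ) • y‖ = 1 ∧
        ∀ c ∈ N, inner ℂ (shift c) (((‖y‖⁻¹ : ℝ) : ℂ) • y) = 0 := by
    intro y hy hy0 h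
    refine ⟨N.smul_mem _ hy, ?_, fun c hc => by rw [inner_smul_right, h c hc, mul_zero]⟩
    rw [norm_smul, Complex.norm_real, norm_inv, norm_norm, inv_mul_cancel₀ (norm_ne_zero_iff.2 hy0)]
  -- Otherwise `N = shift N`, and every element of `N` is divisible by all powers of `z`.
  obtain ⟨y, hyN, hy0, hy⟩ : ∃ y ∈ N, y ≠ 0 ∧ ∀ c ∈ N, inner ℂ (shift c) y = 0 := by
    by_contra! hcon
    refine h0 ((Submodule.eq_bot_iff _).2 fun a ha => ?_)
    refine eq_zero_of_forall_exists_shift (P := (· ∈ N)) (fun a ha => ?_) ha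
    obtain ⟨b, hb, y, hyN, hy, rfl⟩ := exists_shift_add_orthogonal hN hc ha
    by_cases hy0 : y = 0
    · exact ⟨b, hb, by rw [hy0, add_zero]⟩
    · obtain ⟨c, hcN, hcy⟩ := hcon y hyN hy0
      exact absurd (hy c hcN) hcy
  obtain ⟨hpN, hn, hp⟩ := hnorm y hyN hy0 hy
  set p := ((‖y‖⁻¹ : ℝ) : ℂ) • y
  have h1 := norm_ev_le_one_of_wandering hN hpN hn hp
  refine ⟨p, hpN, hn, h1, fun a ha => ?_⟩
  let R : Submodule ℂ HSeq := LinearMap.range (mulOp (ev p) (isHolo_ev p) h1).toLinearMap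
  have hR : IsClosed (R : Set HSeq) := by
    have h := isClosed_range_mulOp (isHolo_ev p) h1 rfl hn
    rwa [LinearMap.coe_range]
  have : CompleteSpace R := hR.completeSpace_coe
  obtain ⟨x, hx, u, hu, rfl⟩ := R.exists_add_mem_mem_orthogonal a
  have hxN : x ∈ N := by
    obtain ⟨b, rfl⟩ := hx
    exact mulOp_mem _ _ rfl hc (shift_pow_mem hN hpN) b
  have huN : u ∈ N := (N.add_mem_iff_right hxN).1 ha
  have hu' : ∀ n, inner ℂ ((shift.toContinuousLinearMap ^ n) p) u = 0 := fun n =>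
    hu _ ⟨monomial n, mulOp_monomial _ _ rfl n⟩
  -- The wandering part of `u` is orthogonal to `p`, hence zero, so `u = shift b` with `b` in `N`
  -- again orthogonal to every `shift ^ n p`.
  have hu0 : u = 0 := by
    refine eq_zero_of_forall_exists_shift (P := fun u => u ∈ N ∧
      ∀ n, inner ℂ ((shift.toContinuousLinearMap ^ n) p) u = 0) (fun u hu => ?_) ⟨huN, hu'⟩
    obtain ⟨b, hb, y, hyN, hy, rfl⟩ := exists_shift_add_orthogonal hN hc hu.1
    have hpy : inner ℂ p y = 0 := by
      have h3 := hu.2 0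
      have h4 := hp b hb
      rw [← inner_conj_symm, map_eq_zero] at h4
      simpa [inner_add_right, h4] using h3
    have hy0 : y = 0 := by
      by_contra hy0
      obtain ⟨hqN, hm, hq⟩ := hnorm y hyN hy0 hy
      refine inner_wandering_ne_zero hN hpN hqN hn hm hp hq ?_
      rw [inner_smul_right, hpy, mul_zero]
    refine ⟨b, ⟨hb, fun n => ?_⟩, by rw [hy0, add_zero]⟩
    have h3 := hu.2 (n + 1)
    rw [hy0, add_zero, pow_succ', mul_apply_eq_comp] at h3
    exact (shift.inner_map_map _ _).symm.trans h3
  rw [hu0, add_zero]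
  obtain ⟨b, hb⟩ := hx
  exact ⟨b, hb⟩

end Beurling

/-! ### Fatou's theorem on radial limits -/

/-- The derivative of the Poisson kernel, up to a factor. -/
noncomputable def derivKernel (r : ℝ) (ζ : ℂ) : ℂ :=
  ((ζ - r) ^ 2)⁻¹ - ((ζ - (r : ℂ)⁻¹) ^ 2)⁻¹

lemma sub_ne_zero_of_mem_sphere {r : ℝ} (h0 : 0 < r) (h1 : r < 1) {ζ : ℂ}
    (hζ : ζ ∈ Metric.sphere (0 : ℂ) 1) : ζ - r ≠ 0 := by
  intro h
  rw [sub_eq_zero] at h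
  rw [h, mem_sphere_zero_iff_norm, Complex.norm_of_nonneg h0.le] at hζ
  exact h1.ne hζ

/-- `r⁻¹` is the reflection of `r` in the unit circle. -/
lemma norm_sub_inv {r : ℝ} (h0 : 0 < r) {ζ : ℂ}
    (hζ : ζ ∈ Metric.sphere (0 : ℂ) 1) : ‖ζ - (r : ℂ)⁻¹‖ = ‖ζ - r‖ / r := by
  rw [mem_sphere_zero_iff_norm] at hζ
  have hr : (r : ℂ) ≠ 0 := by exact_mod_cast h0.ne'
  have h2 : ζ * (starRingEnd ℂ) ζ = 1 := by rw [Complex.mul_conj']; simp [hζ]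
  have h3 : ζ - (r : ℂ)⁻¹ = -(ζ * (starRingEnd ℂ) (ζ - r)) / r := by
    rw [map_sub, Complex.conj_ofReal, mul_sub, h2]
    field_simp
    ring
  rw [h3, norm_div, norm_neg, norm_mul, hζ, one_mul, Complex.norm_conj,
    Complex.norm_of_nonneg h0.le]

lemma sub_inv_ne_zero_of_mem_sphere {r : ℝ} (h0 : 0 < r) (h1 : r < 1) {ζ : ℂ}
    (hζ : ζ ∈ Metric.sphere (0 : ℂ) 1) : ζ - (r : ℂ)⁻¹ ≠ 0 := by
  rw [← norm_ne_zero_iff, norm_sub_inv h0 hζ]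
  exact div_ne_zero (norm_ne_zero_iff.2 (sub_ne_zero_of_mem_sphere h0 h1 hζ)) h0.ne'

lemma continuousOn_derivKernel {r : ℝ} (h0 : 0 < r) (h1 : r < 1) :
    ContinuousOn (derivKernel r) (Metric.sphere 0 1) := by
  unfold derivKernel
  refine ContinuousOn.sub (ContinuousOn.inv₀ (by fun_prop) fun ζ hζ => ?_)
    (ContinuousOn.inv₀ (by fun_prop) fun ζ hζ => ?_)
  · exact pow_ne_zero _ (sub_ne_zero_of_mem_sphere h0 h1 hζ)
  · exact pow_ne_zero _ (sub_inv_ne_zero_of_mem_sphere h0 h1 hζ)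

/-- The two poles are at comparable distances from `ζ`, and the difference of the squares gains a
factor `1 - r²`. Against an error linear in `‖ζ - r‖` this leaves a Poisson kernel. -/
lemma norm_derivKernel_le {r : ℝ} (h0 : 0 < r) (h1 : r < 1) {ζ : ℂ}
    (hζ : ζ ∈ Metric.sphere (0 : ℂ) 1) :
    ‖derivKernel r ζ‖ ≤ 2 * (1 - r ^ 2) / ‖ζ - r‖ ^ 3 := by
  have hu := sub_ne_zero_of_mem_sphere h0 h1 hζ
  have hv := sub_inv_ne_zero_of_mem_sphere h0 h1 hζ
  have hn := norm_sub_inv h0 hζ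
  have hr : (r : ℂ) ≠ 0 := by exact_mod_cast h0.ne'
  have hu' : 0 < ‖ζ - r‖ := norm_pos_iff.2 hu
  have e : derivKernel r ζ = ((r - (r : ℂ)⁻¹) * ((ζ - r) + (ζ - (r : ℂ)⁻¹))) /
      ((ζ - r) ^ 2 * (ζ - (r : ℂ)⁻¹) ^ 2) := by
    rw [derivKernel, inv_sub_inv (pow_ne_zero 2 hu) (pow_ne_zero 2 hv)]
    congr 1
    ring
  have h2 : ‖(r : ℂ) - (r : ℂ)⁻¹‖ = (1 - r ^ 2) / r := by
    rw [← Complex.ofReal_inv, ← Complex.ofReal_sub, Complex.norm_real, Real.norm_eq_abs,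
      abs_sub_comm, abs_of_nonneg]
    · field_simp
    · rw [sub_nonneg]; exact h1.le.trans (one_le_inv_iff₀.2 ⟨h0, h1.le⟩)
  have h3 : ‖(ζ - r) + (ζ - (r : ℂ)⁻¹)‖ ≤ ‖ζ - r‖ * (2 / r) := by
    refine (norm_add_le _ _).trans ?_
    rw [hn, mul_div_assoc', ← sub_nonneg, show ‖ζ - r‖ * 2 / r - (‖ζ - r‖ + ‖ζ - r‖ / r) =
      ‖ζ - r‖ * (1 - r) / r by field_simp; ring]
    exact div_nonneg (mul_nonneg hu'.le (by linarith)) h0.le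
  have h4 : 0 ≤ 1 - r ^ 2 := by nlinarith
  rw [e, norm_div, norm_mul, norm_mul, norm_pow, norm_pow, hn, h2]
  calc _ ≤ (1 - r ^ 2) / r * (‖ζ - r‖ * (2 / r)) / (‖ζ - r‖ ^ 2 * (‖ζ - r‖ / r) ^ 2) := by
        gcongr
    _ = _ := by field_simp

/-- Cauchy's formula for the derivative. The pole `r⁻¹` lies outside the closed disc and contributes
nothing; its term is there only to make the kernel small. -/
lemma circleIntegral_derivKernel {r : ℝ} (h0 : 0 < r) (h1 : r < 1) {g : ℂ → ℂ}
    (hg : Differentiable ℂ g) :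
    ∮ ζ in C(0, 1), derivKernel r ζ * g ζ = 2 * Real.pi * Complex.I * deriv g r := by
  have hb : (r : ℂ) ∈ Metric.ball (0 : ℂ) 1 := by
    rw [mem_ball_zero_iff, Complex.norm_of_nonneg h0.le]; exact h1
  have c1 : ContinuousOn (fun ζ : ℂ => ((ζ - r) ^ 2)⁻¹ * g ζ) (Metric.sphere 0 1) :=
    (ContinuousOn.inv₀ (by fun_prop) fun ζ hζ =>
      pow_ne_zero 2 (sub_ne_zero_of_mem_sphere h0 h1 hζ)).mul hg.continuous.continuousOn
  have c2 : ContinuousOn (fun ζ : ℂ => ((ζ - (r : ℂ)⁻¹) ^ 2)⁻¹ * g ζ) (Metric.sphere 0 1) :=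
    (ContinuousOn.inv₀ (by fun_prop) fun ζ hζ =>
      pow_ne_zero 2 (sub_inv_ne_zero_of_mem_sphere h0 h1 hζ)).mul hg.continuous.continuousOn
  have e1 := Complex.two_pi_I_inv_smul_circleIntegral_sub_sq_inv_smul_of_differentiable
    isOpen_univ (Set.subset_univ (Metric.closedBall (0 : ℂ) 1)) hg.differentiableOn hb
  have hne : ∀ ζ ∈ Metric.closedBall (0 : ℂ) 1, (ζ - (r : ℂ)⁻¹) ^ 2 ≠ 0 := by
    intro ζ hζ h
    rw [sq_eq_zero_iff, sub_eq_zero] at h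
    rw [h, mem_closedBall_zero_iff, norm_inv, Complex.norm_of_nonneg h0.le] at hζ
    exact absurd hζ (not_le.2 ((one_lt_inv₀ h0).2 h1))
  have e2 : ∮ ζ in C(0, 1), ((ζ - (r : ℂ)⁻¹) ^ 2)⁻¹ * g ζ = 0 := by
    refine Complex.circleIntegral_eq_zero_of_differentiable_on_off_countable zero_le_one
      Set.countable_empty ?_ fun ζ hζ => ?_
    · exact (ContinuousOn.inv₀ (by fun_prop) hne).mul hg.continuous.continuousOn
    · refine DifferentiableAt.mul (DifferentiableAt.inv (by fun_prop) ?_) hg.differentiableAt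
      exact hne ζ (Metric.ball_subset_closedBall hζ.1)
  have e3 : ∮ ζ in C(0, 1), derivKernel r ζ * g ζ =
      (∮ ζ in C(0, 1), ((ζ - r) ^ 2)⁻¹ * g ζ) - ∮ ζ in C(0, 1), ((ζ - (r : ℂ)⁻¹) ^ 2)⁻¹ * g ζ := by
    rw [← circleIntegral.integral_sub (c1.circleIntegrable zero_le_one)
      (c2.circleIntegrable zero_le_one)]
    simp only [derivKernel, sub_mul]
  have hpi : (2 * Real.pi * Complex.I : ℂ) ≠ 0 := Complex.two_pi_I_ne_zero
  rw [e3, e2, sub_zero, ← e1, smul_eq_mul, mul_inv_cancel_left₀ hpi]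
  simp only [smul_eq_mul]

lemma integral_poisson {r : ℝ} (h0 : 0 < r) (h1 : r < 1) :
    ∫ θ in (0 : ℝ)..2 * Real.pi, (1 - r ^ 2) / ‖circleMap 0 1 θ - r‖ ^ 2 = 2 * Real.pi := by
  have hb : (r : ℂ) ∈ Metric.ball (0 : ℂ) 1 := by
    rw [mem_ball_zero_iff, Complex.norm_of_nonneg h0.le]; exact h1
  have h := DiffContOnCl.circleAverage_poissonKernel_smul' (f := fun _ : ℂ => (1 : ℂ))
    (c := 0) (R := 1) diffContOnCl_const hb
  have e : ∀ θ : ℝ, ((‖circleMap 0 1 θ - 0‖ ^ 2 - ‖(r : ℂ) - 0‖ ^ 2) /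
      ‖(circleMap 0 1 θ - 0) - ((r : ℂ) - 0)‖ ^ 2) • (1 : ℂ) =
        (((1 - r ^ 2) / ‖circleMap 0 1 θ - r‖ ^ 2 : ℝ) : ℂ) := fun θ => by
    rw [Complex.real_smul, mul_one, sub_zero, sub_zero, Complex.norm_of_nonneg h0.le]
    simp
  rw [Real.circleAverage] at h
  simp only [e] at h
  rw [intervalIntegral.integral_ofReal, Complex.real_smul, ← Complex.ofReal_mul,
    Complex.ofReal_eq_one] at h
  rw [inv_mul_eq_one₀ (by positivity)] at h
  exact h.symm

/-- On the circle `‖ζ - 1‖ ≤ 2 ‖ζ - r‖`. The linear term is integrated against a Poisson kernel of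
total mass `2π`; the cubic term cancels the singularity and keeps the factor `1 - r²`. The constants
are `4 = 2 * 2` and `16 = 2 * 2 ^ 3`. -/
lemma norm_circleIntegral_derivKernel_le {r : ℝ} (h0 : 0 < r) (h1 : r < 1) {E : ℂ → ℂ} {ε C : ℝ}
    (hε : 0 ≤ ε) (hC : 0 ≤ C)
    (hE : ∀ ζ ∈ Metric.sphere (0 : ℂ) 1, ‖E ζ‖ ≤ ε * ‖ζ - 1‖ + C * ‖ζ - 1‖ ^ 3) :
    ‖∮ ζ in C(0, 1), derivKernel r ζ * E ζ‖ ≤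
      2 * Real.pi * (4 * ε + 16 * C * (1 - r ^ 2)) := by
  have hr2 : 0 ≤ 1 - r ^ 2 := by nlinarith
  have hc : Continuous fun θ : ℝ => (1 - r ^ 2) / ‖circleMap 0 1 θ - r‖ ^ 2 := by
    refine Continuous.div continuous_const (by fun_prop) fun θ => pow_ne_zero 2 ?_
    exact norm_ne_zero_iff.2
      (sub_ne_zero_of_mem_sphere h0 h1 (circleMap_mem_sphere 0 zero_le_one θ))
  have hpt : ∀ ζ ∈ Metric.sphere (0 : ℂ) 1, ‖derivKernel r ζ * E ζ‖ ≤
      4 * ε * ((1 - r ^ 2) / ‖ζ - r‖ ^ 2) + 16 * C * (1 - r ^ 2) := by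
    intro ζ hζ
    have hu : 0 < ‖ζ - r‖ := norm_pos_iff.2 (sub_ne_zero_of_mem_sphere h0 h1 hζ)
    have h2 : ‖ζ - 1‖ ≤ 2 * ‖ζ - r‖ := by
      have h3 : ‖(r : ℂ) - 1‖ = 1 - r := by
        rw [← Complex.ofReal_one, ← Complex.ofReal_sub, Complex.norm_real, Real.norm_eq_abs,
          abs_sub_comm, abs_of_nonneg (by linarith)]
      have h4 : 1 - r ≤ ‖ζ - r‖ := by
        have h5 := norm_sub_norm_le ζ (r : ℂ)
        rwa [mem_sphere_zero_iff_norm.1 hζ, Complex.norm_of_nonneg h0.le] at h5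
      have h6 := norm_sub_le_norm_sub_add_norm_sub ζ (r : ℂ) 1
      linarith
    rw [norm_mul]
    calc _ ≤ 2 * (1 - r ^ 2) / ‖ζ - r‖ ^ 3 * (ε * (2 * ‖ζ - r‖) + C * (2 * ‖ζ - r‖) ^ 3) := by
          refine mul_le_mul (norm_derivKernel_le h0 h1 hζ) ((hE ζ hζ).trans ?_) (norm_nonneg _)
            (by positivity)
          gcongr
      _ = _ := by field_simp; ring
  have hi1 : IntervalIntegrable (fun θ : ℝ => 4 * ε * ((1 - r ^ 2) / ‖circleMap 0 1 θ - r‖ ^ 2))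
    volume 0 (2 * Real.pi) := (hc.const_mul _).intervalIntegrable _ _
  have hi2 : IntervalIntegrable (fun _ : ℝ => 16 * C * (1 - r ^ 2)) volume 0 (2 * Real.pi) :=
    intervalIntegrable_const
  refine (intervalIntegral.norm_integral_le_of_norm_le (by positivity)
    (Eventually.of_forall fun θ _ => ?_) (hi1.add hi2)).trans (le_of_eq ?_)
  · rw [norm_smul]
    have h3 : ‖deriv (circleMap 0 1) θ‖ = 1 := by simp
    rw [h3, one_mul]
    exact hpt _ (circleMap_mem_sphere 0 zero_le_one θ)
  · rw [intervalIntegral.integral_add hi1 hi2, intervalIntegral.integral_const_mul,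
      integral_poisson h0 h1, intervalIntegral.integral_const, smul_eq_mul]
    ring

lemma summable_mul_pow_of_norm_le {b : ℕ → ℂ} (hb : Summable fun n => ‖b n‖) {ζ : ℂ}
    (hζ : ‖ζ‖ ≤ 1) : Summable fun n => b n * ζ ^ n :=
  Summable.of_norm_bounded hb fun n => by
    rw [norm_mul, norm_pow]
    exact mul_le_of_le_one_right (norm_nonneg _) (pow_le_one₀ (norm_nonneg _) hζ)

lemma continuousOn_tsum_mul_pow {b : ℕ → ℂ} (hb : Summable fun n => ‖b n‖) :
    ContinuousOn (fun ζ : ℂ => ∑' n, b n * ζ ^ n) (Metric.sphere 0 1) := by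
  refine continuousOn_tsum (fun n => by fun_prop) hb fun n ζ hζ => ?_
  rw [norm_mul, norm_pow, mem_sphere_zero_iff_norm.1 hζ, one_pow, mul_one]

lemma hasSum_circleIntegral_derivKernel {b : ℕ → ℂ} (hb : Summable fun n => ‖b n‖) {r : ℝ}
    (h0 : 0 < r) (h1 : r < 1) :
    HasSum (fun n => 2 * Real.pi * Complex.I * (b n * (n * (r : ℂ) ^ (n - 1))))
      (∮ ζ in C(0, 1), derivKernel r ζ * ∑' n, b n * ζ ^ n) := by
  have hK := continuousOn_derivKernel h0 h1
  obtain ⟨A, hA⟩ := (isCompact_sphere (0 : ℂ) 1).exists_bound_of_continuousOn hK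
  have hterm : ∀ n, ∮ ζ in C(0, 1), derivKernel r ζ * (b n * ζ ^ n) =
      2 * Real.pi * Complex.I * (b n * (n * (r : ℂ) ^ (n - 1))) := fun n => by
    rw [circleIntegral_derivKernel h0 h1 (g := fun ζ => b n * ζ ^ n) (by fun_prop)]
    simp
  simp only [← hterm]
  have hs : ∀ θ : ℝ, circleMap 0 1 θ ∈ Metric.sphere (0 : ℂ) 1 :=
    circleMap_mem_sphere 0 zero_le_one
  refine intervalIntegral.hasSum_integral_of_dominated_convergence (fun n _ => A * ‖b n‖)
    (fun n => ?_) (fun n => Eventually.of_forall fun θ _ => ?_)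
    (Eventually.of_forall fun θ _ => hb.mul_left A) intervalIntegrable_const
    (Eventually.of_forall fun θ _ => ?_)
  · refine Continuous.aestronglyMeasurable ?_
    have h2 : Continuous fun θ => derivKernel r (circleMap 0 1 θ) :=
      hK.comp_continuous (continuous_circleMap 0 1) hs
    simp only [deriv_circleMap]
    fun_prop
  · have h3 : ‖deriv (circleMap 0 1) θ‖ = 1 := by simp
    have h4 : ‖circleMap 0 1 θ‖ = 1 := by simp
    rw [norm_smul, h3, one_mul, norm_mul, norm_mul, norm_pow, h4, one_pow, mul_one]
    gcongr
    exact hA _ (hs θ)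
  · exact ((summable_mul_pow_of_norm_le hb (by simp)).hasSum.mul_left _).const_smul _

/-- The derivative of a power series with summable coefficients tends radially to the derivative
along the circle of its boundary function. -/
lemma tendsto_of_hasDerivWithinAt {b : ℕ → ℂ} (hb : Summable fun n => ‖b n‖) {c : ℂ}
    (h : HasDerivWithinAt (fun ζ : ℂ => ∑' n, b n * ζ ^ n) c (Metric.sphere 0 1) 1) :
    Tendsto (fun r : ℝ => ∑' n, b n * (n * (r : ℂ) ^ (n - 1))) (𝓝[<] 1) (𝓝 c) := by
  set g : ℂ → ℂ := fun ζ => ∑' n, b n * ζ ^ n with hg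
  have hgc : ContinuousOn g (Metric.sphere 0 1) := continuousOn_tsum_mul_pow hb
  obtain ⟨A, hA⟩ := (isCompact_sphere (0 : ℂ) 1).exists_bound_of_continuousOn
    (f := fun ζ => g ζ - g 1 - (ζ - 1) * c) (by fun_prop)
  have hA0 : 0 ≤ A := (norm_nonneg _).trans (hA 1 (by simp))
  -- Subtracting an affine function with derivative `c` leaves an error that is `o(ζ - 1)` at 1.
  have hkey : ∀ r : ℝ, 0 < r → r < 1 → 2 * Real.pi * Complex.I *
      (∑' n, b n * (n * (r : ℂ) ^ (n - 1)) - c) =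
        ∮ ζ in C(0, 1), derivKernel r ζ * (g ζ - g 1 - (ζ - 1) * c) := by
    intro r h0 h1
    have hK := continuousOn_derivKernel h0 h1
    have e1 := circleIntegral_derivKernel h0 h1 (g := fun ζ => g 1 + (ζ - 1) * c) (by fun_prop)
    have e2 : deriv (fun ζ : ℂ => g 1 + (ζ - 1) * c) r = c := by simp
    have e3 := (hasSum_circleIntegral_derivKernel hb h0 h1).tsum_eq
    rw [tsum_mul_left] at e3
    rw [e2] at e1
    rw [mul_sub, e3, ← e1, ← circleIntegral.integral_sub]
    · congr 1
      funext ζ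
      rw [← mul_sub, sub_sub]
    · exact (hK.mul hgc).circleIntegrable zero_le_one
    · exact (hK.mul (by fun_prop)).circleIntegrable zero_le_one
  rw [Metric.tendsto_nhds]
  intro ε hε
  rw [hasDerivWithinAt_iff_isLittleO, Asymptotics.isLittleO_iff] at h
  have h2 := h (c := ε / 8) (by positivity)
  rw [eventually_nhdsWithin_iff, Metric.eventually_nhds_iff] at h2
  obtain ⟨δ, hδ, h2⟩ := h2
  -- At distance at least `δ` from 1 the error is only known to be at most `A`; with this `C` the
  -- cubic term dominates it there, and its contribution vanishes as `r → 1`.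
  set C := A / δ ^ 3
  have hE : ∀ ζ ∈ Metric.sphere (0 : ℂ) 1, ‖g ζ - g 1 - (ζ - 1) * c‖ ≤
      ε / 8 * ‖ζ - 1‖ + C * ‖ζ - 1‖ ^ 3 := by
    intro ζ hζ
    have hC : 0 ≤ C := by positivity
    rcases lt_or_ge (dist ζ 1) δ with hd | hd
    · exact (h2 hd hζ).trans (le_add_of_nonneg_right (by positivity))
    · refine (hA ζ hζ).trans ((?_ : A ≤ C * ‖ζ - 1‖ ^ 3).trans
        (le_add_of_nonneg_left (by positivity)))
      rw [dist_eq_norm] at hd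
      calc A = C * δ ^ 3 := by simp only [C]; field_simp
        _ ≤ _ := by gcongr
  have hlim : Tendsto (fun r : ℝ => 4 * (ε / 8) + 16 * C * (1 - r ^ 2)) (𝓝[<] 1)
      (𝓝 (4 * (ε / 8) + 16 * C * (1 - 1 ^ 2))) := by
    refine Tendsto.mono_left ?_ nhdsWithin_le_nhds
    exact (Continuous.tendsto (by fun_prop) 1)
  have hlt : 4 * (ε / 8) + 16 * C * (1 - (1 : ℝ) ^ 2) < ε := by linarith
  filter_upwards [hlim.eventually_lt_const hlt, Ioo_mem_nhdsLT (zero_lt_one (α := ℝ))]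
    with r hr hr1
  have h3 := norm_circleIntegral_derivKernel_le hr1.1 hr1.2 (by positivity) (by positivity) hE
  rw [← hkey r hr1.1 hr1.2, norm_mul] at h3
  have h4 : ‖(2 * Real.pi * Complex.I : ℂ)‖ = 2 * Real.pi := by
    simp [abs_of_pos Real.pi_pos]
  rw [h4] at h3
  rw [dist_eq_norm]
  exact (le_of_mul_le_mul_left h3 (by positivity)).trans_lt hr

/-- Near 1 the circle is parametrised by `arg`, and `I * arg ζ = log ζ` agrees with `ζ - 1` to first
order. -/
lemma hasDerivWithinAt_of_hasDerivAt_exp {g : ℂ → ℂ} {d : ℂ}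
    (h : HasDerivAt (fun t : ℝ => g (Complex.exp (t * Complex.I))) d 0) :
    HasDerivWithinAt g (d / Complex.I) (Metric.sphere 0 1) 1 := by
  rw [hasDerivAt_iff_isLittleO] at h
  have harg : Tendsto Complex.arg (𝓝[Metric.sphere 0 1] 1) (𝓝 0) := by
    have := (Complex.continuousAt_arg Complex.one_mem_slitPlane).tendsto
    rw [Complex.arg_one] at this
    exact this.mono_left nhdsWithin_le_nhds
  have h2 := h.comp_tendsto harg
  have hlog : HasDerivAt Complex.log 1 1 := by
    simpa using Complex.hasDerivAt_log Complex.one_mem_slitPlane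
  have h3 : Complex.arg =O[𝓝[Metric.sphere 0 1] 1] fun ζ : ℂ => ζ - 1 := by
    have h4 := hlog.isBigO_sub.mono (nhdsWithin_le_nhds (s := Metric.sphere 0 1))
    refine Asymptotics.IsBigO.trans (Asymptotics.isBigO_of_le _ fun ζ => ?_) h4
    rw [Complex.log_one, sub_zero, ← Complex.log_im, Real.norm_eq_abs]
    exact Complex.abs_im_le_norm _
  have h5 : (fun ζ : ℂ => Complex.log ζ - (ζ - 1)) =o[𝓝[Metric.sphere 0 1] 1]
      fun ζ : ℂ => ζ - 1 := by
    have h6 := hasDerivAt_iff_isLittleO.1 hlog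
    simp only [Complex.log_one, sub_zero, smul_eq_mul, mul_one] at h6
    exact h6.mono nhdsWithin_le_nhds
  rw [hasDerivWithinAt_iff_isLittleO]
  have h2' : (fun ζ : ℂ => g (Complex.exp (ζ.arg * Complex.I)) - g 1 - ζ.arg * d)
      =o[𝓝[Metric.sphere 0 1] 1] fun ζ : ℂ => ζ - 1 := by
    refine Asymptotics.IsLittleO.trans_isBigO ?_ h3
    refine (h2.congr (fun ζ => ?_) fun ζ => ?_)
    · simp
    · simp
  refine (h2'.add (h5.const_mul_left (d / Complex.I))).congr' ?_ EventuallyEq.rfl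
  filter_upwards [self_mem_nhdsWithin] with ζ hζ
  rw [mem_sphere_zero_iff_norm] at hζ
  have h7 : Complex.exp (ζ.arg * Complex.I) = ζ := by
    have := Complex.norm_mul_exp_arg_mul_I ζ
    rwa [hζ, Complex.ofReal_one, one_mul] at this
  have h8 : Complex.log ζ = ζ.arg * Complex.I := by
    rw [Complex.log, hζ, Real.log_one, Complex.ofReal_zero, zero_add]
  rw [h7, h8, smul_eq_mul]
  field_simp [Complex.I_ne_zero]
  ring

lemma tendsto_radius : Tendsto (fun n => (radius n : ℝ)) atTop (𝓝[<] 1) := by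
  refine tendsto_nhdsWithin_iff.2 ⟨?_, Eventually.of_forall radius_lt_one⟩
  have := (tendsto_const_nhds (x := (1 : ℝ))).sub (tendsto_one_div_add_atTop_nhds_zero_nat (𝕜 := ℝ))
  simpa [radius] using this

/-- These are the coefficients of the primitive of `(f - f(0)) / z`. The convention `a 0 / 0 = 0`
removes the constant term. -/
lemma HSeq.summable_div (a : HSeq) : Summable fun n : ℕ => ‖a n / n‖ := by
  have h2 : Summable fun n : ℕ => 1 / (n : ℝ) ^ 2 := Real.summable_one_div_nat_pow.2 one_lt_two
  refine Summable.of_nonneg_of_le (fun n => norm_nonneg _) (fun n => ?_)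
    (a.hasSum_norm_sq.summable.add h2)
  rw [norm_div, Complex.norm_natCast, div_eq_mul_one_div, ← one_div_pow]
  nlinarith [sq_nonneg (‖a n‖ - 1 / n), sq_nonneg ‖a n‖, sq_nonneg (1 / (n : ℝ))]

lemma HSeq.norm_apply_le (a : HSeq) (n : ℕ) : ‖a n‖ ≤ ‖a‖ :=
  lp.norm_apply_le_norm (by norm_num) a n

lemma div_mul_self_natCast (a : HSeq) (n : ℕ) : a n / n * n = a n - if n = 0 then a 0 else 0 := by
  rcases eq_or_ne n 0 with rfl | hn
  · simp
  · rw [div_mul_cancel₀ _ (Nat.cast_ne_zero.2 hn), if_neg hn, sub_zero]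

lemma hasSum_sub_apply_zero (a : HSeq) (z : Disc) :
    HasSum (fun n : ℕ => a n / n * n * (z : ℂ) ^ n) (ev a z - ev a zeroPt) := by
  have h2 := (hasCoeff_ev a z).sub (hasSum_ite_eq 0 (a 0))
  rw [(hasCoeff_ev a).apply_zero]
  have e : (fun n : ℕ => a n / n * n * (z : ℂ) ^ n) =
      fun n => a n * (z : ℂ) ^ n - if n = 0 then a 0 else 0 := by
    funext n
    rw [div_mul_self_natCast, sub_mul]
    split_ifs with hn <;> simp [hn]
  rwa [e]

/-- The boundary values of the primitive of a bounded function are Lipschitz. -/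
lemma lipschitzWith_primitive {a : HSeq} {C : NNReal} (hC : ∀ z, ‖ev a z‖ ≤ C) :
    LipschitzWith (2 * C) fun θ : ℝ => ∑' n : ℕ, a n / n * Complex.exp (θ * Complex.I) ^ n := by
  -- On a circle of radius `r < 1` the derivative in the angle is `I (f - f(0))`, of size at most `2
  -- C`; this Lipschitz bound survives the limit `r → 1`.
  have hder : ∀ (r : ℝ) (h0 : 0 ≤ r) (h1 : r < 1) (θ : ℝ),
      HasDerivAt (fun θ : ℝ => ∑' n : ℕ, a n / n * (r * Complex.exp (θ * Complex.I)) ^ n)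
        (Complex.I * (ev a (polarPt h0 h1 θ) - ev a zeroPt)) θ := by
    intro r h0 h1 θ
    have hz : ∀ θ : ℝ, ‖(r : ℂ) * Complex.exp (θ * Complex.I)‖ = r := fun θ => by
      rw [norm_mul, Complex.norm_exp_ofReal_mul_I, mul_one, Complex.norm_of_nonneg h0]
    have h2 := hasDerivAt_tsum (𝕜 := ℝ) (u := fun n => ‖a‖ * r ^ n)
      (g := fun (n : ℕ) (θ : ℝ) => a n / n * (r * Complex.exp (θ * Complex.I)) ^ n)
      (g' := fun (n : ℕ) (θ : ℝ) =>
        Complex.I * (a n / n * n * (r * Complex.exp (θ * Complex.I)) ^ n)) (y₀ := 0)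
      ((summable_geometric_of_lt_one h0 h1).mul_left _) (fun n θ => ?_) (fun n θ => ?_) ?_ θ
    · refine h2.congr_deriv ?_
      rw [tsum_mul_left]
      exact congrArg _ (hasSum_sub_apply_zero a (polarPt h0 h1 θ)).tsum_eq
    · have h3 : HasDerivAt (fun θ : ℝ => (r : ℂ) * Complex.exp (θ * Complex.I))
          (r * (Complex.exp (θ * Complex.I) * (1 * Complex.I))) θ :=
        (((Complex.ofRealCLM.hasDerivAt (x := θ)).mul_const Complex.I).cexp).const_mul (r : ℂ)
      refine ((h3.fun_pow n).const_mul (a n / n)).congr_deriv ?_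
      rcases n with _ | n
      · simp
      · rw [Nat.add_sub_cancel, pow_succ]; ring
    · rw [norm_mul, Complex.norm_I, one_mul, norm_mul, norm_pow, hz]
      gcongr
      rw [div_mul_self_natCast]
      split_ifs with hn
      · simp [hn]
      · rw [sub_zero]; exact a.norm_apply_le n
    · exact summable_mul_pow_of_norm_le a.summable_div ((hz 0).trans_le h1.le)
  have hlip : ∀ n, LipschitzWith (2 * C) fun θ : ℝ =>
      ∑' k : ℕ, a k / k * ((radius n : ℝ) * Complex.exp (θ * Complex.I)) ^ k := fun n => by
    have hd := hder (radius n) (radius n).2.1 (radius_lt_one n)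
    refine lipschitzWith_of_nnnorm_deriv_le (fun θ => (hd θ).differentiableAt) fun θ => ?_
    rw [(hd θ).deriv, ← NNReal.coe_le_coe, coe_nnnorm, norm_mul, Complex.norm_I, one_mul]
    refine (norm_sub_le _ _).trans ((add_le_add (hC _) (hC _)).trans_eq ?_)
    push_cast
    ring
  have hlim : ∀ θ : ℝ, Tendsto (fun n => ∑' k : ℕ, a k / k *
      ((radius n : ℝ) * Complex.exp (θ * Complex.I)) ^ k) atTop
        (𝓝 (∑' k : ℕ, a k / k * Complex.exp (θ * Complex.I) ^ k)) := by
    intro θ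
    refine tendsto_tsum_of_dominated_convergence a.summable_div (fun k => ?_)
      (Eventually.of_forall fun n k => ?_)
    · have h3 : Tendsto (fun n => ((radius n : ℝ) : ℂ)) atTop (𝓝 ((1 : ℝ) : ℂ)) :=
        (Complex.continuous_ofReal.tendsto 1).comp (tendsto_nhdsWithin_iff.1 tendsto_radius).1
      have h4 := ((h3.mul_const (Complex.exp (θ * Complex.I))).pow k).const_mul (a k / k)
      simpa using h4
    · rw [norm_mul, norm_pow, norm_mul, Complex.norm_exp_ofReal_mul_I, mul_one,
        Complex.norm_of_nonneg (radius n).2.1]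
      exact mul_le_of_le_one_right (norm_nonneg _)
        (pow_le_one₀ (radius n).2.1 (radius_lt_one n).le)
  refine LipschitzWith.of_dist_le_mul fun s t => ?_
  exact le_of_tendsto' ((hlim s).dist (hlim t)) fun n => (hlip n).dist_le_mul s t

/-- **Fatou's theorem**: bounded holomorphic functions have radial limits almost everywhere. -/
theorem ae_exists_tendsto_radial {a : HSeq} {C : NNReal} (hC : ∀ z, ‖ev a z‖ ≤ C) :
    ∀ᵐ θ : ℝ, ∃ ζ : ℂ, Tendsto
      (fun r : ℝ => zeroExt (ev a) ((r : ℂ) * Complex.exp ((θ : ℂ) * Complex.I))) (𝓝[<] 1)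
        (𝓝 ζ) := by
  -- Lipschitz functions are differentiable almost everywhere, and at such an angle the radial
  -- derivative of the primitive converges.
  filter_upwards [(lipschitzWith_primitive hC).ae_differentiableAt] with θ hθ
  set e := Complex.exp (θ * Complex.I)
  have he : ‖e‖ = 1 := Complex.norm_exp_ofReal_mul_I θ
  have hb : Summable fun n : ℕ => ‖a n / n * e ^ n‖ := by
    simpa only [norm_mul, norm_pow, he, one_pow, mul_one] using a.summable_div
  -- Twisting the coefficients by `e ^ n` rotates the boundary point `e` to 1.
  have h2 : HasDerivAt (fun t : ℝ => ∑' n : ℕ, a n / n * e ^ n * Complex.exp (t * Complex.I) ^ n)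
      (deriv (fun θ : ℝ => ∑' n : ℕ, a n / n * Complex.exp (θ * Complex.I) ^ n) θ) 0 := by
    have h3 := hθ.hasDerivAt
    rw [← add_zero θ] at h3
    refine ((HasDerivAt.comp_const_add θ 0 h3).congr_deriv (by rw [add_zero])).congr_of_eventuallyEq
      (Eventually.of_forall fun t => tsum_congr fun n => ?_)
    rw [mul_assoc, ← mul_pow, ← Complex.exp_add]
    push_cast
    ring_nf
  have h4 := tendsto_of_hasDerivWithinAt hb (hasDerivWithinAt_of_hasDerivAt_exp
    (g := fun ζ => ∑' n : ℕ, a n / n * e ^ n * ζ ^ n) h2)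
  have h5 : Tendsto (fun r : ℝ => (r : ℂ)) (𝓝[<] 1) (𝓝 ((1 : ℝ) : ℂ)) :=
    (Complex.continuous_ofReal.tendsto 1).mono_left nhdsWithin_le_nhds
  refine ⟨_, ((h5.mul h4).const_add (ev a zeroPt)).congr' ?_⟩
  filter_upwards [Ioo_mem_nhdsLT (zero_lt_one (α := ℝ))] with r hr
  have h6 := hasSum_sub_apply_zero a (polarPt hr.1.le hr.2 θ)
  have h7 : zeroExt (ev a) (r * e) = ev a (polarPt hr.1.le hr.2 θ) :=
    zeroExt_coe _ (polarPt hr.1.le hr.2 θ)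
  rw [h7, ← tsum_mul_left, ← eq_sub_iff_add_eq', ← h6.tsum_eq]
  congr 1
  funext n
  have h8 : ((polarPt hr.1.le hr.2 θ : Disc) : ℂ) = r * e := rfl
  rw [h8]
  rcases n with _ | n
  · simp
  · rw [Nat.add_sub_cancel]; ring

/-! ### Inner functions as contractive functions of norm one -/

/-- The square of the norm is the limit of the means over circles. -/
lemma tendsto_mean_norm_sq (a : HSeq) : Tendsto (fun n => (2 * Real.pi)⁻¹ *
    ∫ θ in Set.Ioc (0 : ℝ) (2 * Real.pi),
      ‖ev a (polarPt (radius n).2.1 (radius_lt_one n) θ)‖ ^ 2) atTop (𝓝 (‖a‖ ^ 2)) := by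
  have h1 := fun n => ((hasCoeff_ev a).integral_normSq (radius n).2.1 (radius_lt_one n)).tsum_eq
  simp only [← h1]
  rw [← a.hasSum_norm_sq.tsum_eq]
  refine tendsto_tsum_of_dominated_convergence a.hasSum_norm_sq.summable (fun k => ?_)
    (Eventually.of_forall fun n k => ?_)
  · have h2 := (((tendsto_nhdsWithin_iff.1 tendsto_radius).1).pow (2 * k)).const_mul (‖a k‖ ^ 2)
    simpa using h2
  · rw [Real.norm_of_nonneg (mul_nonneg (sq_nonneg _) (pow_nonneg (radius n).2.1 _))]
    exact mul_le_of_le_one_right (sq_nonneg _)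
      (pow_le_one₀ (radius n).2.1 (radius_lt_one n).le)

lemma ae_of_periodic {Q : ℝ → Prop} (hQ : ∀ (θ : ℝ) (m : ℤ), Q (θ + m • (2 * Real.pi)) → Q θ)
    (h : ∀ᵐ θ ∂volume.restrict (Set.Ioc (0 : ℝ) (2 * Real.pi)), Q θ) : ∀ᵐ θ : ℝ, Q θ := by
  rw [ae_restrict_iff' measurableSet_Ioc] at h
  have h2 : ∀ᵐ θ : ℝ, ∀ m : ℤ, θ + m • (2 * Real.pi) ∈ Set.Ioc (0 : ℝ) (2 * Real.pi) →
      Q (θ + m • (2 * Real.pi)) := ae_all_iff.2 fun m =>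
    (measurePreserving_add_right volume (m • (2 * Real.pi))).quasiMeasurePreserving.ae h
  filter_upwards [h2] with θ hθ
  obtain ⟨m, hm, -⟩ := existsUnique_add_zsmul_mem_Ioc Real.two_pi_pos θ 0
  rw [zero_add] at hm
  exact hQ θ m (hθ m hm)

lemma polarPt_add_zsmul {r : ℝ} (h0 : 0 ≤ r) (h1 : r < 1) (θ : ℝ) (m : ℤ) :
    polarPt h0 h1 (θ + m • (2 * Real.pi)) = polarPt h0 h1 θ := by
  refine Subtype.ext ?_
  have h2 : Complex.exp (((θ + m • (2 * Real.pi) : ℝ) : ℂ) * Complex.I) =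
      Complex.exp (θ * Complex.I) := by
    rw [← Complex.exp_periodic.int_mul m (θ * Complex.I)]
    congr 1
    push_cast [zsmul_eq_mul]
    ring
  change (r : ℂ) * _ = r * _
  rw [h2]

/-- A function bounded by `1` and of norm `1` in the Hardy space is inner. -/
lemma isInner_ev {p : HSeq} (hn : ‖p‖ = 1) (h1 : ∀ z, ‖ev p z‖ ≤ 1) : IsInner (ev p) := by
  refine ⟨isHolo_ev p, h1, ?_⟩
  let u : ℕ → ℝ → ENNReal := fun n θ =>
    ENNReal.ofReal (1 - ‖ev p (polarPt (radius n).2.1 (radius_lt_one n) θ)‖ ^ 2)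
  have hcont : ∀ n, Continuous fun θ => ev p (polarPt (radius n).2.1 (radius_lt_one n) θ) :=
    fun n => (isHolo_ev p).continuous.comp (continuous_polarPt _ _)
  have hum : ∀ n, Measurable (u n) := fun n =>
    (ENNReal.continuous_ofReal.comp (continuous_const.sub ((hcont n).norm.pow 2))).measurable
  have hint : ∀ n, ∫⁻ θ in Set.Ioc (0 : ℝ) (2 * Real.pi), u n θ =
      ENNReal.ofReal (2 * Real.pi * (1 - (2 * Real.pi)⁻¹ * ∫ θ in Set.Ioc (0 : ℝ) (2 * Real.pi),
        ‖ev p (polarPt (radius n).2.1 (radius_lt_one n) θ)‖ ^ 2)) := by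
    intro n
    have hi : IntegrableOn (fun θ => ‖ev p (polarPt (radius n).2.1 (radius_lt_one n) θ)‖ ^ 2)
        (Set.Ioc (0 : ℝ) (2 * Real.pi)) :=
      (((hcont n).norm.pow 2).integrableOn_Icc).mono_set Set.Ioc_subset_Icc_self
    have hi1 : IntegrableOn (fun _ : ℝ => (1 : ℝ)) (Set.Ioc (0 : ℝ) (2 * Real.pi)) :=
      continuous_const.integrableOn_Ioc
    refine (ofReal_integral_eq_lintegral_ofReal (hi1.sub hi)
      (Eventually.of_forall fun θ => ?_)).symm.trans ?_
    swap
    · simp only [Pi.sub_apply]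
      rw [integral_sub hi1 hi]
      congr 1
      have : volume.real (Set.Ioc (0 : ℝ) (2 * Real.pi)) = 2 * Real.pi := by
        rw [Real.volume_real_Ioc_of_le Real.two_pi_pos.le, sub_zero]
      rw [setIntegral_const, this, smul_eq_mul, mul_one, mul_sub, mul_one,
        mul_inv_cancel_left₀ Real.two_pi_pos.ne']
    · simp only [Pi.zero_apply, Pi.sub_apply, sub_nonneg]
      exact pow_le_one₀ (norm_nonneg _) (h1 _)
  have hlim : Tendsto (fun n => ∫⁻ θ in Set.Ioc (0 : ℝ) (2 * Real.pi), u n θ) atTop (𝓝 0) := by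
    simp only [hint]
    have h2 := ((tendsto_mean_norm_sq p).const_sub 1).const_mul (2 * Real.pi)
    rw [hn, one_pow, sub_self, mul_zero] at h2
    rw [← ENNReal.ofReal_zero]
    exact ENNReal.tendsto_ofReal h2
  -- Fatou's lemma: the integrals of `1 - |p|²` over circles tend to a multiple of `1 - ‖p‖² = 0`,
  -- so along almost every radius its liminf is zero; where the radial limit exists, it is
  -- unimodular.
  have h0 : ∫⁻ θ in Set.Ioc (0 : ℝ) (2 * Real.pi), liminf (fun n => u n θ) atTop = 0 := by
    refine le_antisymm ((lintegral_liminf_le hum).trans_eq hlim.liminf_eq) zero_le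
  rw [lintegral_eq_zero_iff (Measurable.liminf hum)] at h0
  have hae : ∀ᵐ θ : ℝ, liminf (fun n => u n θ) atTop = 0 := by
    refine ae_of_periodic (fun θ m h => ?_) h0
    simpa only [u, polarPt_add_zsmul] using h
  filter_upwards [hae, ae_exists_tendsto_radial (C := 1) (by simpa using h1)] with θ hθ hζ
  obtain ⟨ζ, hζ⟩ := hζ
  have h2 : Tendsto (fun n => ev p (polarPt (radius n).2.1 (radius_lt_one n) θ)) atTop (𝓝 ζ) := by
    refine (hζ.comp tendsto_radius).congr fun n => ?_
    exact zeroExt_coe _ (polarPt (radius n).2.1 (radius_lt_one n) θ)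
  have h3 : ‖ζ‖ ≤ 1 := le_of_tendsto' h2.norm fun n => h1 _
  have h4 : Tendsto (fun n => u n θ) atTop (𝓝 (ENNReal.ofReal (1 - ‖ζ‖ ^ 2))) :=
    ENNReal.tendsto_ofReal ((h2.norm.pow 2).const_sub 1)
  rw [h4.liminf_eq, ENNReal.ofReal_eq_zero] at hθ
  refine ⟨ζ, le_antisymm h3 ?_, hζ⟩
  nlinarith [norm_nonneg ζ]

/-- Dominated convergence: unimodular radial limits make the circle means of `|p|²` tend to 1. -/
lemma IsInner.norm_eq_one {p : HSeq} (h : IsInner (ev p)) : ‖p‖ = 1 := by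
  have h1 : Tendsto (fun n => (2 * Real.pi)⁻¹ * ∫ θ in Set.Ioc (0 : ℝ) (2 * Real.pi),
      ‖ev p (polarPt (radius n).2.1 (radius_lt_one n) θ)‖ ^ 2) atTop
        (𝓝 ((2 * Real.pi)⁻¹ * ∫ _ in Set.Ioc (0 : ℝ) (2 * Real.pi), (1 : ℝ))) := by
    refine Tendsto.const_mul _ ?_
    refine tendsto_integral_of_dominated_convergence (fun _ => 1) (fun n => ?_) ?_ (fun n => ?_) ?_
    · refine Continuous.aestronglyMeasurable (Continuous.pow (Continuous.norm ?_) 2)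
      exact (isHolo_ev p).continuous.comp (continuous_polarPt _ _)
    · exact continuous_const.integrableOn_Ioc
    · refine Eventually.of_forall fun θ => ?_
      rw [norm_pow, norm_norm]
      exact pow_le_one₀ (norm_nonneg _) (h.bound _)
    · filter_upwards [ae_restrict_of_ae h.radial] with θ hθ
      obtain ⟨ζ, hζ1, hζ⟩ := hθ
      have h2 : Tendsto (fun n => ev p (polarPt (radius n).2.1 (radius_lt_one n) θ)) atTop
          (𝓝 ζ) := by
        refine (hζ.comp tendsto_radius).congr fun n => ?_
        exact zeroExt_coe _ (polarPt (radius n).2.1 (radius_lt_one n) θ)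
      have h3 := h2.norm.pow 2
      rwa [hζ1, one_pow] at h3
  have h4 := tendsto_nhds_unique h1 (tendsto_mean_norm_sq p)
  have : volume.real (Set.Ioc (0 : ℝ) (2 * Real.pi)) = 2 * Real.pi := by
    rw [Real.volume_real_Ioc_of_le Real.two_pi_pos.le, sub_zero]
  rw [setIntegral_const, this, smul_eq_mul, mul_one, inv_mul_cancel₀ Real.two_pi_pos.ne'] at h4
  exact (pow_eq_one_iff_of_nonneg (norm_nonneg _) two_ne_zero).1 h4.symm

/-! ### The closure in the Hardy space and the conclusion -/

lemma mem_innerMultiples_iff {φ : Disc → ℂ} (hφ : IsHolo φ) (h1 : ∀ z, ‖φ z‖ ≤ 1)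
    {f : Disc → ℂ} : f ∈ innerMultiples φ ↔ ∃ a, ev (mulOp φ hφ h1 a) = f := by
  constructor
  · rintro ⟨h, hh, rfl⟩
    obtain ⟨a, rfl⟩ := exists_ev hh
    exact ⟨a, ev_mulOp hφ h1 a⟩
  · rintro ⟨a, rfl⟩
    exact ⟨ev a, ev_mem_hardySpace a, ev_mulOp hφ h1 a⟩

/-- The closure in the Hardy space of a linear space of functions. -/
noncomputable def hardyClosure (M : Submodule ℂ (Disc → ℂ)) : Submodule ℂ HSeq :=
  (M.comap ev).topologicalClosure

lemma isClosed_hardyClosure (M : Submodule ℂ (Disc → ℂ)) :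
    IsClosed (hardyClosure M : Set HSeq) :=
  (M.comap ev).isClosed_topologicalClosure

lemma mem_hardyClosure_iff {M : Submodule ℂ (Disc → ℂ)} {a : HSeq} :
    a ∈ hardyClosure M ↔ ∃ A : ℕ → HSeq, (∀ n, ev (A n) ∈ M) ∧ Tendsto A atTop (𝓝 a) := by
  rw [hardyClosure, ← SetLike.mem_coe, Submodule.topologicalClosure_coe, mem_closure_iff_seq_limit]
  rfl

lemma mem_hardyClosure {M : Submodule ℂ (Disc → ℂ)} {a : HSeq} (ha : ev a ∈ M) :
    a ∈ hardyClosure M :=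
  mem_hardyClosure_iff.2 ⟨fun _ => a, fun _ => ha, tendsto_const_nhds⟩

section
variable {μ : Measure Disc} {M : Submodule ℂ (Disc → ℂ)}

lemma IsInvariantSubspace.shift_mem (hM : IsInvariantSubspace μ M) :
    ∀ a ∈ hardyClosure M, DirichletDisc.shift a ∈ hardyClosure M := by
  intro a ha
  obtain ⟨A, hA, hlim⟩ := mem_hardyClosure_iff.1 ha
  refine mem_hardyClosure_iff.2 ⟨fun n => DirichletDisc.shift (A n), fun n => ?_,
    (DirichletDisc.shift.continuous.tendsto a).comp hlim⟩
  have h : ev (DirichletDisc.shift (A n)) = fun z : Disc => (z : ℂ) * ev (A n) z := funext fun z => ev_shift _ z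
  rw [h]
  exact hM.shift _ (hA n)

/-- The divisor is Beurling's generator `p` of the closure. For inner `J`, multiplication by `J` is
isometric, so `J H²` is closed; if it contains `M`, it contains the closure and hence `p`. -/
lemma IsInvariantSubspace.exists_isGreatest (hM : IsInvariantSubspace μ M) (hM0 : M ≠ ⊥) :
    ∃ p ∈ hardyClosure M, IsGreatestCommonInnerDivisor M (ev p) := by
  have hN0 : hardyClosure M ≠ ⊥ := by
    intro h
    refine hM0 ((Submodule.eq_bot_iff _).2 fun f hf => ?_)
    obtain ⟨a, rfl⟩ := exists_ev (hM.subset f hf).1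
    have ha := mem_hardyClosure hf
    rw [h, Submodule.mem_bot] at ha
    rw [ha, map_zero]
  obtain ⟨p, hpN, hn, h1, hN⟩ := exists_wandering hM.shift_mem (isClosed_hardyClosure M) hN0
  refine ⟨p, hpN, isInner_ev hn h1, fun f hf => ?_, fun J hJ hJM => ?_⟩
  · obtain ⟨a, rfl⟩ := exists_ev (hM.subset f hf).1
    obtain ⟨b, hb⟩ := hN a (mem_hardyClosure hf)
    exact (mem_innerMultiples_iff (isHolo_ev p) h1).2 ⟨b, by rw [hb]⟩
  · obtain ⟨j, rfl⟩ := exists_ev_of_bound hJ.holo hJ.bound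
    have hc := isClosed_range_mulOp hJ.holo hJ.bound rfl hJ.norm_eq_one
    obtain ⟨A, hA, hlim⟩ := mem_hardyClosure_iff.1 hpN
    obtain ⟨b, hb⟩ := hc.mem_of_tendsto hlim (Eventually.of_forall fun n => by
      obtain ⟨b, hb⟩ := (mem_innerMultiples_iff hJ.holo hJ.bound).1 (hJM _ (hA n))
      exact ⟨b, ev_injective hb⟩)
    exact (mem_innerMultiples_iff hJ.holo hJ.bound).2 ⟨b, by rw [hb]⟩

/-- Being a multiple of `p`, the divisor `I` lies in the shift-invariant closure of `M`, and so does
`I H²`; the functions of `D_μ` in that closure belong to `M`. -/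
lemma IsInvariantSubspace.eq_inter [IsFiniteMeasure μ] (hM : IsInvariantSubspace μ M)
    (hM0 : M ≠ ⊥) {I : Disc → ℂ}
    (hI : IsGreatestCommonInnerDivisor M I) :
    (M : Set (Disc → ℂ)) = innerMultiples I ∩ dirichletSpace μ := by
  refine Set.Subset.antisymm (fun f hf => ⟨hI.dvd f hf, hM.subset f hf⟩) ?_
  rintro f ⟨hfI, hfD⟩
  obtain ⟨q, rfl⟩ := exists_ev_of_bound hI.inner.holo hI.inner.bound
  obtain ⟨p, hpN, hp⟩ := hM.exists_isGreatest hM0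
  obtain ⟨b, hb⟩ := (mem_innerMultiples_iff hp.inner.holo hp.inner.bound).1
    (hI.greatest _ hp.inner hp.dvd)
  have hqN : q ∈ hardyClosure M := by
    rw [← ev_injective hb]
    exact mulOp_mem _ _ rfl (isClosed_hardyClosure M) (shift_pow_mem hM.shift_mem hpN) b
  obtain ⟨a, rfl⟩ := (mem_innerMultiples_iff hI.inner.holo hI.inner.bound).1 hfI
  obtain ⟨A, hA, hlim⟩ := mem_hardyClosure_iff.1 (mulOp_mem hI.inner.holo hI.inner.bound rfl
    (isClosed_hardyClosure M) (shift_pow_mem hM.shift_mem hqN) a)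
  exact hM.mem_of_tendsto_hardy hA hlim hfD

end

end DirichletDisc

theorem mainTheorem10 (μ : MeasureTheory.Measure DirichletDisc.Disc)
    [MeasureTheory.IsFiniteMeasure μ]
    (M : Submodule ℂ (DirichletDisc.Disc → ℂ))
    (hM : DirichletDisc.IsInvariantSubspace μ M) (hM0 : M ≠ ⊥) :
    (∃ I : DirichletDisc.Disc → ℂ, DirichletDisc.IsGreatestCommonInnerDivisor M I) ∧
    ∀ I : DirichletDisc.Disc → ℂ, DirichletDisc.IsGreatestCommonInnerDivisor M I →
      (M : Set (DirichletDisc.Disc → ℂ)) =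
        DirichletDisc.innerMultiples I ∩ DirichletDisc.dirichletSpace μ :=
  ⟨let ⟨p, _, hp⟩ := hM.exists_isGreatest hM0; ⟨DirichletDisc.ev p, hp⟩,
    fun _ hI => hM.eq_inter hM0 hI⟩
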